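/- **Theorem (Avila–Viana Invariance Principle).** Let $(X,\mathcal A,m)$ be a probability space (for instance a Lebesgue space) and let $f:X\to X$ be a bimeasurable bijection that preserves $m$ and is ergodic. Let $\mathcal B\subset\mathcal A$ be a sub-$\sigma$-algebra which is * non-increasing: each set of $f^{-1}\mathcal B$ coincides up to an $m$-null set with a set of $\mathcal B$; * generating: each set of $\mathcal A$ coincides up to an $m$-null set with a set of the $\sigma$-algebra generated by all $f^n\mathcal B$, $n\in\mathbb Z$. *The bundle.* For $x\in X$ let $\mathcal E_x$ be a compact smooth manifold with a Riemannian metric of class $C^2$; the dimensions and the diameters of the $\mathcal E_x$ are bounded. The $\mathcal E_x$ form a bundle over $X$ which is $\mathcal B$-measurable, with uniformly $C^2$-bounded metrics, in the following sense. There are compact smooth manifolds $N_i$, $i\in\mathbb N$, a $\mathcal B$-measurable function $x\mapsto i(x)\in\mathbb N$ and smooth diffeomorphisms $\tau_x:\mathcal E_x\to N_{i(x)}$. They identify $\mathcal E=\{(x,\xi):\xi\in\mathcal E_x\}$ with $\bigsqcup_i\{x:i(x)=i\}\times N_i$, and similarly the fiberwise tangent spaces $\{(x,\xi,v):v\in T_\xi\mathcal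 E_x\}$ with $\bigsqcup_i\{x:i(x)=i\}\times TN_i$. For $\mathcal C=\mathcal A$ or $\mathcal B$, the product of $\mathcal C$ with the Borel $\sigma$-algebras of the $N_i$ (of the $TN_i$) is the $\sigma$-algebra of $\mathcal C$-measurable sets on these spaces. The norm $(x,\xi,v)\mapsto\|v\|$ is $\mathcal B$-measurable. There are constants $r,K>0$ such that each point of each $N_i$ is the center of a smooth chart onto the ball $B(0,r)$ of $\mathbb R^{\dim N_i}$ in which, for all $x$ with $i(x)=i$, the metric of $\mathcal E_x$ transported by $\tau_x$, read as a bilinear form $g_u$ on $\mathbb R^{\dim N_i}$, satisfies $K^{-1}|v|^2\le g_u(v,v)$ and $\|D^j_u\, g_u(v,w)\|\le K|v||w|$ for $0\le j\le 2$, all $u\in B(0,r)$ and all vectors $v,w$. *The dynamics.* Let $F_x:\mathcal E_x\to\mathcal E_{f(x)}$, $x\in X$, be $C^2$-diffeomorphisms such that $\|D_\xi F_x\|$, $\|(D_\xi F_x)^{-1}\|$ and $\|\mathrm{Hess}_\xi F_x\|$ are bounded uniformly in $(x,\xi)$, where $\mathrm{Hess}$ is the second covariant derivative. Assume that $x\mapsto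 F_x$ is $\mathcal B$-measurable, that is, $(x,\xi)\mapsto\tau_{f(x)}F_x\xi\in\bigsqcup_i N_i$ is $\mathcal B$-measurable on $\mathcal E$. Put $F(x,\xi)=(f(x),F_x\xi)$ and $F^{(n)}_x=F_{f^{n-1}x}\circ\dots\circ F_x$. Let $M$ be an ergodic $F$-invariant probability measure on $\mathcal E$ (with its $\mathcal A$-measurable sets) that projects to $m$, with disintegration $M=\int M_x\,dm(x)$, where $M_x$ is, for $m$-a.e. $x$, a probability measure on $\mathcal E_x$. Assume that the smallest fiber exponent $$\gamma^-=-\lim_{n\to\infty}\frac1n\log\|(D_\xi F^{(n)}_x)^{-1}\|$$ (the limit exists and is constant $M$-almost everywhere) satisfies $\gamma^-\ge 0$. Then the disintegration $x\mapsto M_x$ is $\mathcal B$-measurable modulo $m$: there are measures $\kappa_x$ on $\mathcal E_x$, $x\in X$, such that $M_x=\kappa_x$ for $m$-a.e. $x$ and $x\mapsto\kappa_x(S\cap\mathcal E_x)$ is $\mathcal B$-measurable for each $\mathcal B$-measurable set $S\subset\mathcal E$. -/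

import Mathlib

open MeasureTheory Filter Topology Bundle
open scoped Manifold ContDiff ENNReal NNReal

noncomputable section

namespace InvariancePrinciple

/-! ### Riemannian geometry in coordinates -/

section Geometry

variable {k l : ℕ}
  {M : Type*} [TopologicalSpace M] [ChartedSpace (EuclideanSpace ℝ (Fin k)) M]
  [RiemannianBundle (fun ξ : M ↦ TangentSpace (𝓡 k) ξ)]
  {M' : Type*} [TopologicalSpace M'] [ChartedSpace (EuclideanSpace ℝ (Fin l)) M']
  [RiemannianBundle (fun ξ : M' ↦ TangentSpace (𝓡 l) ξ)]

/-- The Riemannian metric of `M` read in a local parametrization `σ` (the inverse of a chart):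
`g_u (v, w) = ⟨D_u σ v, D_u σ w⟩`. -/
def metricCoeff (σ : EuclideanSpace ℝ (Fin k) → M) (u v w : EuclideanSpace ℝ (Fin k)) : ℝ :=
  inner ℝ (mfderiv (𝓡 k) (𝓡 k) σ u v : TangentSpace (𝓡 k) (σ u))
    (mfderiv (𝓡 k) (𝓡 k) σ u w : TangentSpace (𝓡 k) (σ u))

/-- `γ = Γ_u (v, w)` is the value at `u` of the Christoffel symbol of the Levi-Civita connection in
the local parametrization `σ`. It is determined by the Koszul formula
`2 g (Γ (v, w), z) = ∂_v g (w, z) + ∂_w g (v, z) - ∂_z g (v, w)` for all `z`. -/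
def IsChristoffel (σ : EuclideanSpace ℝ (Fin k) → M) (u v w γ : EuclideanSpace ℝ (Fin k)) : Prop :=
  ∀ z, 2 * metricCoeff σ u γ z =
    fderiv ℝ (fun y ↦ metricCoeff σ y w z) u v + fderiv ℝ (fun y ↦ metricCoeff σ y v z) u w
      - fderiv ℝ (fun y ↦ metricCoeff σ y v w) u z

/-- `‖Hess_ξ F‖ ≤ C` at all points `ξ` of `M`, where the Hessian is the second covariant derivative
`∇dF` of the map `F` between Riemannian manifolds. In charts `φ` and `ψ`, with
`G = ψ ∘ F ∘ φ⁻¹`, it is `(v, w) ↦ D²G (v, w) - DG (Γ (v, w)) + Γ' (DG v, DG w)`.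
This does not depend on the charts. -/
def HessianBoundedBy (F : M → M') (C : ℝ) : Prop :=
  ∀ φ ∈ IsManifold.maximalAtlas (𝓡 k) ∞ M, ∀ ψ ∈ IsManifold.maximalAtlas (𝓡 l) ∞ M',
    ∀ u ∈ φ.target, F (φ.symm u) ∈ ψ.source →
      let G : EuclideanSpace ℝ (Fin k) → EuclideanSpace ℝ (Fin l) := fun y ↦ ψ (F (φ.symm y))
      ∀ v w γ γ', IsChristoffel φ.symm u v w γ →
        IsChristoffel ψ.symm (G u) (fderiv ℝ G u v) (fderiv ℝ G u w) γ' →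
        √(metricCoeff ψ.symm (G u) (fderiv ℝ (fderiv ℝ G) u v w - fderiv ℝ G u γ + γ')
            (fderiv ℝ (fderiv ℝ G) u v w - fderiv ℝ G u γ + γ')) ≤
          C * √(metricCoeff φ.symm u v v) * √(metricCoeff φ.symm u w w)

/-- In the local parametrization `σ`, on the ball `B(0, r)`, the metric is `C`-comparable to the
Euclidean one and its coefficients have derivatives of order at most two bounded by `C`. -/
def MetricC2Bounded (σ : EuclideanSpace ℝ (Fin k) → M) (r C : ℝ) : Prop :=
  ∀ u ∈ Metric.ball (0 : EuclideanSpace ℝ (Fin k)) r, ∀ v w : EuclideanSpace ℝ (Fin k),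
    C⁻¹ * ‖v‖ ^ 2 ≤ metricCoeff σ u v v ∧
    ∀ j ≤ 2, ‖iteratedFDeriv ℝ j (fun y ↦ metricCoeff σ y v w) u‖ ≤ C * ‖v‖ * ‖w‖

end Geometry

/-! ### Measurable bundles -/

/-- The total space of a family of fibers. -/
@[ext]
structure FiberTotal {X : Type*} (E : X → Type*) where
  /-- the projection to the base -/
  base : X
  /-- the point in the fiber -/
  point : E base

section Bundles

variable {X : Type*} {E : X → Type*}

/-- The part of a subset of the total space that lies in the fiber over `x`. -/
def slice (S : Set (FiberTotal E)) (x : X) : Set (E x) := {ξ | (⟨x, ξ⟩ : FiberTotal E) ∈ S}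

/-- The map from the total space to `X × ⨆ N i` defined by the identifications
`τ x : E x → N (idx x)` of the fibers with the models `N i`. -/
def coord {idx : X → ℕ} {N : ℕ → Type*} (τ : ∀ x, E x → N (idx x)) (p : FiberTotal E) :
    X × (Σ i, N i) :=
  (p.base, ⟨idx p.base, τ p.base p.point⟩)

/-- The σ-algebra on the total space defined by a σ-algebra `𝓒` on the base and by the
identifications `τ` of the fibers with the models: over the set `{idx = i}` it is the product of
`𝓒` with the Borel σ-algebra of `N i`. -/
@[reducible] def totalSigma {idx : X → ℕ} {N : ℕ → Type*} [∀ i, TopologicalSpace (N i)]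
    (𝓒 : MeasurableSpace X) (τ : ∀ x, E x → N (idx x)) : MeasurableSpace (FiberTotal E) :=
  (𝓒.prod (borel (Σ i, N i))).comap (coord τ)

/-- A family `x ↦ κ x` of measures on the fibers is `𝓒`-measurable, where `𝓜` is the σ-algebra on
the total space that corresponds to `𝓒`. -/
def MeasurableFamily [∀ x, MeasurableSpace (E x)] (𝓒 : MeasurableSpace X)
    (𝓜 : MeasurableSpace (FiberTotal E)) (κ : ∀ x, Measure (E x)) : Prop :=
  ∀ S : Set (FiberTotal E), MeasurableSet[𝓜] S → Measurable[𝓒] fun x ↦ κ x (slice S x)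

/-- `M = ∫ Mx x dm(x)` is a disintegration of `M` along the projection to the base. -/
structure IsDisintegration [∀ x, MeasurableSpace (E x)] [MeasurableSpace X] (m : Measure X)
    {𝓜 : MeasurableSpace (FiberTotal E)} (M : Measure (FiberTotal E)) (Mx : ∀ x, Measure (E x)) : Prop where
  isProbability : ∀ᵐ x ∂m, IsProbabilityMeasure (Mx x)
  aemeasurable : ∀ S : Set (FiberTotal E), MeasurableSet S → AEMeasurable (fun x ↦ Mx x (slice S x)) m
  lintegral_eq : ∀ S : Set (FiberTotal E), MeasurableSet S → M S = ∫⁻ x, Mx x (slice S x) ∂m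

/-- The bundle map `(x, ξ) ↦ (f x, F_x ξ)`. -/
def bundleMap (f : X → X) (F : ∀ x, E x → E (f x)) (p : FiberTotal E) : FiberTotal E :=
  ⟨f p.base, F p.base p.point⟩

/-- The composition `F_{f^{n-1} x} ∘ ⋯ ∘ F_x`. -/
def fiberIter (f : X → X) (F : ∀ x, E x → E (f x)) : ∀ (n : ℕ) (x : X), E x → E (f^[n] x)
  | 0, _ => id
  | n + 1, x => fun ξ ↦ fiberIter f F n (f x) (F x ξ)

/-- The smallest fiber exponent `γ⁻ = - lim (1/n) log ‖(D_ξ F^{(n)}_x)⁻¹‖` at the point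
`p = (x, ξ)`. The limit exists at almost every point by the subadditive ergodic theorem;
the upper limit is used to have a value at each point. -/
def lowerExponent (dim : X → ℕ) [∀ x, TopologicalSpace (E x)]
    [∀ x, ChartedSpace (EuclideanSpace ℝ (Fin (dim x))) (E x)]
    [∀ x, RiemannianBundle (fun ξ : E x ↦ TangentSpace (𝓡 (dim x)) ξ)]
    (f : X → X) (F : ∀ x, E x → E (f x)) (p : FiberTotal E) : ℝ :=
  - limsup (fun n : ℕ ↦ (1 / (n : ℝ)) * Real.log
      ‖(mfderiv (𝓡 (dim p.base)) (𝓡 (dim (f^[n] p.base)))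
        (fiberIter f F n p.base) p.point).inverse‖) atTop

end Bundles

/-- The sub-σ-algebra `𝓑` is finer than `𝓒` modulo `m`-null sets. -/
def FinerMod0 {X : Type*} (𝓑 𝓒 : MeasurableSpace X) [MeasurableSpace X] (m : Measure X) : Prop :=
  ∀ C : Set X, MeasurableSet[𝓒] C → ∃ B : Set X, MeasurableSet[𝓑] B ∧ m (symmDiff B C) = 0

end InvariancePrinciple

end

open InvariancePrinciple

/-!
The proof is an entropy argument. Write `T` for the bundle map, `Y₀` for the position in the fiber,
`𝓖` for the σ-algebra on the total space of the sets over the base that belong to `𝓑` modulo null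
sets, and `𝓣` for the σ-algebra generated by `𝓖` and `Y₀`. Then `T⁻¹ 𝓖 ⊆ 𝓖`, because `𝓑` is
non-increasing, and `T⁻¹ 𝓣 ⊆ 𝓣`, because the fiber maps are `𝓑`-measurable. The main point is that,
for each `U` in `𝓣`, conditioning `T⁻¹ U` on `𝓖` or on the coarser `T⁻¹ 𝓖` gives the same result
(`SameInformation`). By invariance of the measure the law of `Y₀` conditional on `𝓖` is then also its
law conditional on the larger σ-algebras `Tⁿ 𝓖` for all `n`. These generate the ambient σ-algebra of
the base, so that the conditional laws given `𝓑` are the measures of the disintegration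
(`measureReal_inter_eq_setIntegral_condExp`, `exists_measurableFamily_of_setIntegral_condExp`).

*Entropy.* Let `Z` be a variable with `K` values such that, for each `j < n`, the position at time
`0` can be recovered up to a small error from the base point and the value of `Z` at time `j`. The
conditional entropy of `Z ∘ Tⁿ` given `T⁻ᵏ 𝓖`, `k ≤ n`, is non-decreasing in `k` and varies by at
most a multiple of `log (2 K)`. By the convexity of `x log x`, each of the `n` increments controls
one and the same quantity, which measures how much `𝓖` and `T⁻¹ 𝓖` differ as regards the position at
time `1`. Hence this quantity vanishes if `log K / n` can be made arbitrarily small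
(`integral_comp_mul_eq_zero`).

*Few values suffice.* Here the non-negative exponent is used. The inverses of the iterates expand
the fibers at a subexponential rate near most points (`exists_good_set`), so `Z` has to give the
position only with a precision `exp (-θ n)`, where `θ` is arbitrarily small. As the fibers have
finite dimension, there are nets of that precision with at most `exp (C θ n)` points
(`exists_nets_of_lipschitz_charts`, `exists_fine_discretization`).

*Geometry.* The exponent concerns the differentials of the iterates at single points. The bounds on
the Hessians give a second-order Taylor estimate for the iterate of order `N`, uniform over all the
fibers. It converts a bound on the inverse of the differential at `ξ` into a bound on the distances
from `ξ` to the points whose images are `δ N`-close to the image of `ξ`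
(`exists_riemannianDist_le_norm_inverse_mul`). The dependence of `δ N` on `N` is irrelevant, since
long iterates are cut into blocks of one fixed length `N`. Finally the models carry distances to
which the Riemannian distances of all the fibers are comparable (`exists_metricSpace_models`).
-/

namespace InvariancePrinciple

/-! ### Entropy of finite-valued random variables -/

/-- A quantitative form of the convexity of `x log x`, with the squared Hellinger distance as the
remainder. -/
theorem mul_log_sub_mul_log_ge {a b : ℝ} (ha : 0 < a) (hb : 0 < b) :
    (a - b) * (1 + Real.log b) + (√a - √b) ^ 2 ≤ a * Real.log a - b * Real.log b := by
  have hsa := Real.sqrt_pos.2 ha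
  have hsb := Real.sqrt_pos.2 hb
  have h1 : Real.log (√b / √a) ≤ √b / √a - 1 := Real.log_le_sub_one_of_pos (by positivity)
  rw [Real.log_div hsb.ne' hsa.ne', Real.log_sqrt ha.le, Real.log_sqrt hb.le] at h1
  have h2 : a * (√b / √a) = √a * √b := by
    field_simp
    nlinarith [Real.sq_sqrt ha.le]
  have h3 := mul_le_mul_of_nonneg_left h1 ha.le
  nlinarith [Real.sq_sqrt ha.le, Real.sq_sqrt hb.le]

theorem abs_sub_le_sq_sqrt_sub {a b t : ℝ} (ha : 0 ≤ a) (hb : 0 ≤ b) (ht : 0 < t) :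
    |a - b| ≤ (√a - √b) ^ 2 / (2 * t) + t * (a + b) := by
  have h1 : a - b = (√a - √b) * (√a + √b) := by
    nlinarith [Real.sq_sqrt ha, Real.sq_sqrt hb]
  have h2 : 0 ≤ √a + √b := by positivity
  rw [h1, abs_mul, abs_of_nonneg h2, ← sq_abs (√a - √b)]
  set s := |√a - √b|
  have h3 : (√a + √b) ^ 2 ≤ 2 * (a + b) := by
    nlinarith [Real.sq_sqrt ha, Real.sq_sqrt hb, sq_nonneg (√a - √b)]
  have h4 : s * (√a + √b) ≤ s ^ 2 / (2 * t) + t / 2 * (√a + √b) ^ 2 := by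
    have : s ^ 2 / (2 * t) + t / 2 * (√a + √b) ^ 2 - s * (√a + √b)
        = (s - t * (√a + √b)) ^ 2 / (2 * t) := by
      field_simp
      ring
    have : 0 ≤ (s - t * (√a + √b)) ^ 2 / (2 * t) := by positivity
    linarith
  nlinarith

/-- The convex function `x ↦ (x + e) log (x + e)`. The shift by `e > 0` keeps its derivative
bounded on `[0, 1]`. -/
noncomputable def shiftedMulLog (e x : ℝ) : ℝ := (x + e) * Real.log (x + e)

section Entropy

variable {Ω : Type*} {mΩ : MeasurableSpace Ω} {μ : Measure Ω} [IsProbabilityMeasure μ]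

theorem condExp_mem_Icc {𝓖 : MeasurableSpace Ω} (h𝓖 : 𝓖 ≤ mΩ) {u : Ω → ℝ}
    (hu : Integrable u μ) (h0 : ∀ p, 0 ≤ u p) (h1 : ∀ p, u p ≤ 1) :
    ∀ᵐ p ∂μ, μ[u|𝓖] p ∈ Set.Icc (0 : ℝ) 1 := by
  have ha : 0 ≤ᵐ[μ] μ[u|𝓖] := condExp_nonneg (Eventually.of_forall h0)
  have hb : μ[u|𝓖] ≤ᵐ[μ] μ[(fun _ => (1 : ℝ))|𝓖] :=
    condExp_mono hu (integrable_const _) (Eventually.of_forall h1)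
  rw [condExp_const h𝓖] at hb
  filter_upwards [ha, hb] with p h h' using ⟨h, h'⟩

theorem abs_log_add_le {e x : ℝ} (he : 0 < e) (hx : x ∈ Set.Icc (0 : ℝ) 1) :
    |Real.log (x + e)| ≤ |Real.log e| + |Real.log (1 + e)| := by
  have h1 : Real.log e ≤ Real.log (x + e) := Real.log_le_log he (by linarith [hx.1])
  have h2 : Real.log (x + e) ≤ Real.log (1 + e) :=
    Real.log_le_log (by linarith [hx.1]) (by linarith [hx.2])
  rw [abs_le]
  constructor
  · linarith [neg_abs_le (Real.log e), abs_nonneg (Real.log (1 + e))]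
  · linarith [le_abs_self (Real.log (1 + e)), abs_nonneg (Real.log e)]

theorem integrable_shiftedMulLog {q : Ω → ℝ} (hq : AEStronglyMeasurable q μ)
    (hq1 : ∀ᵐ p ∂μ, q p ∈ Set.Icc (0 : ℝ) 1) {e : ℝ} (he : 0 < e) :
    Integrable (fun p => shiftedMulLog e (q p)) μ := by
  have hq' := hq.aemeasurable
  refine Integrable.of_bound (C := (1 + e) * (|Real.log e| + |Real.log (1 + e)|)) ?_ ?_
  · unfold shiftedMulLog
    exact AEMeasurable.aestronglyMeasurable (by fun_prop)
  · filter_upwards [hq1] with p h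
    rw [shiftedMulLog, Real.norm_eq_abs, abs_mul]
    have h2 : |q p + e| ≤ 1 + e := by
      rw [abs_of_nonneg (by linarith [h.1])]; linarith [h.2]
    exact mul_le_mul h2 (abs_log_add_le he h) (abs_nonneg _) (by linarith)

/-- The entropy lost by coarsening a σ-algebra controls the `L¹` distance between the two
conditional expectations. -/
theorem integral_abs_condExp_sub_le {𝓖 𝓖' : MeasurableSpace Ω} (h𝓖 : 𝓖 ≤ mΩ) (h' : 𝓖' ≤ 𝓖)
    {u : Ω → ℝ} (hu : Integrable u μ) (h0 : ∀ p, 0 ≤ u p) (h1 : ∀ p, u p ≤ 1)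
    {e t : ℝ} (he : 0 < e) (ht : 0 < t) :
    ∫ p, |μ[u|𝓖] p - μ[u|𝓖'] p| ∂μ ≤
      (∫ p, shiftedMulLog e (μ[u|𝓖] p) ∂μ - ∫ p, shiftedMulLog e (μ[u|𝓖'] p) ∂μ) / (2 * t)
        + 2 * t * (∫ p, u p ∂μ + e) := by
  set q := μ[u|𝓖] with hq
  set q' := μ[u|𝓖'] with hq'
  have hqI : Integrable q μ := integrable_condExp
  have hqI' : Integrable q' μ := integrable_condExp
  have hq1 := condExp_mem_Icc h𝓖 hu h0 h1
  have hq1' := condExp_mem_Icc (h'.trans h𝓖) hu h0 h1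
  set g : Ω → ℝ := fun p => 1 + Real.log (q' p + e) with hg
  have hgm : StronglyMeasurable[𝓖'] g := by
    have : Measurable[𝓖'] q' := stronglyMeasurable_condExp.measurable
    have h2 : Measurable[𝓖'] g := by
      exact measurable_const.add ((this.add measurable_const).log)
    exact h2.stronglyMeasurable
  have hgb : ∀ᵐ p ∂μ, ‖g p‖ ≤ 1 + (|Real.log e| + |Real.log (1 + e)|) := by
    filter_upwards [hq1'] with p h
    rw [hg, Real.norm_eq_abs]
    refine (abs_add_le _ _).trans ?_
    rw [abs_one]
    linarith [abs_log_add_le he h]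
  have hgm' : AEStronglyMeasurable[mΩ] g μ := (hgm.mono (h'.trans h𝓖)).aestronglyMeasurable
  have hgq : Integrable (g * q) μ := hqI.bdd_mul hgm' hgb
  have hgq' : Integrable (g * q') μ := hqI'.bdd_mul hgm' hgb
  have hpull : ∫ p, (g * q) p ∂μ = ∫ p, (g * q') p ∂μ := by
    have a1 := condExp_mul_of_stronglyMeasurable_left hgm hgq hqI
    have a2 : μ[q|𝓖'] =ᵐ[μ] q' := condExp_condExp_of_le h' h𝓖
    rw [← integral_condExp (h'.trans h𝓖)]
    refine integral_congr_ae ?_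
    filter_upwards [a1, a2] with p b1 b2
    rw [b1, Pi.mul_apply, Pi.mul_apply, b2]
  have hΦ := integrable_shiftedMulLog hqI.1 hq1 he
  have hΦ' := integrable_shiftedMulLog hqI'.1 hq1' he
  have key : ∀ᵐ p ∂μ, |q p - q' p| ≤
      (shiftedMulLog e (q p) - shiftedMulLog e (q' p) - (g * q) p + (g * q') p) / (2 * t)
        + t * (q p + q' p + 2 * e) := by
    filter_upwards [hq1, hq1'] with p h h'
    have ha : 0 < q p + e := by linarith [h.1]
    have hb : 0 < q' p + e := by linarith [h'.1]
    have e1 := mul_log_sub_mul_log_ge ha hb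
    have e2 := abs_sub_le_sq_sqrt_sub ha.le hb.le ht
    have e3 : (√(q p + e) - √(q' p + e)) ^ 2 ≤
        shiftedMulLog e (q p) - shiftedMulLog e (q' p) - (g * q) p + (g * q') p := by
      simp only [shiftedMulLog, Pi.mul_apply, hg]
      nlinarith
    have e4 := div_le_div_of_nonneg_right e3 (by positivity : 0 ≤ 2 * t)
    have e5 : q p + e - (q' p + e) = q p - q' p := by ring
    rw [e5] at e2
    nlinarith
  have hint1 : Integrable (fun p => shiftedMulLog e (q p) - shiftedMulLog e (q' p)
      - (g * q) p + (g * q') p) μ := ((hΦ.sub hΦ').sub hgq).add hgq'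
  have hint2 : Integrable (fun p => t * (q p + q' p + 2 * e)) μ :=
    ((hqI.add hqI').add (integrable_const _)).const_mul t
  have i1 : ∫ p, (shiftedMulLog e (q p) - shiftedMulLog e (q' p) - (g * q) p + (g * q') p) ∂μ
      = ∫ p, shiftedMulLog e (q p) ∂μ - ∫ p, shiftedMulLog e (q' p) ∂μ := by
    have j1 : Integrable (fun p => shiftedMulLog e (q p) - shiftedMulLog e (q' p)) μ := hΦ.sub hΦ'
    have j2 : Integrable (fun p => shiftedMulLog e (q p) - shiftedMulLog e (q' p)
      - (g * q) p) μ := j1.sub hgq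
    rw [integral_add j2 hgq', integral_sub j1 hgq, integral_sub hΦ hΦ', hpull]
    ring
  have i2 : ∫ p, t * (q p + q' p + 2 * e) ∂μ = 2 * t * (∫ p, u p ∂μ + e) := by
    have j1 : Integrable (fun p => q p + q' p) μ := hqI.add hqI'
    rw [integral_const_mul, integral_add j1 (integrable_const _), integral_add hqI hqI', hq, hq',
      integral_condExp h𝓖, integral_condExp (h'.trans h𝓖)]
    simp
    ring
  rw [← i1, ← i2, ← integral_div, ← integral_add (hint1.div_const _) hint2]
  exact integral_mono_ae (hqI.sub hqI').abs ((hint1.div_const _).add hint2) key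

/-- The indicator function of the event `Z = z`. -/
noncomputable def eventInd {K : ℕ} (Z : Ω → Fin K) (z : Fin K) : Ω → ℝ :=
  (Z ⁻¹' {z}).indicator fun _ => 1

theorem eventInd_nonneg {K : ℕ} (Z : Ω → Fin K) (z : Fin K) (p : Ω) : 0 ≤ eventInd Z z p :=
  Set.indicator_nonneg (fun _ _ => zero_le_one) _

theorem eventInd_le_one {K : ℕ} (Z : Ω → Fin K) (z : Fin K) (p : Ω) : eventInd Z z p ≤ 1 :=
  Set.indicator_le_self' (fun _ _ => zero_le_one) _

theorem sum_eventInd {K : ℕ} (Z : Ω → Fin K) (h : Fin K → ℝ) (p : Ω) :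
    ∑ z, h z * eventInd Z z p = h (Z p) := by
  rw [Finset.sum_eq_single (Z p)]
  · simp [eventInd]
  · intro b _ hb
    simp [eventInd, hb.symm]
  · simp

theorem integrable_eventInd {K : ℕ} {Z : Ω → Fin K} (hZ : Measurable Z) (z : Fin K) :
    Integrable (eventInd Z z) μ :=
  (integrable_const (1 : ℝ)).indicator (hZ (measurableSet_singleton z))

/-- The (shifted) entropy of a finite-valued random variable conditional on a σ-algebra, with the
opposite sign. -/
noncomputable def negEntropy {K : ℕ} (μ : Measure Ω) (Z : Ω → Fin K) (𝓖 : MeasurableSpace Ω) : ℝ :=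
  ∑ z, ∫ p, shiftedMulLog (1 / K) (μ[eventInd Z z|𝓖] p) ∂μ

theorem sum_integral_eventInd {K : ℕ} {Z : Ω → Fin K} (hZ : Measurable Z) :
    ∑ z, ∫ p, eventInd Z z p ∂μ = 1 := by
  rw [← integral_finsetSum _ fun z _ => integrable_eventInd hZ z]
  have : (fun p => ∑ z, eventInd Z z p) = fun _ => (1 : ℝ) := by
    ext p
    simpa using sum_eventInd Z (fun _ => 1) p
  rw [this]
  simp

theorem sum_integral_abs_condExp_sub_le {K : ℕ} {Z : Ω → Fin K} (hZ : Measurable Z)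
    {𝓖 𝓖' : MeasurableSpace Ω} (h𝓖 : 𝓖 ≤ mΩ) (h' : 𝓖' ≤ 𝓖) {t : ℝ} (ht : 0 < t) :
    ∑ z, ∫ p, |μ[eventInd Z z|𝓖] p - μ[eventInd Z z|𝓖'] p| ∂μ ≤
      (negEntropy μ Z 𝓖 - negEntropy μ Z 𝓖') / (2 * t) + 4 * t := by
  have hK : 0 < K := by
    obtain ⟨p⟩ : Nonempty Ω := μ.nonempty_of_neZero
    exact (Nat.zero_le _).trans_lt (Z p).2
  have hK' : (0 : ℝ) < 1 / K := by positivity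
  refine (Finset.sum_le_sum fun z _ => integral_abs_condExp_sub_le h𝓖 h' (integrable_eventInd hZ z)
    (eventInd_nonneg Z z) (eventInd_le_one Z z) hK' ht).trans (le_of_eq ?_)
  rw [Finset.sum_add_distrib, ← Finset.sum_div, Finset.sum_sub_distrib, ← Finset.mul_sum,
    Finset.sum_add_distrib, sum_integral_eventInd hZ]
  simp only [negEntropy, Finset.sum_const, Finset.card_univ, Fintype.card_fin, nsmul_eq_mul]
  have : (K : ℝ) * (1 / K) = 1 := by field_simp
  rw [this]
  ring

/-- The entropy of a variable with `K` values varies by at most `2 log (2 K)`. -/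
theorem negEntropy_sub_le {K : ℕ} {Z : Ω → Fin K} (hZ : Measurable Z)
    {𝓖 𝓖' : MeasurableSpace Ω} (h𝓖 : 𝓖 ≤ mΩ) (h𝓖' : 𝓖' ≤ mΩ) :
    negEntropy μ Z 𝓖 - negEntropy μ Z 𝓖' ≤ 2 * Real.log (2 * K) := by
  have hK : 0 < K := by
    obtain ⟨p⟩ : Nonempty Ω := μ.nonempty_of_neZero
    exact (Nat.zero_le _).trans_lt (Z p).2
  have hK1 : (1 : ℝ) ≤ K := by exact_mod_cast hK
  have hK' : (0 : ℝ) < 1 / K := by positivity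
  have hK2 : (1 : ℝ) / K ≤ 1 := by rw [div_le_one (by positivity)]; exact hK1
  have hsum : ∀ 𝓗 : MeasurableSpace Ω, 𝓗 ≤ mΩ →
      ∑ z, ∫ p, (μ[eventInd Z z|𝓗] p + 1 / K) ∂μ = 2 := by
    intro 𝓗 h
    have : ∀ z, ∫ p, (μ[eventInd Z z|𝓗] p + 1 / K) ∂μ = ∫ p, eventInd Z z p ∂μ + 1 / K := by
      intro z
      rw [integral_add integrable_condExp (integrable_const _), integral_condExp h]
      simp
    simp_rw [this]
    rw [Finset.sum_add_distrib, sum_integral_eventInd hZ]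
    simp only [Finset.sum_const, Finset.card_univ, Fintype.card_fin, nsmul_eq_mul]
    field_simp
    norm_num
  have hm := fun (𝓗 : MeasurableSpace Ω) (h : 𝓗 ≤ mΩ) z =>
    condExp_mem_Icc h (integrable_eventInd (μ := μ) hZ z) (eventInd_nonneg Z z) (eventInd_le_one Z z)
  have hup : negEntropy μ Z 𝓖 ≤ 2 * Real.log 2 := by
    have e2 : 2 * Real.log 2 =
        (∑ z, ∫ p, (μ[eventInd Z z|𝓖] p + 1 / K) ∂μ) * Real.log 2 := by rw [hsum 𝓖 h𝓖]
    rw [e2, Finset.sum_mul]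
    refine Finset.sum_le_sum fun z _ => ?_
    rw [← integral_mul_const]
    refine integral_mono_ae (integrable_shiftedMulLog integrable_condExp.1 (hm 𝓖 h𝓖 z) hK')
      ((integrable_condExp.add (integrable_const _)).mul_const _) ?_
    filter_upwards [hm 𝓖 h𝓖 z] with p h
    have := h.1
    have := h.2
    exact mul_le_mul_of_nonneg_left (Real.log_le_log (by positivity) (by linarith)) (by positivity)
  have hlo : 2 * Real.log (1 / K) ≤ negEntropy μ Z 𝓖' := by
    rw [← hsum 𝓖' h𝓖', Finset.sum_mul]
    refine Finset.sum_le_sum fun z _ => ?_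
    rw [← integral_mul_const]
    refine integral_mono_ae ((integrable_condExp.add (integrable_const _)).mul_const _)
      (integrable_shiftedMulLog integrable_condExp.1 (hm 𝓖' h𝓖' z) hK') ?_
    filter_upwards [hm 𝓖' h𝓖' z] with p h
    have := h.1
    exact mul_le_mul_of_nonneg_left (Real.log_le_log (by positivity) (by linarith)) (by positivity)
  rw [Real.log_div one_ne_zero (by positivity), Real.log_one] at hlo
  rw [Real.log_mul two_ne_zero (by positivity)]
  linarith

end Entropy

/-! ### The one-step comparison of conditional entropies -/

section OneStep

variable {Ω : Type*} {𝓖 : MeasurableSpace Ω} {mΩ : MeasurableSpace Ω} {M : Measure Ω}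

theorem integral_comp_of_measurePreserving {S : Ω → Ω} (hS : MeasurePreserving S M M) {φ : Ω → ℝ}
    (hφ : Measurable φ) : ∫ p, φ (S p) ∂M = ∫ p, φ p ∂M := by
  have hm : AEStronglyMeasurable[mΩ] φ (M.map S) := hφ.aestronglyMeasurable
  rw [← integral_map hS.measurable.aemeasurable hm, hS.map_eq]

theorem setIntegral_comp_of_measurePreserving {S : Ω → Ω} (hS : MeasurePreserving S M M)
    {φ : Ω → ℝ} (hφ : Measurable φ) {B : Set Ω} (hB : MeasurableSet B) :
    ∫ p in S ⁻¹' B, φ (S p) ∂M = ∫ p in B, φ p ∂M := by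
  rw [← integral_indicator hB, ← integral_indicator (hS.measurable hB),
    ← integral_comp_of_measurePreserving hS (hφ.indicator hB)]
  rfl

variable [IsProbabilityMeasure M]

theorem integrable_of_abs_le_one {w : Ω → ℝ} (hw : Measurable w) (hb : ∀ p, |w p| ≤ 1) :
    Integrable w M :=
  Integrable.of_bound hw.aestronglyMeasurable 1 (Eventually.of_forall hb)

/-- Pull-out property of the conditional expectation, in integrated form. -/
theorem integral_mul_condExp {𝓗 : MeasurableSpace Ω} (h𝓗 : 𝓗 ≤ mΩ) {b u : Ω → ℝ}
    (hb : Measurable[𝓗] b) {C : ℝ} (hb1 : ∀ᵐ p ∂M, ‖b p‖ ≤ C) (hu : Integrable u M) :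
    ∫ p, b p * u p ∂M = ∫ p, b p * M[u|𝓗] p ∂M := by
  have hbm : AEStronglyMeasurable[mΩ] b M := (hb.mono h𝓗 le_rfl).aestronglyMeasurable
  have h1 : Integrable (b * u) M := hu.bdd_mul hbm hb1
  have h2 := condExp_mul_of_stronglyMeasurable_left hb.stronglyMeasurable h1 hu
  have h3 := integral_condExp h𝓗 (f := b * u) (μ := M)
  rw [integral_congr_ae h2] at h3
  exact h3.symm

theorem integral_mul_eq_zero_of_setIntegral_eq_zero {𝓗 : MeasurableSpace Ω} (h𝓗 : 𝓗 ≤ mΩ)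
    {b w : Ω → ℝ} (hb : Measurable[𝓗] b) {C : ℝ} (hb1 : ∀ᵐ p ∂M, ‖b p‖ ≤ C)
    (hw : Integrable w M) (hw0 : ∀ G, MeasurableSet[𝓗] G → ∫ p in G, w p ∂M = 0) :
    ∫ p, b p * w p ∂M = 0 := by
  have h0 : (fun _ => (0 : ℝ)) =ᵐ[M] M[w|𝓗] := by
    refine ae_eq_condExp_of_forall_setIntegral_eq h𝓗 hw (fun _ _ _ => integrableOn_const) ?_ ?_
    · intro s hs _
      rw [hw0 s hs]
      simp
    · exact stronglyMeasurable_const.aestronglyMeasurable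
  rw [integral_mul_condExp h𝓗 hb hb1 hw]
  rw [integral_congr_ae (g := fun _ => (0 : ℝ))]
  · simp
  · filter_upwards [h0] with p hp
    rw [← hp, mul_zero]

variable {T : Ω → Ω}

theorem comap_iterate_succ_le (hdec : 𝓖.comap T ≤ 𝓖) (n : ℕ) :
    𝓖.comap T^[n + 1] ≤ 𝓖.comap T^[n] := by
  rw [Function.iterate_succ', ← MeasurableSpace.comap_comp]
  exact MeasurableSpace.comap_mono hdec

theorem comap_iterate_le (hT : Measurable T) (h𝓖 : 𝓖 ≤ mΩ) (n : ℕ) :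
    𝓖.comap T^[n] ≤ mΩ :=
  (MeasurableSpace.comap_mono h𝓖).trans (hT.iterate n).comap_le

/-- Let `g` be approximable, up to small errors, by functions of a discretization `Z` of the
`j`-th iterate of the point and of the σ-algebra `𝓖`, uniformly in `j < n`, where the logarithm of
the number of values of `Z` is small compared to `n`. Then `g ∘ T` does not see the difference
between `𝓖` and `T⁻¹ 𝓖`. The entropy of `Z ∘ T^n` conditional on `T⁻ᵏ 𝓖` increases with `k`, by an
amount that does not depend on `k` up to small errors, and it cannot exceed `log K`. -/
theorem integral_comp_mul_eq_zero (hT : MeasurePreserving T M M) (h𝓖 : 𝓖 ≤ mΩ)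
    (hdec : 𝓖.comap T ≤ 𝓖) {g : Ω → ℝ} (hg : Measurable g) (hg1 : ∀ p, |g p| ≤ 1)
    (hfine : ∀ ε > 0, ∃ n : ℕ, 0 < n ∧ ∃ K : ℕ, ∃ Z : Ω → Fin K, Measurable Z ∧
      2 * Real.log (2 * K) ≤ ε * n ∧ ∀ j < n, ∃ h : Fin K → Ω → ℝ,
        (∀ z, Measurable[𝓖] (h z)) ∧ (∀ z p, |h z p| ≤ 1) ∧
        ∫ p, |g p - h (Z (T^[j] p)) p| ∂M ≤ ε)
    {w : Ω → ℝ} (hw : Measurable[𝓖] w) (hw1 : ∀ p, |w p| ≤ 1)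
    (hw0 : ∀ G, MeasurableSet[𝓖.comap T] G → ∫ p in G, w p ∂M = 0) :
    ∫ p, g (T p) * w p ∂M = 0 := by
  set I := ∫ p, g (T p) * w p ∂M with hI
  have hTk := fun k => hT.iterate k
  have hbound : ∀ ε > 0, ∀ t > 0, |I| ≤ ε + (ε / (2 * t) + 4 * t) := by
    intro ε hε t ht
    obtain ⟨n, hn, K, Z', hZ', hK, hj⟩ := hfine ε hε
    set Z : Ω → Fin K := Z' ∘ T^[n] with hZdef
    have hZ : Measurable Z := hZ'.comp (hT.measurable.iterate n)
    set G : ℕ → MeasurableSpace Ω := fun k => 𝓖.comap T^[k] with hG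
    have hGle : ∀ k, G k ≤ mΩ := comap_iterate_le hT.measurable h𝓖
    have hGdec : ∀ k, G (k + 1) ≤ G k := comap_iterate_succ_le hdec
    have hk : ∀ k < n, |I| ≤ ε +
        ((negEntropy M Z (G k) - negEntropy M Z (G (k + 1))) / (2 * t) + 4 * t) := by
      intro k hkn
      obtain ⟨h, hhm, hh1, hherr⟩ := hj (n - k - 1) (by omega)
      set wk : Ω → ℝ := w ∘ T^[k] with hwk
      have hwkm : Measurable[G k] wk := @Measurable.comp Ω Ω ℝ (G k) 𝓖 _ _ _ hw
        (comap_measurable _)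
      have hwkm' : Measurable[mΩ] wk := hwkm.mono (hGle k) le_rfl
      have hwk1 : ∀ p, |wk p| ≤ 1 := fun p => hw1 _
      have hwk0 : ∀ A, MeasurableSet[G (k + 1)] A → ∫ p in A, wk p ∂M = 0 := by
        intro A hA
        have hA' : MeasurableSet[(𝓖.comap T).comap T^[k]] A := by
          rw [MeasurableSpace.comap_comp, ← Function.iterate_succ']
          exact hA
        obtain ⟨B, hB, rfl⟩ := hA'
        rw [← hw0 B hB]
        exact setIntegral_comp_of_measurePreserving (hTk k) (hw.mono h𝓖 le_rfl)
          ((hdec.trans h𝓖) _ hB)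
      set hk : Fin K → Ω → ℝ := fun z => h z ∘ T^[k + 1] with hhk
      have hhkm : ∀ z, Measurable[G (k + 1)] (hk z) := fun z =>
        @Measurable.comp Ω Ω ℝ (G (k + 1)) 𝓖 _ _ _ (hhm z) (comap_measurable _)
      have hhk1 : ∀ z p, |hk z p| ≤ 1 := fun z p => hh1 _ _
      have hhkm' : ∀ z, Measurable[mΩ] (hk z) := fun z => (hhkm z).mono (hGle _) le_rfl
      -- by invariance of the measure
      have hIk : I = ∫ p, g (T^[k + 1] p) * wk p ∂M := by
        rw [hI, ← integral_comp_of_measurePreserving (φ := fun p => g (T p) * w p) (hTk k)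
          ((hg.comp hT.measurable).mul (hw.mono h𝓖 le_rfl))]
        simp only [hwk, Function.comp_apply, Function.iterate_succ_apply']
      have herr : ∫ p, |g (T^[k + 1] p) - hk (Z p) p| ∂M ≤ ε := by
        have hm0 : Measurable fun p => h (Z' (T^[n - k - 1] p)) p := by
          have : (fun p => h (Z' (T^[n - k - 1] p)) p) =
              fun p => ∑ z, h z p * eventInd (Z' ∘ T^[n - k - 1]) z p := by
            ext p
            exact (sum_eventInd (Z' ∘ T^[n - k - 1]) (fun z => h z p) p).symm
          rw [this]
          refine Finset.measurable_sum _ fun z _ => ((hhm z).mono h𝓖 le_rfl).mul ?_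
          exact measurable_const.indicator
            ((hZ'.comp (hT.measurable.iterate _)) (measurableSet_singleton z))
        refine le_of_eq_of_le ?_ hherr
        rw [← integral_comp_of_measurePreserving (φ := fun p => |g p - h (Z' (T^[n - k - 1] p)) p|)
          (hTk (k + 1)) (hg.sub hm0).abs]
        refine integral_congr_ae (Eventually.of_forall fun p => ?_)
        simp only [hhk, hZdef, Function.comp_apply, ← Function.iterate_add_apply]
        rw [show n - k - 1 + (k + 1) = n by omega]
      have hmZ : ∀ z, Measurable (eventInd Z z) := fun z =>
        measurable_const.indicator (hZ (measurableSet_singleton z))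
      have hprodI : ∀ z, Integrable (fun p => hk z p * wk p * eventInd Z z p) M := by
        intro z
        refine integrable_of_abs_le_one (((hhkm' z).mul hwkm').mul (hmZ z)) fun p => ?_
        rw [abs_mul, abs_mul, abs_of_nonneg (eventInd_nonneg Z z p)]
        exact mul_le_one₀ (mul_le_one₀ (hhk1 z p) (abs_nonneg _) (hwk1 p))
          (eventInd_nonneg Z z p) (eventInd_le_one Z z p)
      have hmhZ : Measurable fun p => hk (Z p) p := by
        have : (fun p => hk (Z p) p) = fun p => ∑ z, hk z p * eventInd Z z p := by
          ext p
          exact (sum_eventInd Z (fun z => hk z p) p).symm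
        rw [this]
        exact Finset.measurable_sum _ fun z _ => (hhkm' z).mul (hmZ z)
      have hgk : Measurable fun p => g (T^[k + 1] p) := hg.comp (hT.measurable.iterate _)
      have hterm : ∀ z, |∫ p, hk z p * wk p * eventInd Z z p ∂M| ≤
          ∫ p, |M[eventInd Z z|G k] p - M[eventInd Z z|G (k + 1)] p| ∂M := by
        intro z
        have e1 : ∫ p, hk z p * wk p * eventInd Z z p ∂M
            = ∫ p, hk z p * wk p * M[eventInd Z z|G k] p ∂M := by
          refine integral_mul_condExp (hGle k) (C := 1)
            (((hhkm z).mono (hGdec k) le_rfl).mul hwkm) (Eventually.of_forall fun p => ?_)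
            (integrable_eventInd hZ z)
          rw [Real.norm_eq_abs, abs_mul]
          exact mul_le_one₀ (hhk1 z p) (abs_nonneg _) (hwk1 p)
        have hq' := condExp_mem_Icc (hGle (k + 1)) (integrable_eventInd (μ := M) hZ z)
          (eventInd_nonneg Z z) (eventInd_le_one Z z)
        have e2 : ∫ p, (hk z p * M[eventInd Z z|G (k + 1)] p) * wk p ∂M = 0 := by
          refine integral_mul_eq_zero_of_setIntegral_eq_zero (hGle (k + 1)) (C := 1)
            ((hhkm z).mul stronglyMeasurable_condExp.measurable) ?_
            (integrable_of_abs_le_one hwkm' hwk1) hwk0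
          filter_upwards [hq'] with p hp
          rw [Real.norm_eq_abs, abs_mul]
          exact mul_le_one₀ (hhk1 z p) (abs_nonneg _) (by rw [abs_of_nonneg hp.1]; exact hp.2)
        have hI1 : Integrable (fun p => hk z p * wk p * M[eventInd Z z|G k] p) M := by
          refine integrable_condExp.bdd_mul (c := 1)
            ((hhkm' z).mul hwkm').aestronglyMeasurable (Eventually.of_forall fun p => ?_)
          rw [Real.norm_eq_abs, abs_mul]
          exact mul_le_one₀ (hhk1 z p) (abs_nonneg _) (hwk1 p)
        have hI2 : Integrable (fun p => hk z p * wk p * M[eventInd Z z|G (k + 1)] p) M := by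
          refine integrable_condExp.bdd_mul (c := 1)
            ((hhkm' z).mul hwkm').aestronglyMeasurable (Eventually.of_forall fun p => ?_)
          rw [Real.norm_eq_abs, abs_mul]
          exact mul_le_one₀ (hhk1 z p) (abs_nonneg _) (hwk1 p)
        have e3 : ∫ p, hk z p * wk p * M[eventInd Z z|G (k + 1)] p ∂M = 0 := by
          rw [← e2]
          refine integral_congr_ae (Eventually.of_forall fun p => ?_)
          simp only
          ring
        rw [e1, ← sub_zero (∫ p, hk z p * wk p * M[eventInd Z z|G k] p ∂M), ← e3,
          ← integral_sub hI1 hI2]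
        refine (abs_integral_le_integral_abs).trans (integral_mono_ae (hI1.sub hI2).abs
          (integrable_condExp.sub integrable_condExp).abs (Eventually.of_forall fun p => ?_))
        beta_reduce
        rw [← mul_sub, abs_mul]
        refine mul_le_of_le_one_left (abs_nonneg _) ?_
        rw [abs_mul]
        exact mul_le_one₀ (hhk1 z p) (abs_nonneg _) (hwk1 p)
      have hsum : ∫ p, hk (Z p) p * wk p ∂M = ∑ z, ∫ p, hk z p * wk p * eventInd Z z p ∂M := by
        rw [← integral_finsetSum _ fun z _ => hprodI z]
        refine integral_congr_ae (Eventually.of_forall fun p => ?_)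
        exact (sum_eventInd Z (fun z => hk z p * wk p) p).symm
      have hA : |∫ p, hk (Z p) p * wk p ∂M| ≤
          (negEntropy M Z (G k) - negEntropy M Z (G (k + 1))) / (2 * t) + 4 * t := by
        rw [hsum]
        exact (Finset.abs_sum_le_sum_abs _ _).trans ((Finset.sum_le_sum fun z _ => hterm z).trans
          (sum_integral_abs_condExp_sub_le hZ (hGle k) (hGdec k) ht))
      have i1 : Integrable (fun p => g (T^[k + 1] p) * wk p) M :=
        integrable_of_abs_le_one (hgk.mul hwkm') fun p => by
          rw [abs_mul]; exact mul_le_one₀ (hg1 _) (abs_nonneg _) (hwk1 p)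
      have i2 : Integrable (fun p => hk (Z p) p * wk p) M :=
        integrable_of_abs_le_one (hmhZ.mul hwkm') fun p => by
          rw [abs_mul]; exact mul_le_one₀ (hhk1 _ _) (abs_nonneg _) (hwk1 p)
      have i3 : Integrable (fun p => |g (T^[k + 1] p) - hk (Z p) p|) M :=
        ((integrable_of_abs_le_one hgk fun p => hg1 _).sub
          (integrable_of_abs_le_one hmhZ fun p => hhk1 _ _)).abs
      have hB : |I - ∫ p, hk (Z p) p * wk p ∂M| ≤ ε := by
        rw [hIk, ← integral_sub i1 i2]
        refine (abs_integral_le_integral_abs).trans (le_trans (integral_mono_ae (i1.sub i2).abs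
          i3 (Eventually.of_forall fun p => ?_)) herr)
        beta_reduce
        rw [← sub_mul, abs_mul]
        exact mul_le_of_le_one_right (abs_nonneg _) (hwk1 p)
      have := abs_add_le (I - ∫ p, hk (Z p) p * wk p ∂M) (∫ p, hk (Z p) p * wk p ∂M)
      rw [sub_add_cancel] at this
      linarith
    -- the sum of the increments telescopes
    have hsum := Finset.sum_le_sum fun k (hkn : k ∈ Finset.range n) => hk k (Finset.mem_range.1 hkn)
    rw [Finset.sum_add_distrib, Finset.sum_add_distrib, ← Finset.sum_div,
      Finset.sum_range_sub' (fun k => negEntropy M Z (G k)) n] at hsum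
    simp only [Finset.sum_const, Finset.card_range, nsmul_eq_mul] at hsum
    have hent := (negEntropy_sub_le (μ := M) hZ (hGle 0) (hGle n)).trans hK
    have hent' := div_le_div_of_nonneg_right hent (by positivity : 0 ≤ 2 * t)
    have hn' : (0 : ℝ) < n := by exact_mod_cast hn
    have : (n : ℝ) * |I| ≤ n * (ε + (ε / (2 * t) + 4 * t)) := by
      have : ε * n / (2 * t) = n * (ε / (2 * t)) := by ring
      nlinarith
    exact le_of_mul_le_mul_left this hn'
  -- the bound with `ε = t ^ 2` tends to zero with `t`
  have hlim : Tendsto (fun t : ℝ => t ^ 2 + (t / 2 + 4 * t)) (𝓝[>] 0) (𝓝 0) := by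
    have : Tendsto (fun t : ℝ => t ^ 2 + (t / 2 + 4 * t)) (𝓝 0) (𝓝 (0 ^ 2 + (0 / 2 + 4 * 0))) :=
      Continuous.tendsto (by fun_prop) 0
    simp only [ne_eq, OfNat.ofNat_ne_zero, not_false_eq_true, zero_pow, zero_div, mul_zero,
      add_zero] at this
    exact this.mono_left nhdsWithin_le_nhds
  have : |I| ≤ 0 := by
    refine ge_of_tendsto hlim ?_
    filter_upwards [self_mem_nhdsWithin] with t ht
    have ht : 0 < t := ht
    have := hbound (t ^ 2) (by positivity) t ht
    have e : t ^ 2 / (2 * t) = t / 2 := by field_simp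
    rwa [e] at this
  exact abs_eq_zero.1 (le_antisymm this (abs_nonneg _))

end OneStep

/-! ### Sets carrying the same information as the future -/

section Invariance

variable {Ω : Type*} {𝓖 𝓣 : MeasurableSpace Ω} {mΩ : MeasurableSpace Ω} {M : Measure Ω}
  [IsProbabilityMeasure M] {T : Ω → Ω}

theorem condExp_comp_measurePreserving (hT : MeasurePreserving T M M) (h𝓖 : 𝓖 ≤ mΩ) {u : Ω → ℝ}
    (hu : Measurable[mΩ] u) (huI : Integrable u M) :
    M[u ∘ T|𝓖.comap T] =ᵐ[M] M[u|𝓖] ∘ T := by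
  have hle : 𝓖.comap T ≤ mΩ := (MeasurableSpace.comap_mono h𝓖).trans hT.measurable.comap_le
  have hc : StronglyMeasurable[𝓖] (M[u|𝓖]) := stronglyMeasurable_condExp
  symm
  refine ae_eq_condExp_of_forall_setIntegral_eq hle (hT.integrable_comp_of_integrable huI) ?_ ?_ ?_
  · intro s _ _
    exact (hT.integrable_comp_of_integrable integrable_condExp).integrableOn
  · rintro s ⟨B, hB, rfl⟩ _
    have e1 := setIntegral_comp_of_measurePreserving hT (hc.measurable.mono h𝓖 le_rfl) (h𝓖 _ hB)
    have e2 := setIntegral_comp_of_measurePreserving hT hu (h𝓖 _ hB)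
    simp only [Function.comp_apply]
    rw [e1, e2]
    exact setIntegral_condExp h𝓖 huI hB
  · exact (hc.comp_measurable (comap_measurable T)).aestronglyMeasurable

/-- The property that `𝓖` and `T⁻¹ 𝓖` give the same information on `T⁻¹ A`, in dual form. -/
def SameInformation (M : Measure[mΩ] Ω) (T : Ω → Ω) (𝓖 : MeasurableSpace Ω) (A : Set Ω) : Prop :=
  ∀ w : Ω → ℝ, Measurable[𝓖] w → (∀ p, |w p| ≤ 1) →
    (∀ G, MeasurableSet[𝓖.comap T] G → ∫ p in G, w p ∂M = 0) → ∫ p in T ⁻¹' A, w p ∂M = 0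

theorem sameInformation_of_generateFrom (hT : Measurable T) (h𝓖 : 𝓖 ≤ mΩ) (h𝓣 : 𝓣 ≤ mΩ)
    {𝓢 : Set (Set Ω)} (hgen : 𝓣 = MeasurableSpace.generateFrom 𝓢) (hpi : IsPiSystem 𝓢)
    (h : ∀ A ∈ 𝓢, SameInformation M T 𝓖 A) {U : Set Ω} (hU : MeasurableSet[𝓣] U) :
    SameInformation M T 𝓖 U := by
  intro w hw hw1 hw0
  have hwI : Integrable w M := integrable_of_abs_le_one (hw.mono h𝓖 le_rfl) hw1
  have h0 : ∫ p, w p ∂M = 0 := by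
    have := hw0 Set.univ MeasurableSet.univ
    rwa [setIntegral_univ] at this
  induction U, hU using MeasurableSpace.induction_on_inter hgen hpi with
  | empty => simp
  | basic A hA => exact h A hA w hw hw1 hw0
  | compl A hA ih =>
    have := integral_add_compl (hT (h𝓣 _ hA)) hwI
    rw [ih, h0, zero_add] at this
    exact this
  | iUnion A hd hA ih =>
    rw [Set.preimage_iUnion, integral_iUnion (fun i => hT (h𝓣 _ (hA i)))
      (fun i j hij => (hd hij).preimage T) hwI.integrableOn]
    simp [ih]

/-- The conditional expectation given `T⁻¹ 𝓖` is obtained by testing the dual condition on the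
functions `1_D - E[1_D | T⁻¹ 𝓖]` with `D` in `𝓖`. -/
theorem condExp_ae_eq_of_sameInformation (hT : Measurable T) (h𝓖 : 𝓖 ≤ mΩ)
    (hdec : 𝓖.comap T ≤ 𝓖) {U : Set Ω} (hU : MeasurableSet[mΩ] U) (h : SameInformation M T 𝓖 U) :
    M[(T ⁻¹' U).indicator fun _ => (1 : ℝ)|𝓖] =ᵐ[M]
      M[(T ⁻¹' U).indicator fun _ => (1 : ℝ)|𝓖.comap T] := by
  have hle : 𝓖.comap T ≤ mΩ := hdec.trans h𝓖
  have hUT : MeasurableSet[mΩ] (T ⁻¹' U) := hT hU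
  set u : Ω → ℝ := (T ⁻¹' U).indicator fun _ => (1 : ℝ) with hu
  have huI : Integrable u M := (integrable_const 1).indicator hUT
  have hum : Measurable[mΩ] u := measurable_const.indicator hUT
  have hu0 : ∀ p, 0 ≤ u p := fun p => Set.indicator_nonneg (fun _ _ => zero_le_one) p
  have hu1 : ∀ p, u p ≤ 1 := fun p => Set.indicator_le_self' (fun _ _ => zero_le_one) p
  symm
  refine ae_eq_condExp_of_forall_setIntegral_eq h𝓖 huI
    (fun _ _ _ => integrable_condExp.integrableOn) ?_
    (stronglyMeasurable_condExp.mono hdec).aestronglyMeasurable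
  intro D hD _
  have hD' : MeasurableSet[mΩ] D := h𝓖 _ hD
  set d : Ω → ℝ := D.indicator fun _ => (1 : ℝ) with hd
  have hd0 : ∀ p, 0 ≤ d p := fun p => Set.indicator_nonneg (fun _ _ => zero_le_one) p
  have hd1 : ∀ p, d p ≤ 1 := fun p => Set.indicator_le_self' (fun _ _ => zero_le_one) p
  have hdI : Integrable d M := (integrable_const 1).indicator hD'
  have hdm : Measurable[𝓖] d := measurable_const.indicator hD
  have hdb := condExp_mem_Icc hle hdI hd0 hd1
  -- a bounded version of the conditional expectation of `d`
  set e : Ω → ℝ := fun p => max 0 (min 1 (M[d|𝓖.comap T] p)) with he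
  have hem : Measurable[𝓖.comap T] e :=
    measurable_const.max (measurable_const.min stronglyMeasurable_condExp.measurable)
  have he0 : ∀ p, 0 ≤ e p := fun p => le_max_left _ _
  have he1 : ∀ p, e p ≤ 1 := fun p => max_le zero_le_one (min_le_left _ _)
  have hee : e =ᵐ[M] M[d|𝓖.comap T] := by
    filter_upwards [hdb] with p hp
    rw [he]
    simp only
    rw [min_eq_right hp.2, max_eq_right hp.1]
  have heI : Integrable e M := integrable_condExp.congr hee.symm
  have hw := h (fun p => d p - e p) (hdm.sub (hem.mono hdec le_rfl))
    (fun p => by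
      rw [abs_le]
      constructor <;> linarith [hd0 p, hd1 p, he0 p, he1 p])
    (by
      intro G hG
      rw [integral_sub hdI.integrableOn heI.integrableOn,
        setIntegral_congr_ae (g := M[d|𝓖.comap T]) (hle _ hG) (hee.mono fun _ h _ => h),
        setIntegral_condExp hle hdI hG, sub_self])
  have hmulI : ∀ {b c : Ω → ℝ}, Measurable[mΩ] b → (∀ p, 0 ≤ b p) → (∀ p, b p ≤ 1) →
      Integrable c M → Integrable (fun p => b p * c p) M := by
    intro b c hb hb0 hb1 hc
    refine hc.bdd_mul (c := 1) hb.aestronglyMeasurable (Eventually.of_forall fun p => ?_)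
    rw [Real.norm_eq_abs, abs_of_nonneg (hb0 p)]
    exact hb1 p
  have hind : ∀ (A : Set Ω) (c : Ω → ℝ), MeasurableSet[mΩ] A →
      ∫ p in A, c p ∂M = ∫ p, A.indicator (fun _ => (1 : ℝ)) p * c p ∂M := by
    intro A c hA
    rw [← integral_indicator hA]
    congr 1
    ext p
    by_cases hp : p ∈ A <;> simp [hp]
  have hem' : Measurable[mΩ] e := hem.mono hle le_rfl
  have hb : ∀ {b : Ω → ℝ}, (∀ p, 0 ≤ b p) → (∀ p, b p ≤ 1) → ∀ᵐ p ∂M, ‖b p‖ ≤ 1 := by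
    intro b h0 h1
    refine Eventually.of_forall fun p => ?_
    rw [Real.norm_eq_abs, abs_of_nonneg (h0 p)]
    exact h1 p
  have hcu := condExp_mem_Icc hle huI hu0 hu1
  rw [hind _ _ hUT, ← hu] at hw
  have s1 : ∫ p, u p * d p ∂M = ∫ p, u p * e p ∂M := by
    have a1 := hmulI hum hu0 hu1 hdI
    have a2 := hmulI hum hu0 hu1 heI
    rw [← sub_eq_zero, ← integral_sub a1 a2, ← hw]
    refine integral_congr_ae (Eventually.of_forall fun p => ?_)
    simp only
    ring
  have s2 : ∫ p, e p * u p ∂M = ∫ p, e p * M[u|𝓖.comap T] p ∂M :=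
    integral_mul_condExp hle hem (hb he0 he1) huI
  have s3 : ∫ p, M[u|𝓖.comap T] p * d p ∂M = ∫ p, M[u|𝓖.comap T] p * M[d|𝓖.comap T] p ∂M := by
    refine integral_mul_condExp hle stronglyMeasurable_condExp.measurable (C := 1) ?_ hdI
    filter_upwards [hcu] with p hp
    rw [Real.norm_eq_abs, abs_of_nonneg hp.1]
    exact hp.2
  rw [hind _ _ hD', hind _ _ hD', ← hd]
  have s4 : ∫ p, e p * M[u|𝓖.comap T] p ∂M = ∫ p, M[u|𝓖.comap T] p * M[d|𝓖.comap T] p ∂M := by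
    refine integral_congr_ae ?_
    filter_upwards [hee] with p hp
    rw [hp, mul_comm]
  calc ∫ p, d p * M[u|𝓖.comap T] p ∂M = ∫ p, M[u|𝓖.comap T] p * d p ∂M := by
        simp_rw [mul_comm]
    _ = ∫ p, e p * u p ∂M := by rw [s3, ← s4, s2]
    _ = ∫ p, u p * d p ∂M := by rw [s1]; simp_rw [mul_comm]
    _ = ∫ p, d p * u p ∂M := by simp_rw [mul_comm]

/-- If `𝓖` and `T⁻¹ 𝓖` give the same information on `T⁻¹ U` for each `U` in `𝓣`, then `𝓖` and
`T⁻ⁿ 𝓖` give the same information on `T⁻ⁿ U`. -/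
theorem condExp_iterate_ae_eq (hT : MeasurePreserving T M M) (h𝓖 : 𝓖 ≤ mΩ) (h𝓣 : 𝓣 ≤ mΩ)
    (hdec : 𝓖.comap T ≤ 𝓖) (hT𝓣 : Measurable[𝓣, 𝓣] T)
    (h : ∀ U, MeasurableSet[𝓣] U → SameInformation M T 𝓖 U) {U : Set Ω} (hU : MeasurableSet[𝓣] U)
    (n : ℕ) :
    M[(T^[n] ⁻¹' U).indicator fun _ => (1 : ℝ)|𝓖] =ᵐ[M]
      M[(T^[n] ⁻¹' U).indicator fun _ => (1 : ℝ)|𝓖.comap T^[n]] := by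
  induction n with
  | zero =>
    rw [Function.iterate_zero, MeasurableSpace.comap_id]
  | succ n ih =>
    set V := T^[n] ⁻¹' U with hV
    have hVm : MeasurableSet[𝓣] V := by
      have : Measurable[𝓣, 𝓣] T^[n] := @Measurable.iterate Ω 𝓣 T hT𝓣 n
      exact this hU
    have e0 : T^[n + 1] ⁻¹' U = T ⁻¹' V := by
      rw [hV, ← Set.preimage_comp, Function.iterate_succ]
    have e1 : (T ⁻¹' V).indicator (fun _ => (1 : ℝ)) = (V.indicator fun _ => (1 : ℝ)) ∘ T := by
      rfl
    have hVm' : Measurable[mΩ] (V.indicator fun _ => (1 : ℝ)) :=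
      measurable_const.indicator (h𝓣 _ hVm)
    have hVI : Integrable (V.indicator fun _ => (1 : ℝ)) M :=
      (integrable_const 1).indicator (h𝓣 _ hVm)
    have s1 := condExp_ae_eq_of_sameInformation hT.measurable h𝓖 hdec (h𝓣 _ hVm) (h V hVm)
    have s2 := condExp_comp_measurePreserving hT h𝓖 hVm' hVI
    have s3 := condExp_comp_measurePreserving hT (comap_iterate_le hT.measurable h𝓖 n) hVm' hVI
    rw [e0, Function.iterate_succ, ← MeasurableSpace.comap_comp, e1]
    rw [e1] at s1
    exact s1.trans (s2.trans ((hT.quasiMeasurePreserving.ae_eq_comp ih).trans s3.symm))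

/-- The conclusion of the invariance principle: `𝓖` gives as much information on the sets
of `𝓣` as any σ-algebra generated modulo null sets by the images of `𝓖` under the iterates. -/
theorem measureReal_inter_eq_setIntegral_condExp (hT : MeasurePreserving T M M) (h𝓖 : 𝓖 ≤ mΩ)
    (h𝓣 : 𝓣 ≤ mΩ) (hdec : 𝓖.comap T ≤ 𝓖) (hT𝓣 : Measurable[𝓣, 𝓣] T)
    (h : ∀ U, MeasurableSet[𝓣] U → SameInformation M T 𝓖 U) {U : Set Ω} (hU : MeasurableSet[𝓣] U)
    {A : Set Ω}
    (hA : ∃ A', MeasurableSet[MeasurableSpace.generateFrom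
      {D | MeasurableSet[mΩ] D ∧ ∃ n, MeasurableSet[𝓖] (T^[n] ⁻¹' D)}] A' ∧ A =ᵐ[M] A') :
    M.real (U ∩ A) = ∫ p in A, M[U.indicator fun _ => (1 : ℝ)|𝓖] p ∂M := by
  set u : Ω → ℝ := U.indicator fun _ => (1 : ℝ) with hu
  have hUm : MeasurableSet[mΩ] U := h𝓣 _ hU
  have hum : Measurable[mΩ] u := measurable_const.indicator hUm
  have huI : Integrable u M := (integrable_const 1).indicator hUm
  have huA : ∀ A, M.real (U ∩ A) = ∫ p in A, u p ∂M := by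
    intro A
    rw [hu, integral_indicator_const _ hUm, measureReal_restrict_apply hUm]
    simp
  obtain ⟨A', hA', hAA'⟩ := hA
  rw [huA, setIntegral_congr_set hAA', setIntegral_congr_set hAA']
  set 𝓢 := {D | MeasurableSet[mΩ] D ∧ ∃ n, MeasurableSet[𝓖] (T^[n] ⁻¹' D)} with h𝓢
  have hstep : ∀ {D : Set Ω} {n : ℕ}, MeasurableSet[𝓖] (T^[n] ⁻¹' D) →
      MeasurableSet[𝓖] (T^[n + 1] ⁻¹' D) := by
    intro D n hD
    rw [Function.iterate_succ, Set.preimage_comp]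
    exact hdec _ ⟨_, hD, rfl⟩
  have hmono : ∀ {D : Set Ω} {n k : ℕ}, n ≤ k → MeasurableSet[𝓖] (T^[n] ⁻¹' D) →
      MeasurableSet[𝓖] (T^[k] ⁻¹' D) := by
    intro D n k hnk hD
    induction hnk with
    | refl => exact hD
    | step _ ih => exact hstep ih
  have hpi : IsPiSystem 𝓢 := by
    rintro D ⟨hD, n, hn⟩ D' ⟨hD', n', hn'⟩ _
    refine ⟨hD.inter hD', max n n', ?_⟩
    rw [Set.preimage_inter]
    exact (hmono (le_max_left _ _) hn).inter (hmono (le_max_right _ _) hn')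
  have hle : MeasurableSpace.generateFrom 𝓢 ≤ mΩ := MeasurableSpace.generateFrom_le fun _ h => h.1
  induction A', hA' using MeasurableSpace.induction_on_inter rfl hpi generalizing A with
  | empty => simp
  | basic D hD =>
    obtain ⟨hDm, n, hn⟩ := hD
    have hTn := hT.iterate n
    have hcm : Measurable[mΩ] (M[u|𝓖]) :=
      (stronglyMeasurable_condExp (m := 𝓖)).measurable.mono h𝓖 le_rfl
    have e1 : (T^[n] ⁻¹' U).indicator (fun _ => (1 : ℝ)) = u ∘ T^[n] := by
      rfl
    have s1 := condExp_iterate_ae_eq hT h𝓖 h𝓣 hdec hT𝓣 h hU n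
    have s2 := condExp_comp_measurePreserving hTn h𝓖 hum huI
    rw [e1] at s1
    rw [← setIntegral_comp_of_measurePreserving hTn hum hDm,
      ← setIntegral_comp_of_measurePreserving hTn hcm hDm]
    have huTI : Integrable (u ∘ T^[n]) M := hTn.integrable_comp_of_integrable huI
    calc ∫ p in T^[n] ⁻¹' D, u (T^[n] p) ∂M = ∫ p in T^[n] ⁻¹' D, M[u ∘ T^[n]|𝓖] p ∂M :=
          (setIntegral_condExp h𝓖 huTI hn).symm
      _ = ∫ p in T^[n] ⁻¹' D, M[u|𝓖] (T^[n] p) ∂M :=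
          setIntegral_congr_ae (hTn.measurable hDm) ((s1.trans s2).mono fun _ h _ => h)
  | compl D hD ih =>
    have a1 := integral_add_compl (hle _ hD) huI
    have a2 := integral_add_compl (hle _ hD) (integrable_condExp (m := 𝓖) (f := u) (μ := M))
    rw [integral_condExp h𝓖, ← a1, ih (Eventually.of_forall fun _ => rfl)] at a2
    linarith
  | iUnion D hd hD ih =>
    rw [integral_iUnion (fun i => hle _ (hD i)) hd huI.integrableOn,
      integral_iUnion (fun i => hle _ (hD i)) hd integrable_condExp.integrableOn]
    exact tsum_congr fun i => ih i (Eventually.of_forall fun _ => rfl)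

end Invariance

/-! ### Kernels and the descent to the base -/

/-- The sets of the ambient σ-algebra that coincide with a set of `𝓑` up to an `m`-null set. -/
@[reducible] def nullCompletion {X : Type*} (𝓑 : MeasurableSpace X) [𝓐 : MeasurableSpace X]
    (m : Measure X) : MeasurableSpace X :=
  𝓐 ⊓ eventuallyMeasurableSpace 𝓑 (ae m)

section Kernels

theorem le_nullCompletion {X : Type*} {𝓑 : MeasurableSpace X} {𝓐 : MeasurableSpace X}
    {m : Measure X} (h𝓑 : 𝓑 ≤ 𝓐) : 𝓑 ≤ nullCompletion 𝓑 m :=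
  le_inf h𝓑 (le_eventuallyMeasurableSpace)

open ProbabilityTheory

theorem exists_kernel_prod_eq {X Y : Type*} [MeasurableSpace X] [MeasurableSpace Y]
    [StandardBorelSpace Y] [Nonempty Y] (ρ : Measure (X × Y)) [IsFiniteMeasure ρ] :
    ∃ k : Kernel X Y, IsMarkovKernel k ∧ ∀ B C, MeasurableSet B → MeasurableSet C →
      ρ (B ×ˢ C) = ∫⁻ x in B, k x C ∂ρ.fst :=
  ⟨ρ.condKernel, inferInstance, fun _ _ hB hC =>
    (Measure.setLIntegral_condKernel_eq_measure_prod hB hC).symm⟩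

/-- The law of `Y0` conditional on the `σ`-algebra `𝓑` also disintegrates the law of `Y0` over
the ambient σ-algebra, if the completion of `𝓑` gives all the information on `Y0`. -/
theorem exists_kernel_of_setIntegral_condExp {Ω X Y : Type*} {𝓑 : MeasurableSpace X}
    {𝓐 : MeasurableSpace X} {mΩ : MeasurableSpace Ω} [MeasurableSpace Y] [StandardBorelSpace Y]
    (h𝓑 : 𝓑 ≤ 𝓐) {m : Measure X} [IsProbabilityMeasure m] {M : Measure Ω}
    [IsProbabilityMeasure M] {pr : Ω → X} {Y0 : Ω → Y} (hpr : MeasurePreserving pr M m)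
    (hY0 : Measurable Y0)
    (hinv : ∀ C, MeasurableSet C → ∀ A, MeasurableSet[𝓐] A → M.real (Y0 ⁻¹' C ∩ pr ⁻¹' A) =
      ∫ p in pr ⁻¹' A, M[(Y0 ⁻¹' C).indicator fun _ => (1 : ℝ)|(nullCompletion 𝓑 m).comap pr] p ∂M) :
    ∃ k : @Kernel X Y 𝓑 _, @IsMarkovKernel X Y 𝓑 _ k ∧ ∀ C, MeasurableSet C →
      ∀ A, MeasurableSet[𝓐] A → M (Y0 ⁻¹' C ∩ pr ⁻¹' A) = ∫⁻ x in A, k x C ∂m := by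
  have : Nonempty Ω := M.nonempty_of_neZero
  have : Nonempty Y := this.map Y0
  have hpr𝓑 : Measurable[mΩ, 𝓑] pr := hpr.measurable.mono le_rfl h𝓑
  have hpair : @Measurable Ω (X × Y) mΩ (@Prod.instMeasurableSpace X Y 𝓑 _)
      (fun p => (pr p, Y0 p)) := Measurable.prodMk hpr𝓑 hY0
  let ρ : @Measure (X × Y) (@Prod.instMeasurableSpace X Y 𝓑 _) :=
    @Measure.map Ω (X × Y) mΩ (@Prod.instMeasurableSpace X Y 𝓑 _) (fun p => (pr p, Y0 p)) M
  have hρ : @IsFiniteMeasure (X × Y) (@Prod.instMeasurableSpace X Y 𝓑 _) ρ :=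
    @Measure.isFiniteMeasure_map Ω (X × Y) (@Prod.instMeasurableSpace X Y 𝓑 _) mΩ M _ _
  obtain ⟨k, hk, hkρ⟩ := @exists_kernel_prod_eq X Y 𝓑 _ _ _ ρ hρ
  have hfst : @Measure.fst X Y 𝓑 _ ρ = m.trim h𝓑 := by
    refine @Measure.ext X 𝓑 _ _ fun B hB => ?_
    rw [trim_measurableSet_eq h𝓑 hB, @Measure.fst_apply X Y 𝓑 _ ρ B hB,
      @Measure.map_apply Ω (X × Y) mΩ (@Prod.instMeasurableSpace X Y 𝓑 _) M _ hpair _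
        (@measurable_fst X Y 𝓑 _ _ hB), ← hpr.measure_preimage (h𝓑 _ hB).nullMeasurableSet]
    rfl
  have hkm : ∀ C, MeasurableSet C → Measurable[𝓑] fun x => k x C := fun C hC =>
    @Kernel.measurable_coe X Y 𝓑 _ k C hC
  have hB : ∀ C, MeasurableSet C → ∀ B, MeasurableSet[𝓑] B →
      M (Y0 ⁻¹' C ∩ pr ⁻¹' B) = ∫⁻ x in B, k x C ∂m := by
    intro C hC B hB
    have := hkρ B C hB hC
    rw [hfst, setLIntegral_trim h𝓑 (hkm C hC) hB,
      @Measure.map_apply Ω (X × Y) mΩ (@Prod.instMeasurableSpace X Y 𝓑 _) M _ hpair _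
        (@MeasurableSet.prod X Y 𝓑 _ _ _ hB hC)] at this
    rw [← this, Set.inter_comm]
    rfl
  refine ⟨k, hk, fun C hC A hA => ?_⟩
  have hprob : ∀ x, k x C ≤ 1 := fun x => prob_le_one
  have hkt : ∀ x, k x C ≠ ⊤ := fun x => measure_ne_top _ _
  set b : X → ℝ := fun x => (k x C).toReal with hb
  have hbm : Measurable[𝓑] b := (hkm C hC).ennreal_toReal
  have hbm' : Measurable[𝓐] b := hbm.mono h𝓑 le_rfl
  have hb0 : ∀ x, 0 ≤ b x := fun x => ENNReal.toReal_nonneg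
  have hb1 : ∀ x, |b x| ≤ 1 := fun x => by
    rw [abs_of_nonneg (hb0 x)]
    exact ENNReal.toReal_mono ENNReal.one_ne_top (hprob x)
  have hbI : Integrable b m := integrable_of_abs_le_one hbm' hb1
  have hint : ∀ A, MeasurableSet[𝓐] A → ∫⁻ x in A, k x C ∂m = ENNReal.ofReal (∫ x in A, b x ∂m) := by
    intro A hA
    rw [ofReal_integral_eq_lintegral_ofReal hbI.integrableOn (Eventually.of_forall hb0)]
    simp only [hb, ENNReal.ofReal_toReal (hkt _)]
  have hnn : ∀ A, 0 ≤ ∫ x in A, b x ∂m := fun A => integral_nonneg hb0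
  have hset : ∀ A, MeasurableSet[𝓐] A → ∫ p in pr ⁻¹' A, b (pr p) ∂M = ∫ x in A, b x ∂m := by
    intro A hA
    rw [← integral_indicator hA, ← integral_indicator (hpr.measurable hA), ← hpr.map_eq,
      integral_map hpr.measurable.aemeasurable (hbm'.indicator hA).aestronglyMeasurable]
    rfl
  set u : Ω → ℝ := (Y0 ⁻¹' C).indicator fun _ => (1 : ℝ) with hu
  have hYC : MeasurableSet[mΩ] (Y0 ⁻¹' C) := hY0 hC
  have huI : Integrable u M := (integrable_const 1).indicator hYC
  have hle : (nullCompletion 𝓑 m).comap pr ≤ mΩ :=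
    (MeasurableSpace.comap_mono inf_le_left).trans hpr.measurable.comap_le
  have hcond : (fun p => b (pr p)) =ᵐ[M] M[u|(nullCompletion 𝓑 m).comap pr] := by
    refine ae_eq_condExp_of_forall_setIntegral_eq hle huI
      (fun _ _ _ => (integrable_of_abs_le_one (hbm'.comp hpr.measurable)
        fun p => hb1 _).integrableOn) ?_ ?_
    · rintro _ ⟨A', ⟨hA'𝓐, B, hBm, hAB⟩, rfl⟩ _
      rw [hset A' hA'𝓐, setIntegral_congr_set hAB, hu, integral_indicator_const _ hYC,
        measureReal_restrict_apply hYC]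
      have e1 : (Y0 ⁻¹' C ∩ pr ⁻¹' A' : Set Ω) =ᵐ[M] (Y0 ⁻¹' C ∩ pr ⁻¹' B : Set Ω) :=
        (ae_eq_refl _).inter (hpr.quasiMeasurePreserving.preimage_ae_eq hAB)
      rw [measureReal_congr e1, measureReal_def, hB C hC B hBm, hint B (h𝓑 _ hBm),
        ENNReal.toReal_ofReal (hnn _)]
      simp
    · have h1 : Measurable[(nullCompletion 𝓑 m).comap pr] fun p => b (pr p) :=
        @Measurable.comp Ω X ℝ ((nullCompletion 𝓑 m).comap pr) (nullCompletion 𝓑 m) _ _ _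
          (hbm.mono (le_nullCompletion h𝓑) le_rfl) (comap_measurable pr)
      exact h1.stronglyMeasurable.aestronglyMeasurable
  have h1 := hinv C hC A hA
  rw [← setIntegral_congr_ae (hpr.measurable hA) (hcond.mono fun _ h _ => h), hset A hA] at h1
  rw [hint A hA, ← h1, measureReal_def, ENNReal.ofReal_toReal (measure_ne_top _ _)]

theorem exists_countable_isPiSystem_generateFrom (Y : Type*) [mY : MeasurableSpace Y]
    [MeasurableSpace.CountablyGenerated Y] :
    ∃ 𝓒 : Set (Set Y), 𝓒.Countable ∧ IsPiSystem 𝓒 ∧ mY = MeasurableSpace.generateFrom 𝓒 := by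
  set s := MeasurableSpace.natGeneratingSequence Y with hs
  refine ⟨Set.range fun F : Finset ℕ => ⋂ n ∈ F, s n, Set.countable_range _, ?_, le_antisymm ?_ ?_⟩
  · rintro _ ⟨F, rfl⟩ _ ⟨F', rfl⟩ _
    classical
    refine ⟨F ∪ F', ?_⟩
    simp only [Finset.mem_union, Set.iInter_or, Set.iInter_inter_distrib]
  · conv_lhs => rw [← MeasurableSpace.generateFrom_natGeneratingSequence Y]
    refine MeasurableSpace.generateFrom_mono ?_
    rintro _ ⟨n, rfl⟩
    exact ⟨{n}, by simp [hs]⟩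
  · refine MeasurableSpace.generateFrom_le ?_
    rintro _ ⟨F, rfl⟩
    exact Finset.measurableSet_biInter F fun n _ =>
      MeasurableSpace.measurableSet_natGeneratingSequence n

end Kernels

section Descent

theorem isOpenEmbedding_fiber {X : Type*} {N : ℕ → Type*} [∀ i, TopologicalSpace (N i)] {idx : X → ℕ}
    {E : X → Type*} [∀ x, TopologicalSpace (E x)] (τ : ∀ x, E x ≃ₜ N (idx x)) (x : X) :
    IsOpenEmbedding (fun ξ : E x => (⟨idx x, τ x ξ⟩ : Σ i, N i)) :=
  (Topology.IsOpenEmbedding.sigmaMk (σ := N) (i := idx x)).comp (τ x).isOpenEmbedding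

variable {X : Type*} {𝓑 : MeasurableSpace X} [𝓐 : MeasurableSpace X] {m : Measure X}
  [IsProbabilityMeasure m] {N : ℕ → Type*} [∀ i, TopologicalSpace (N i)] [∀ i, PolishSpace (N i)]
  {idx : X → ℕ} {E : X → Type*} [∀ x, TopologicalSpace (E x)] [∀ x, MeasurableSpace (E x)]
  [∀ x, BorelSpace (E x)]

/-- A disintegration is measurable modulo null sets with respect to a σ-algebra that gives all the
information on the position in the fibers. -/
theorem exists_measurableFamily_of_setIntegral_condExp (h𝓑 : 𝓑 ≤ 𝓐) (τ : ∀ x, E x ≃ₜ N (idx x))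
    (hidx : Measurable[𝓑] idx)
    (M : @Measure (FiberTotal E) (totalSigma 𝓐 fun x ↦ τ x))
    (hMm : ∀ A : Set X, MeasurableSet A → M {p | p.base ∈ A} = m A)
    (Mx : ∀ x, Measure (E x)) (hMx : IsDisintegration m M Mx)
    (hinv : ∀ C, MeasurableSet[borel (Σ i, N i)] C → ∀ A, MeasurableSet[𝓐] A →
      M.real ((fun p => (coord (fun x ↦ τ x) p).2) ⁻¹' C ∩ FiberTotal.base ⁻¹' A) =
      ∫ p in FiberTotal.base ⁻¹' A,
        (condExp ((nullCompletion 𝓑 m).comap FiberTotal.base) M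
          (((fun p => (coord (fun x ↦ τ x) p).2) ⁻¹' C).indicator fun _ => (1 : ℝ))) p ∂M) :
    ∃ κ : ∀ x, Measure (E x),
      MeasurableFamily 𝓑 (totalSigma 𝓑 fun x ↦ τ x) κ ∧ ∀ᵐ x ∂m, Mx x = κ x := by
  let : MeasurableSpace (Σ i, N i) := borel _
  have : BorelSpace (Σ i, N i) := ⟨rfl⟩
  let mE : MeasurableSpace (FiberTotal E) := totalSigma 𝓐 fun x ↦ τ x
  have hcoord : Measurable (coord (E := E) (fun x ↦ τ x)) := comap_measurable _
  have hbase : Measurable (FiberTotal.base : FiberTotal E → X) := measurable_fst.comp hcoord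
  have hY0 : Measurable fun p : FiberTotal E => (coord (fun x ↦ τ x) p).2 :=
    measurable_snd.comp hcoord
  have hM1 : IsProbabilityMeasure M := ⟨by simpa using hMm Set.univ MeasurableSet.univ⟩
  have hpr : MeasurePreserving (FiberTotal.base : FiberTotal E → X) M m :=
    ⟨hbase, Measure.ext fun A hA => by rw [Measure.map_apply hbase hA]; exact hMm A hA⟩
  obtain ⟨k, hk, hkeq⟩ := exists_kernel_of_setIntegral_condExp h𝓑 hpr hY0 hinv
  set ι : ∀ x, E x → Σ i, N i := fun x ξ => ⟨idx x, τ x ξ⟩ with hι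
  have hιe : ∀ x, MeasurableEmbedding (ι x) := fun x =>
    (isOpenEmbedding_fiber τ x).measurableEmbedding
  refine ⟨fun x => (k x).comap (ι x), ?_, ?_⟩
  · rintro _ ⟨U, hU, rfl⟩
    set W : Set (X × Σ i, N i) := {q | q.2.1 = idx q.1} with hW
    have hfst : Measurable fun y : Σ i, N i => y.1 :=
      (continuous_sigma_iff.2 fun i => continuous_const).measurable
    have hWm : MeasurableSet[𝓑.prod (borel (Σ i, N i))] W := by
      have h1 : @Measurable (X × Σ i, N i) ℕ (𝓑.prod (borel _)) _ fun q => q.2.1 :=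
        hfst.comp (@measurable_snd X (Σ i, N i) 𝓑 _)
      have h2 : @Measurable (X × Σ i, N i) ℕ (𝓑.prod (borel _)) _ fun q => idx q.1 :=
        hidx.comp (@measurable_fst X (Σ i, N i) 𝓑 _)
      exact measurableSet_eq_fun h1 h2
    have key : ∀ x, (k x).comap (ι x) (slice (coord (fun x ↦ τ x) ⁻¹' U) x) =
        k x (Prod.mk x ⁻¹' (U ∩ W)) := by
      intro x
      rw [(hιe x).comap_apply]
      congr 1
      ext ⟨i, y⟩
      constructor
      · rintro ⟨ξ, hξ, h⟩
        rw [← h]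
        exact ⟨hξ, rfl⟩
      · rintro ⟨h1, h2⟩
        have h2 : i = idx x := h2
        subst h2
        refine ⟨(τ x).symm y, ?_, by simp [hι]⟩
        change coord (fun x ↦ τ x) (⟨x, (τ x).symm y⟩ : FiberTotal E) ∈ U
        simpa [coord] using h1
    simp_rw [key]
    exact @ProbabilityTheory.Kernel.measurable_kernel_prodMk_left X (Σ i, N i) 𝓑 _ k _ _
      (@MeasurableSet.inter _ (𝓑.prod (borel _)) _ _ hU hWm)
  · obtain ⟨𝓒, h𝓒c, h𝓒pi, h𝓒gen⟩ := exists_countable_isPiSystem_generateFrom (Σ i, N i)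
    have h𝓒m : ∀ C ∈ 𝓒, MeasurableSet C := by
      intro C hC
      have := MeasurableSpace.measurableSet_generateFrom hC
      rwa [← h𝓒gen] at this
    have hae : ∀ C ∈ 𝓒, ∀ᵐ x ∂m, Mx x (ι x ⁻¹' C) = k x C := by
      intro C hC
      have hCm := h𝓒m C hC
      have ha : AEMeasurable (fun x => Mx x (ι x ⁻¹' C)) m := hMx.aemeasurable _ (hY0 hCm)
      have hb : AEMeasurable (fun x => k x C) m :=
        ((@ProbabilityTheory.Kernel.measurable_coe X _ 𝓑 _ k C hCm).mono h𝓑 le_rfl).aemeasurable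
      refine ae_eq_of_forall_setLIntegral_eq_of_sigmaFinite₀ ha hb fun A hA _ => ?_
      rw [← hkeq C hCm A hA, hMx.lintegral_eq _ ((hY0 hCm).inter (hbase hA)),
        ← lintegral_indicator hA]
      refine lintegral_congr fun x => ?_
      by_cases hx : x ∈ A
      · rw [Set.indicator_of_mem hx]
        congr 1
        ext ξ
        simp [slice, coord, hι, hx]
      · rw [Set.indicator_of_notMem hx]
        have : slice ((fun p : FiberTotal E => (coord (fun x ↦ τ x) p).2) ⁻¹' C ∩
            FiberTotal.base ⁻¹' A) x = ∅ := by
          ext ξ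
          simp [slice, hx]
        rw [this, measure_empty]
    have hall : ∀ᵐ x ∂m, ∀ C ∈ 𝓒, Mx x (ι x ⁻¹' C) = k x C := (ae_ball_iff h𝓒c).2 hae
    filter_upwards [hall, hMx.isProbability] with x hx hp
    have hmap : (Mx x).map (ι x) = k x := by
      have : IsProbabilityMeasure ((Mx x).map (ι x)) :=
        Measure.isProbabilityMeasure_map (hιe x).measurable.aemeasurable
      refine ext_of_generate_finite 𝓒 h𝓒gen h𝓒pi (fun C hC => ?_) (by simp)
      rw [Measure.map_apply (hιe x).measurable (h𝓒m C hC)]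
      exact hx C hC
    rw [← hmap, (hιe x).comap_map]

end Descent

/-! ### Points with slow backward expansion -/

/-- A finite set that is a net of precision `ρ` of a part of the space defines a measurable
discretization with one more value than it has points. -/
theorem exists_measurable_nearest {Y : Type*} [PseudoMetricSpace Y] [MeasurableSpace Y]
    [OpensMeasurableSpace Y] [Nonempty Y] (S : Finset Y) (ρ : ℝ) :
    ∃ ζ : Y → Fin (S.card + 1), Measurable ζ ∧ ∃ c : Fin (S.card + 1) → Y,
      ∀ y, (∃ s ∈ S, dist y s < ρ) → dist y (c (ζ y)) < ρ := by
  classical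
  set k := S.card with hk
  set e := S.equivFin.symm with he
  set P : ℕ → Y → Prop := fun n y => (∃ h : n < k, dist y (e ⟨n, h⟩) < ρ) ∨ n = k with hP
  have hex : ∀ y, ∃ n, P n y := fun y => ⟨k, Or.inr rfl⟩
  have hle : ∀ y, Nat.find (hex y) ≤ k := fun y => Nat.find_min' _ (Or.inr rfl)
  have hPm : ∀ n, MeasurableSet {y | P n y} := by
    intro n
    by_cases h : n < k
    · have : {y | P n y} = Metric.ball (e ⟨n, h⟩ : Y) ρ := by
        ext y
        simp [hP, h, h.ne]
      rw [this]
      exact Metric.isOpen_ball.measurableSet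
    · by_cases h' : n = k <;> simp [hP, h, h']
  obtain ⟨y0⟩ := ‹Nonempty Y›
  refine ⟨fun y => ⟨min (Nat.find (hex y)) k, by omega⟩, ?_,
    fun i => if h : i.1 < k then e ⟨i, h⟩ else y0, ?_⟩
  · exact Measurable.find (f := fun n _ => (⟨min n k, by omega⟩ : Fin (k + 1)))
      (fun n => measurable_const) hPm hex
  · rintro y ⟨s, hs, hys⟩
    obtain ⟨i, hi⟩ := e.surjective ⟨s, hs⟩
    have hPi : P i y := Or.inl ⟨i.2, by simpa [hi] using hys⟩
    have hlt : Nat.find (hex y) < k := (Nat.find_min' (hex y) hPi).trans_lt i.2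
    have hmin : min (Nat.find (hex y)) k = Nat.find (hex y) := min_eq_left hlt.le
    simp only [hmin, hlt, dite_true]
    rcases Nat.find_spec (hex y) with ⟨_, h⟩ | h
    · exact h
    · exact absurd h hlt.ne

section SlowSet

variable {Ω X Y : Type*} {𝓑 : MeasurableSpace X} {𝓣 : MeasurableSpace Ω}
  {mΩ : MeasurableSpace Ω} {M : Measure Ω} {T : Ω → Ω} [PseudoMetricSpace Y]
  {pr : Ω → X} {Y0 : Ω → Y}

/-- Backward contraction bounds along blocks multiply, as long as the distances stay small. -/
theorem dist_le_prod_mul_dist {S : Ω → Ω} (hS : ∀ p p', pr p = pr p' → pr (S p) = pr (S p'))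
    {w : Ω → ℝ} (hw : ∀ p, 1 ≤ w p) {δ : ℝ}
    (h : ∀ p p', pr p = pr p' → dist (Y0 (S p)) (Y0 (S p')) < δ →
      dist (Y0 p) (Y0 p') ≤ w p * dist (Y0 (S p)) (Y0 (S p')))
    (q : ℕ) (p p' : Ω) (hpp : pr p = pr p')
    (hq : (∏ l ∈ Finset.range q, w (S^[l] p)) * dist (Y0 (S^[q] p)) (Y0 (S^[q] p')) < δ) :
    dist (Y0 p) (Y0 p') ≤
      (∏ l ∈ Finset.range q, w (S^[l] p)) * dist (Y0 (S^[q] p)) (Y0 (S^[q] p')) := by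
  induction q generalizing p p' with
  | zero => simp
  | succ q ih =>
    rw [Finset.prod_range_succ'] at hq ⊢
    simp only [Function.iterate_succ_apply, Function.iterate_zero, id_eq] at hq ⊢
    have hP : 0 ≤ ∏ l ∈ Finset.range q, w (S^[l] (S p)) :=
      Finset.prod_nonneg fun l _ => zero_le_one.trans (hw _)
    have hw1 := hw p
    set D := dist (Y0 (S^[q] (S p))) (Y0 (S^[q] (S p'))) with hD
    set Q := ∏ l ∈ Finset.range q, w (S^[l] (S p)) with hQ
    have hD0 : 0 ≤ D := dist_nonneg
    have hQD : 0 ≤ Q * D := mul_nonneg hP hD0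
    have h1 : Q * D < δ := by nlinarith
    have h2 := ih (S p) (S p') (hS p p' hpp) h1
    have h3 := h p p' hpp (h2.trans_lt h1)
    nlinarith

/-- The points `p` for which the inverse of the `N`-th iterate expands small balls of the fiber
around the `N`-th image of `p` by a factor at most `exp (θ N)`. -/
def slowSet (T : Ω → Ω) (pr : Ω → X) (Y0 : Ω → Y) (δ θ : ℝ) (N : ℕ) : Set Ω :=
  {p | ∀ p', pr p' = pr p → dist (Y0 (T^[N] p)) (Y0 (T^[N] p')) < δ →
    dist (Y0 p) (Y0 p') ≤ Real.exp (θ * N) * dist (Y0 (T^[N] p)) (Y0 (T^[N] p'))}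

theorem measurableSet_slowSet [SecondCountableTopology Y] [MeasurableSpace Y] [BorelSpace Y]
    (hT : Measurable T) (hY0 : Measurable[mΩ] Y0) {s : ℕ → X → Ω}
    (hs : ∀ l N, Measurable fun p => Y0 (T^[N] (s l (pr p)))) (hprs : ∀ l p, pr (s l (pr p)) = pr p)
    (hdense : ∀ p N, ∀ ε > 0, ∃ l, dist (Y0 p) (Y0 (s l (pr p))) < ε ∧
      dist (Y0 (T^[N] p)) (Y0 (T^[N] (s l (pr p)))) < ε) (δ θ : ℝ) (N : ℕ) :
    MeasurableSet (slowSet T pr Y0 δ θ N) := by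
  set D0 : ℕ → Ω → ℝ := fun l p => dist (Y0 p) (Y0 (s l (pr p))) with hD0
  set DN : ℕ → Ω → ℝ := fun l p => dist (Y0 (T^[N] p)) (Y0 (T^[N] (s l (pr p)))) with hDN
  have hD0m : ∀ l, Measurable (D0 l) := fun l => hY0.dist (hs l 0)
  have hDNm : ∀ l, Measurable (DN l) := fun l =>
    (hY0.comp (hT.iterate N)).dist (hs l N)
  have : slowSet T pr Y0 δ θ N =
      ⋂ l, ({p | DN l p < δ}ᶜ ∪ {p | D0 l p ≤ Real.exp (θ * N) * DN l p}) := by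
    ext p
    simp only [slowSet, Set.mem_ofPred_eq, Set.mem_iInter, Set.mem_union, Set.mem_compl_iff]
    constructor
    · intro h l
      by_cases hl : DN l p < δ
      · exact Or.inr (h _ (hprs l p) hl)
      · exact Or.inl hl
    · intro h p' hp' hδ
      have he : 0 < Real.exp (θ * N) := Real.exp_pos _
      set e := Real.exp (θ * N)
      refine le_of_forall_pos_le_add fun ε hε => ?_
      set η := min (ε / (e + 1)) (δ - dist (Y0 (T^[N] p)) (Y0 (T^[N] p'))) with hη
      have hη0 : 0 < η := lt_min (by positivity) (by linarith)
      obtain ⟨l, h1, h2⟩ := hdense p' N η hη0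
      rw [hp'] at h1 h2
      have hη1 : η * (e + 1) ≤ ε := by
        rw [← le_div_iff₀ (by positivity)]
        exact min_le_left _ _
      have hη2 : η ≤ δ - dist (Y0 (T^[N] p)) (Y0 (T^[N] p')) := min_le_right _ _
      have t1 : DN l p ≤ dist (Y0 (T^[N] p)) (Y0 (T^[N] p')) + η :=
        (dist_triangle _ (Y0 (T^[N] p')) _).trans (by linarith)
      have t2 : DN l p < δ :=
        (dist_triangle _ (Y0 (T^[N] p')) _).trans_lt (by linarith)
      have t3 : dist (Y0 p) (Y0 p') ≤ D0 l p + η := by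
        refine (dist_triangle _ (Y0 (s l (pr p))) _).trans ?_
        rw [dist_comm (Y0 (s l (pr p)))]
        simp only [hD0]
        linarith
      have t4 : D0 l p ≤ e * DN l p := (h l).resolve_left (not_not.2 t2)
      nlinarith
  rw [this]
  exact MeasurableSet.iInter fun l => ((measurableSet_lt (hDNm l) measurable_const).compl).union
    (measurableSet_le (hD0m l) ((hDNm l).const_mul _))

theorem exists_measureReal_compl_slowSet_le [IsProbabilityMeasure M]
    {δ : ℕ → ℝ} {θ : ℝ} (hmeas : ∀ N, MeasurableSet (slowSet T pr Y0 (δ N) θ N))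
    (hexp : ∀ᵐ p ∂M, ∀ᶠ N in atTop, p ∈ slowSet T pr Y0 (δ N) θ N) {κ : ℝ} (hκ : 0 < κ) :
    ∃ N, 0 < N ∧ M.real (slowSet T pr Y0 (δ N) θ N)ᶜ ≤ κ := by
  have h := tendsto_measure_of_ae_tendsto_indicator_of_isFiniteMeasure (μ := M) atTop
    (A := ∅) MeasurableSet.empty (As := fun N => (slowSet T pr Y0 (δ N) θ N)ᶜ)
    (fun N => (hmeas N).compl) (by
      filter_upwards [hexp] with p hp
      filter_upwards [hp] with N hN
      simp [hN])
  rw [measure_empty] at h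
  have h2 := (h.eventually_lt_const (ENNReal.ofReal_pos.2 hκ)).and (eventually_gt_atTop 0)
  obtain ⟨N, hN, hN0⟩ := h2.exists
  refine ⟨N, hN0, ?_⟩
  rw [measureReal_def]
  exact ENNReal.toReal_le_of_le_ofReal hκ.le hN.le

theorem dist_le_pow_mul_dist {Λ : ℝ} (hΛ : 1 ≤ Λ)
    (hprT : ∀ p p', pr p = pr p' → pr (T p) = pr (T p'))
    (hlip : ∀ p p', pr p = pr p' → dist (Y0 p) (Y0 p') ≤ Λ * dist (Y0 (T p)) (Y0 (T p')))
    (k : ℕ) (p p' : Ω) (hpp : pr p = pr p') :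
    pr (T^[k] p) = pr (T^[k] p') ∧
      dist (Y0 p) (Y0 p') ≤ Λ ^ k * dist (Y0 (T^[k] p)) (Y0 (T^[k] p')) := by
  induction k generalizing p p' with
  | zero => simpa using hpp
  | succ k ih =>
    obtain ⟨h1, h2⟩ := ih (T p) (T p') (hprT p p' hpp)
    refine ⟨h1, (hlip p p' hpp).trans ?_⟩
    rw [pow_succ', mul_assoc]
    exact mul_le_mul_of_nonneg_left h2 (by linarith)

/-- If most points are slow for a single time `N`, then by Markov's inequality for the number of
blocks of length `N` that start outside of the slow set, for each time `j` the inverse of the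
`j`-th iterate expands small balls by a factor at most `Λ ^ N * exp (2 θ j)` around most points. -/
theorem exists_good_set [IsProbabilityMeasure M] (hT : MeasurePreserving T M M) {Λ : ℝ} (hΛ : 1 ≤ Λ)
    (hprT : ∀ p p', pr p = pr p' → pr (T p) = pr (T p'))
    (hlip : ∀ p p', pr p = pr p' → dist (Y0 p) (Y0 p') ≤ Λ * dist (Y0 (T p)) (Y0 (T p')))
    {δ θ κ : ℝ} (hθ : 0 < θ) {N : ℕ} (hN : 0 < N)
    (hmeas : MeasurableSet (slowSet T pr Y0 δ θ N))
    (hsmall : M.real (slowSet T pr Y0 δ θ N)ᶜ * Real.log Λ ≤ θ * κ) (hκ : 0 ≤ κ) (j : ℕ) :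
    ∃ G : Set Ω, MeasurableSet G ∧ M.real Gᶜ ≤ κ ∧ ∀ p ∈ G, ∀ p', pr p = pr p' →
      Λ ^ N * Real.exp (2 * θ * j) * dist (Y0 (T^[j] p)) (Y0 (T^[j] p')) < δ →
      dist (Y0 p) (Y0 p') ≤
        Λ ^ N * Real.exp (2 * θ * j) * dist (Y0 (T^[j] p)) (Y0 (T^[j] p')) := by
  set O := slowSet T pr Y0 δ θ N with hO
  have hlog : 0 ≤ Real.log Λ := Real.log_nonneg hΛ
  have hΛ0 : 0 < Λ := by linarith
  -- a block that starts at `p` expands distances backwards by at most `exp (N * (θ + b p))`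
  set b : Ω → ℝ := Oᶜ.indicator fun _ => Real.log Λ with hb
  have hb0 : ∀ p, 0 ≤ b p := fun p => Set.indicator_nonneg (fun _ _ => hlog) p
  have hbm : Measurable b := measurable_const.indicator hmeas.compl
  have hbI : Integrable b M := (integrable_const _).indicator hmeas.compl
  have hbint : ∫ p, b p ∂M ≤ θ * κ := by
    rw [hb, integral_indicator_const _ hmeas.compl]
    exact hsmall
  set q := j / N with hq
  set S := T^[N] with hS
  have hSmp : MeasurePreserving S M M := hT.iterate N
  set f : Ω → ℝ := fun p => ∑ l ∈ Finset.range q, b (S^[l] p) with hf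
  have hfm : Measurable f :=
    Finset.measurable_sum _ fun l _ => hbm.comp (hSmp.iterate l).measurable
  have hterm : ∀ l, Integrable (fun p => b (S^[l] p)) M := fun l =>
    (hSmp.iterate l).integrable_comp_of_integrable hbI
  have hfI : Integrable f M := integrable_finsetSum _ fun l _ => hterm l
  have hf0 : ∀ p, 0 ≤ f p := fun p => Finset.sum_nonneg fun l _ => hb0 _
  have hfint : ∫ p, f p ∂M ≤ q * (θ * κ) := by
    rw [hf, integral_finsetSum _ fun l _ => hterm l]
    refine (Finset.sum_le_card_nsmul _ _ (θ * κ) fun l _ => ?_).trans (by simp)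
    rw [integral_comp_of_measurePreserving (hSmp.iterate l) hbm]
    exact hbint
  refine ⟨{p | f p ≤ θ * q}, measurableSet_le hfm measurable_const, ?_, ?_⟩
  · rcases Nat.eq_zero_or_pos q with h0 | h0
    · have : {p | f p ≤ θ * q}ᶜ = ∅ := by
        ext p
        simp [hf, h0]
      rw [this]
      simpa using hκ
    · have hq0 : (0 : ℝ) < q := by exact_mod_cast h0
      have h1 := mul_meas_ge_le_integral_of_nonneg (Eventually.of_forall hf0) hfI (θ * q)
      have h2 : M.real {p | f p ≤ θ * q}ᶜ ≤ M.real {p | θ * q ≤ f p} := by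
        refine measureReal_mono fun p hp => ?_
        simp only [Set.mem_compl_iff, Set.mem_ofPred_eq, not_le] at hp ⊢
        exact hp.le
      have h3 : θ * q * M.real {p | f p ≤ θ * q}ᶜ ≤ θ * q * κ := by
        refine (mul_le_mul_of_nonneg_left h2 (by positivity)).trans (h1.trans (hfint.trans ?_))
        linarith [mul_comm (q : ℝ) (θ * κ), mul_comm (θ * q) κ, mul_assoc (q : ℝ) θ κ,
          mul_assoc θ (q : ℝ) κ, mul_left_comm (q : ℝ) θ κ]
      exact le_of_mul_le_mul_left h3 (by positivity)
  · intro p hp p' hpp hδ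
    have hp : f p ≤ θ * q := hp
    set w : Ω → ℝ := fun p => Real.exp (N * (θ + b p)) with hw
    have hw1 : ∀ p, 1 ≤ w p := fun p =>
      Real.one_le_exp (mul_nonneg (Nat.cast_nonneg _) (add_nonneg hθ.le (hb0 p)))
    have hblock : ∀ p p', pr p = pr p' → dist (Y0 (S p)) (Y0 (S p')) < δ →
        dist (Y0 p) (Y0 p') ≤ w p * dist (Y0 (S p)) (Y0 (S p')) := by
      intro a a' haa hlt
      by_cases ha : a ∈ O
      · have e1 : w a = Real.exp (θ * N) := by
          simp [hw, hb, ha, mul_comm]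
        rw [e1]
        exact ha a' haa.symm hlt
      · have e1 : Λ ^ N ≤ w a := by
          have : Λ ^ N = Real.exp (N * Real.log Λ) := by
            rw [mul_comm, Real.exp_mul, Real.exp_log hΛ0, Real.rpow_natCast]
          rw [this]
          refine Real.exp_le_exp.2 (mul_le_mul_of_nonneg_left ?_ (Nat.cast_nonneg _))
          simp [hb, ha, hθ.le]
        exact (dist_le_pow_mul_dist hΛ hprT hlip N a a' haa).2.trans
          (mul_le_mul_of_nonneg_right e1 dist_nonneg)
    have hSpr : ∀ p p', pr p = pr p' → pr (S p) = pr (S p') := fun a a' h =>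
      (dist_le_pow_mul_dist hΛ hprT hlip N a a' h).1
    have hSq : ∀ p, S^[q] p = T^[N * q] p := fun a => by rw [hS, ← Function.iterate_mul]
    have hj : N * q + j % N = j := Nat.div_add_mod j N
    have hrem : dist (Y0 (S^[q] p)) (Y0 (S^[q] p')) ≤
        Λ ^ N * dist (Y0 (T^[j] p)) (Y0 (T^[j] p')) := by
      rw [hSq, hSq]
      have h1 := dist_le_pow_mul_dist hΛ hprT hlip (N * q) p p' hpp
      have h2 := (dist_le_pow_mul_dist hΛ hprT hlip (j % N) _ _ h1.1).2
      rw [← Function.iterate_add_apply, ← Function.iterate_add_apply, add_comm, hj] at h2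
      exact h2.trans (mul_le_mul_of_nonneg_right
        (pow_le_pow_right₀ hΛ (Nat.mod_lt _ hN).le) dist_nonneg)
    have hprod : ∏ l ∈ Finset.range q, w (S^[l] p) ≤ Real.exp (2 * θ * j) := by
      simp only [hw]
      rw [← Real.exp_sum, ← Finset.mul_sum, Finset.sum_add_distrib]
      refine Real.exp_le_exp.2 ?_
      simp only [Finset.sum_const, Finset.card_range, nsmul_eq_mul]
      have e1 : (N : ℝ) * (q * θ + f p) ≤ N * (2 * θ * q) :=
        mul_le_mul_of_nonneg_left (by linarith [mul_comm (q : ℝ) θ]) (Nat.cast_nonneg _)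
      have e2 : (N : ℝ) * q ≤ j := by
        have : N * q ≤ j := by omega
        exact_mod_cast this
      have e3 := mul_le_mul_of_nonneg_left e2 (by positivity : 0 ≤ 2 * θ)
      calc (N : ℝ) * (q * θ + f p) ≤ 2 * θ * (N * q) := by linarith
        _ ≤ 2 * θ * j := e3
    have htot : (∏ l ∈ Finset.range q, w (S^[l] p)) * dist (Y0 (S^[q] p)) (Y0 (S^[q] p')) ≤
        Λ ^ N * Real.exp (2 * θ * j) * dist (Y0 (T^[j] p)) (Y0 (T^[j] p')) := by
      refine (mul_le_mul hprod hrem dist_nonneg (Real.exp_pos _).le).trans (le_of_eq ?_)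
      ring
    exact (dist_le_prod_mul_dist hSpr hw1 hblock q p p' hpp (htot.trans_lt hδ)).trans htot

end SlowSet

/-! ### Fine discretizations -/

theorem log_two_gt_half : (1 : ℝ) / 2 < Real.log 2 := by
  have := Real.log_two_gt_d9
  linarith

theorem exists_nat_pow_bounds {a θ : ℝ} (hθ : 0 ≤ θ) (ha : 0 < a) (n : ℕ) :
    ∃ k : ℕ, a * Real.exp (2 * θ * n) * (1 / 2) ^ k < 1 ∧
      (k : ℝ) ≤ 2 * |Real.log a| + 4 * θ * n + 2 := by
  have h2 : (1 : ℝ) / 2 < Real.log 2 := log_two_gt_half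
  have hl : 0 < Real.log 2 := by linarith
  set x := |Real.log a| + 2 * θ * n with hx
  have hx0 : 0 ≤ x := by positivity
  refine ⟨⌈x / Real.log 2⌉₊ + 1, ?_, ?_⟩
  · set k := ⌈x / Real.log 2⌉₊ + 1 with hk
    have hkx : x < k * Real.log 2 := by
      have h1 : x / Real.log 2 ≤ ⌈x / Real.log 2⌉₊ := Nat.le_ceil _
      rw [div_le_iff₀ hl] at h1
      rw [hk]
      push_cast
      linarith
    have e1 : a * Real.exp (2 * θ * n) * (1 / 2) ^ k =
        Real.exp (Real.log a + 2 * θ * n - k * Real.log 2) := by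
      rw [Real.exp_sub, Real.exp_add, Real.exp_log ha, mul_comm (k : ℝ),
        Real.exp_mul (Real.log 2), Real.exp_log two_pos, Real.rpow_natCast, one_div, inv_pow,
        div_eq_mul_inv]
    rw [e1, Real.exp_lt_one_iff]
    linarith [le_abs_self (Real.log a)]
  · have h1 : (⌈x / Real.log 2⌉₊ : ℝ) < x / Real.log 2 + 1 :=
      Nat.ceil_lt_add_one (by positivity)
    have h3 : x / Real.log 2 ≤ 2 * x := by
      rw [div_le_iff₀ hl]
      nlinarith
    push_cast
    linarith

section Fineness

variable {Ω X Y : Type*} {𝓑 : MeasurableSpace X} {𝓣 : MeasurableSpace Ω}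
  {mΩ : MeasurableSpace Ω} {M : Measure Ω} [IsProbabilityMeasure M] {T : Ω → Ω}
  [PseudoMetricSpace Y] [SecondCountableTopology Y] [MeasurableSpace Y] [BorelSpace Y]
  {pr : Ω → X} {Y0 : Ω → Y}

/-- The position in the fiber at time `0` can be recovered, up to a small error, from the base
point and from the position in the fiber at time `j < n` read with a precision `2 ^ (-k)`, where
`k` is small compared to `n`. This is the hypothesis of `integral_comp_mul_eq_zero`. -/
theorem exists_fine_discretization (hT : MeasurePreserving T M M) (h𝓣 : 𝓣 ≤ mΩ)
    (hT𝓣 : Measurable[𝓣, 𝓣] T) (hY0 : Measurable[𝓣] Y0) (hpr : Measurable[mΩ, 𝓑] pr)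
    {s : ℕ → X → Ω} (hs : ∀ l, Measurable[𝓑, 𝓣] (s l)) (hprs : ∀ l p, pr (s l (pr p)) = pr p)
    (hdense : ∀ p N, ∀ ε > 0, ∃ l, dist (Y0 p) (Y0 (s l (pr p))) < ε ∧
      dist (Y0 (T^[N] p)) (Y0 (T^[N] (s l (pr p)))) < ε)
    {Λ : ℝ} (hΛ : 1 ≤ Λ)
    (hprT : ∀ p p', pr p = pr p' → pr (T p) = pr (T p'))
    (hlip : ∀ p p', pr p = pr p' → dist (Y0 p) (Y0 p') ≤ Λ * dist (Y0 (T p)) (Y0 (T p')))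
    {δ : ℕ → ℝ} (hδ : ∀ N, 0 < δ N)
    (hexp : ∀ θ > 0, ∀ᵐ p ∂M, ∀ᶠ N in atTop, p ∈ slowSet T pr Y0 (δ N) θ N)
    (hnet : ∀ η > 0, ∃ Y' : Set Y, MeasurableSet Y' ∧ M.real (Y0 ⁻¹' Y'ᶜ) ≤ η ∧
      ∃ C Q : ℝ, 1 ≤ C ∧ 1 ≤ Q ∧ ∀ k : ℕ, ∃ S : Finset Y, (S.card : ℝ) ≤ C * Q ^ k ∧
        ∀ y ∈ Y', ∃ s ∈ S, dist y s < (1 / 2) ^ k)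
    {ψ : Y → ℝ} {A : ℝ} (hA : 0 < A) (hψ : ∀ y y', |ψ y - ψ y'| ≤ A * dist y y')
    (hψ1 : ∀ y, |ψ y| ≤ 1) {ε : ℝ} (hε : 0 < ε) :
    ∃ n : ℕ, 0 < n ∧ ∃ K : ℕ, ∃ Z : Ω → Fin K, Measurable[mΩ] Z ∧
      2 * Real.log (2 * K) ≤ ε * n ∧ ∀ j < n, ∃ h : Fin K → Ω → ℝ,
        (∀ z, Measurable[𝓑.comap pr] (h z)) ∧ (∀ z p, |h z p| ≤ 1) ∧
        ∫ p, |ψ (Y0 p) - h (Z (T^[j] p)) p| ∂M ≤ ε := by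
  obtain ⟨p₀⟩ : Nonempty Ω := M.nonempty_of_neZero
  have hYne : Nonempty Y := ⟨Y0 p₀⟩
  have hY0m : Measurable[mΩ] Y0 := hY0.mono h𝓣 le_rfl
  have hTn : ∀ n, Measurable[𝓣, 𝓣] T^[n] := fun n => @Measurable.iterate Ω 𝓣 T hT𝓣 n
  have hsm : ∀ l n, Measurable[mΩ] fun p => Y0 (T^[n] (s l (pr p))) := fun l n =>
    (hY0.comp ((hTn n).comp (hs l))).comp hpr
  obtain ⟨Y', hY', hY'ε, C, Q, hC, hQ, hCQ⟩ := hnet (ε / 8) (by positivity)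
  have hlQ : 0 ≤ Real.log Q := Real.log_nonneg hQ
  have hlΛ : 0 ≤ Real.log Λ := Real.log_nonneg hΛ
  -- a rate for which the nets at time `n` have at most `exp (ε n / 4)` points, up to a constant
  set θ := ε / (16 * (Real.log Q + 1)) with hθdef
  have hθ : 0 < θ := by positivity
  have hmeas : ∀ N, MeasurableSet[mΩ] (slowSet T pr Y0 (δ N) θ N) := fun N =>
    measurableSet_slowSet hT.measurable hY0m hsm hprs hdense _ _ _
  obtain ⟨N, hN, hNsmall⟩ := exists_measureReal_compl_slowSet_le hmeas (hexp θ hθ)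
    (κ := θ * (ε / 8) / (Real.log Λ + 1)) (by positivity)
  have hsmall : M.real (slowSet T pr Y0 (δ N) θ N)ᶜ * Real.log Λ ≤ θ * (ε / 8) := by
    rw [le_div_iff₀ (by positivity)] at hNsmall
    nlinarith [measureReal_nonneg (μ := M) (s := (slowSet T pr Y0 (δ N) θ N)ᶜ)]
  have hgood := fun j => exists_good_set hT hΛ hprT hlip hθ hN (hmeas N) hsmall
    (by positivity : 0 ≤ ε / 8) j
  -- the precision that is needed at time `0`
  set μ := min (δ N) (ε / (2 * A)) with hμ
  have hμ0 : 0 < μ := lt_min (hδ N) (by positivity)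
  set a := 3 * Λ ^ N / μ with ha
  have hΛN : 0 < Λ ^ N := by positivity
  have ha0 : 0 < a := by positivity
  -- the number of iterates
  set c₀ := 2 * Real.log (4 * C) + 2 * (2 * |Real.log a| + 2) * Real.log Q with hc₀
  obtain ⟨n, hn⟩ := exists_nat_ge (max 1 (2 * c₀ / ε))
  have hn1 : (1 : ℝ) ≤ n := (le_max_left _ _).trans hn
  have hn0 : 0 < n := by exact_mod_cast (by linarith : (0 : ℝ) < n)
  have hnc : c₀ ≤ ε * n / 2 := by
    have := (le_max_right _ _).trans hn
    rw [div_le_iff₀ hε] at this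
    linarith
  obtain ⟨k, hk1, hk2⟩ := exists_nat_pow_bounds hθ.le ha0 n
  obtain ⟨S, hS, hSnet⟩ := hCQ k
  set ρ : ℝ := (1 / 2) ^ k with hρ
  have hρ0 : 0 < ρ := by positivity
  obtain ⟨ζ, hζ, ctr, hctr⟩ := exists_measurable_nearest S ρ
  refine ⟨n, hn0, S.card + 1, ζ ∘ Y0, hζ.comp hY0m, ?_, ?_⟩
  · have hQk : 1 ≤ Q ^ k := one_le_pow₀ hQ
    have h1 : (2 : ℝ) * ((S.card + 1 : ℕ) : ℝ) ≤ 4 * C * Q ^ k := by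
      push_cast
      nlinarith
    have h2 : Real.log (2 * ((S.card + 1 : ℕ) : ℝ)) ≤ Real.log (4 * C) + k * Real.log Q := by
      rw [← Real.log_pow, ← Real.log_mul (by positivity) (by positivity)]
      exact Real.log_le_log (by positivity) h1
    have h3 : (k : ℝ) * Real.log Q ≤ (2 * |Real.log a| + 4 * θ * n + 2) * Real.log Q :=
      mul_le_mul_of_nonneg_right hk2 hlQ
    have h4 : 8 * (θ * Real.log Q) ≤ ε / 2 := by
      have : θ * (16 * (Real.log Q + 1)) = ε := by rw [hθdef]; field_simp
      nlinarith
    have h5 : 8 * (θ * Real.log Q) * n ≤ ε / 2 * n :=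
      mul_le_mul_of_nonneg_right h4 (by positivity)
    have h6 : 2 * Real.log (2 * ((S.card + 1 : ℕ) : ℝ)) ≤ c₀ + 8 * (θ * Real.log Q) * n := by
      rw [hc₀]
      nlinarith
    linarith
  · intro j hj
    obtain ⟨G, hGm, hGε, hG⟩ := hgood j
    -- the values of `ψ` at the sample points of the fiber whose image is close to the center `z`
    set F : ℕ → Fin (S.card + 1) → X → ℝ := fun l z x =>
      if dist (Y0 (T^[j] (s l x))) (ctr z) < 2 * ρ then ψ (Y0 (s l x)) else -1 with hF
    have hψm : Measurable ψ := by
      refine (LipschitzWith.of_dist_le_mul (K := A.toNNReal) fun y y' => ?_).continuous.measurable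
      rw [Real.coe_toNNReal _ hA.le]
      exact hψ y y'
    have hFm : ∀ l z, Measurable[𝓑] (F l z) := by
      intro l z
      have h1 : Measurable[𝓑] fun x => Y0 (s l x) := hY0.comp (hs l)
      have h2 : Measurable[𝓑] fun x => Y0 (T^[j] (s l x)) := hY0.comp ((hTn j).comp (hs l))
      refine Measurable.ite ?_ (hψm.comp h1) measurable_const
      exact measurableSet_lt (h2.dist measurable_const) measurable_const
    have hF1 : ∀ l z x, |F l z x| ≤ 1 := by
      intro l z x
      simp only [hF]
      split_ifs
      · exact hψ1 _
      · simp
    have hFbdd : ∀ z x, BddAbove (Set.range fun l => F l z x) := by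
      refine fun z x => ⟨1, ?_⟩
      rintro _ ⟨l, rfl⟩
      exact (abs_le.1 (hF1 l z x)).2
    set H : Fin (S.card + 1) → X → ℝ := fun z x => ⨆ l, F l z x with hH
    have hHm : ∀ z, Measurable[𝓑] (H z) := fun z => Measurable.iSup fun l => hFm l z
    have hH1 : ∀ z x, |H z x| ≤ 1 := by
      intro z x
      rw [abs_le]
      exact ⟨(abs_le.1 (hF1 0 z x)).1.trans (le_ciSup (hFbdd z x) 0),
        ciSup_le fun l => (abs_le.1 (hF1 l z x)).2⟩
    refine ⟨fun z p => H z (pr p), fun z => (hHm z).comp (comap_measurable pr),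
      fun z p => hH1 z _, ?_⟩
    set B : Set Ω := G ∩ T^[j] ⁻¹' (Y0 ⁻¹' Y') with hB
    have hBm : MeasurableSet[mΩ] B :=
      hGm.inter ((hT.iterate j).measurable (hY0m hY'))
    have hBε : M.real Bᶜ ≤ ε / 4 := by
      have e1 : Bᶜ = Gᶜ ∪ T^[j] ⁻¹' (Y0 ⁻¹' Y'ᶜ) := by
        rw [hB, Set.compl_inter]
        rfl
      have e2 : M.real (T^[j] ⁻¹' (Y0 ⁻¹' Y'ᶜ)) = M.real (Y0 ⁻¹' Y'ᶜ) :=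
        (hT.iterate j).measureReal_preimage (hY0m hY'.compl).nullMeasurableSet
      rw [e1]
      refine (measureReal_union_le _ _).trans ?_
      rw [e2]
      linarith
    have hclose : ∀ p ∈ B, |ψ (Y0 p) - H (ζ (Y0 (T^[j] p))) (pr p)| ≤ ε / 2 := by
      rintro p ⟨hpG, hpY⟩
      set z := ζ (Y0 (T^[j] p)) with hz
      have hpz : dist (Y0 (T^[j] p)) (ctr z) < ρ := hctr _ (hSnet _ hpY)
      have hnear : ∀ l, dist (Y0 (T^[j] (s l (pr p)))) (ctr z) < 2 * ρ →
          |ψ (Y0 p) - ψ (Y0 (s l (pr p)))| ≤ ε / 2 := by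
        intro l hl
        have h1 : dist (Y0 (T^[j] p)) (Y0 (T^[j] (s l (pr p)))) ≤ 3 * ρ := by
          refine (dist_triangle_right _ _ (ctr z)).trans ?_
          linarith
        have h2 : Λ ^ N * Real.exp (2 * θ * j) *
            dist (Y0 (T^[j] p)) (Y0 (T^[j] (s l (pr p)))) < μ := by
          have e1 : Real.exp (2 * θ * j) ≤ Real.exp (2 * θ * n) := by
            refine Real.exp_le_exp.2 (mul_le_mul_of_nonneg_left ?_ (by positivity))
            exact_mod_cast hj.le
          have e2 : Λ ^ N * Real.exp (2 * θ * j) *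
              dist (Y0 (T^[j] p)) (Y0 (T^[j] (s l (pr p)))) ≤
              Λ ^ N * Real.exp (2 * θ * n) * (3 * ρ) := by
            gcongr
          have e3 : Λ ^ N * Real.exp (2 * θ * n) * (3 * ρ) =
              μ * (a * Real.exp (2 * θ * n) * ρ) := by
            rw [ha]
            field_simp
          rw [e3] at e2
          exact e2.trans_lt (mul_lt_of_lt_one_right hμ0 hk1)
        have h3 := hG p hpG (s l (pr p)) (hprs l p).symm (h2.trans_le (min_le_left _ _))
        have h4 : dist (Y0 p) (Y0 (s l (pr p))) ≤ ε / (2 * A) :=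
          h3.trans (h2.le.trans (min_le_right _ _))
        refine (hψ _ _).trans ((mul_le_mul_of_nonneg_left h4 hA.le).trans (le_of_eq ?_))
        field_simp
      obtain ⟨l, -, hl⟩ := hdense p j ρ hρ0
      have hl' : dist (Y0 (T^[j] (s l (pr p)))) (ctr z) < 2 * ρ := by
        refine (dist_triangle_left _ _ (Y0 (T^[j] p))).trans_lt ?_
        linarith
      rw [abs_le]
      constructor
      · have : H z (pr p) ≤ ψ (Y0 p) + ε / 2 := by
          refine ciSup_le fun l => ?_
          simp only [hF]
          split_ifs with h
          · linarith [(abs_le.1 (hnear l h)).1]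
          · linarith [(abs_le.1 (hψ1 (Y0 p))).1]
        linarith
      · have h1 : F l z (pr p) ≤ H z (pr p) := le_ciSup (hFbdd z (pr p)) l
        have h2 : F l z (pr p) = ψ (Y0 (s l (pr p))) := by
          simp only [hF, if_pos hl']
        linarith [(abs_le.1 (hnear l hl')).2]
    have hle : ∀ p, |ψ (Y0 p) - H (ζ (Y0 (T^[j] p))) (pr p)| ≤
        ε / 2 + Bᶜ.indicator (fun _ => (2 : ℝ)) p := by
      intro p
      by_cases hp : p ∈ B
      · simpa [hp] using hclose p hp
      · have h1 := abs_le.1 (hψ1 (Y0 p))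
        have h2 := abs_le.1 (hH1 (ζ (Y0 (T^[j] p))) (pr p))
        have h3 : Bᶜ.indicator (fun _ => (2 : ℝ)) p = 2 := by simp [hp]
        rw [h3, abs_le]
        constructor <;> linarith
    have hI : Integrable (fun p => ε / 2 + Bᶜ.indicator (fun _ => (2 : ℝ)) p) M :=
      (integrable_const _).add ((integrable_const _).indicator hBm.compl)
    refine (integral_mono_of_nonneg (Eventually.of_forall fun p => abs_nonneg _) hI
      (Eventually.of_forall hle)).trans ?_
    rw [integral_add (integrable_const _) ((integrable_const _).indicator hBm.compl),
      integral_indicator_const _ hBm.compl]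
    simp only [integral_const, probReal_univ, smul_eq_mul, one_mul]
    linarith

end Fineness

/-! ### Approximation by Lipschitz observables -/

section Closing

variable {Ω X Y : Type*} {𝓑 : MeasurableSpace X} {mΩ : MeasurableSpace Ω} {M : Measure Ω}
  [IsProbabilityMeasure M] [PseudoMetricSpace Y]
  {T : Ω → Ω} {pr : Ω → X} {Y0 : Ω → Y}

/-- A closed set is the decreasing limit of Lipschitz functions. -/
theorem tendsto_one_sub_mul_infDist_indicator {C : Set Y} (hC : IsClosed C) (hne : C.Nonempty)
    (y : Y) :
    Tendsto (fun n : ℕ => max 0 (1 - (n + 1 : ℝ) * Metric.infDist y C)) atTop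
      (𝓝 (C.indicator (fun _ => (1 : ℝ)) y)) := by
  by_cases hy : y ∈ C
  · simp [hy, Metric.infDist_zero_of_mem hy]
  · have hpos : 0 < Metric.infDist y C := (hC.notMem_iff_infDist_pos hne).1 hy
    rw [Set.indicator_of_notMem hy]
    refine tendsto_const_nhds.congr' ?_
    obtain ⟨n₀, hn₀⟩ := exists_nat_ge (1 / Metric.infDist y C)
    filter_upwards [eventually_ge_atTop n₀] with n hn
    symm
    rw [max_eq_left_iff, sub_nonpos]
    rw [div_le_iff₀ hpos] at hn₀
    have : (n₀ : ℝ) ≤ n + 1 := by exact_mod_cast hn.trans (Nat.le_succ n)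
    nlinarith

theorem isPiSystem_preimage_inter_preimage_isClosed :
    IsPiSystem {A : Set Ω | ∃ B C, MeasurableSet[𝓑] B ∧ IsClosed C ∧ A = pr ⁻¹' B ∩ Y0 ⁻¹' C} := by
  rintro _ ⟨B, C, hB, hC, rfl⟩ _ ⟨B', C', hB', hC', rfl⟩ _
  refine ⟨B ∩ B', C ∩ C', hB.inter hB', hC.inter hC', ?_⟩
  ext p
  simp only [Set.mem_inter_iff, Set.mem_preimage]
  tauto

variable [MeasurableSpace Y] [BorelSpace Y]

theorem comap_prodMk_eq_generateFrom :
    (𝓑.prod ‹MeasurableSpace Y›).comap (fun p => (pr p, Y0 p)) = MeasurableSpace.generateFrom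
      {A : Set Ω | ∃ B C, MeasurableSet[𝓑] B ∧ IsClosed C ∧ A = pr ⁻¹' B ∩ Y0 ⁻¹' C} := by
  apply le_antisymm
  · rw [MeasurableSpace.prod, MeasurableSpace.comap_sup, MeasurableSpace.comap_comp,
      MeasurableSpace.comap_comp]
    refine sup_le ?_ ?_
    · rintro _ ⟨B, hB, rfl⟩
      refine MeasurableSpace.measurableSet_generateFrom ⟨B, Set.univ, hB, isClosed_univ, ?_⟩
      simp only [Set.preimage_univ, Set.inter_univ]
      rfl
    · rw [BorelSpace.measurable_eq (α := Y), borel_eq_generateFrom_isClosed,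
        MeasurableSpace.comap_generateFrom]
      refine MeasurableSpace.generateFrom_mono ?_
      rintro _ ⟨C, hC, rfl⟩
      refine ⟨Set.univ, C, MeasurableSet.univ, hC, ?_⟩
      simp only [Set.preimage_univ, Set.univ_inter]
      rfl
  · refine MeasurableSpace.generateFrom_le ?_
    rintro _ ⟨B, C, hB, hC, rfl⟩
    exact ⟨B ×ˢ C, @MeasurableSet.prod X Y 𝓑 _ _ _ hB hC.measurableSet, rfl⟩

/-- If Lipschitz functions of `Y0` can be recovered from few data at positive times, then all the
events that depend on the base point and on `Y0` are as well known at time `0` as at time `1`. -/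
theorem sameInformation_of_forall_lipschitz (hT : MeasurePreserving T M M)
    (hpr : Measurable[mΩ, 𝓑] pr) (hY0 : Measurable[mΩ] Y0)
    {f : X → X} (hf : Measurable[𝓑, 𝓑] f) (hprT : ∀ p, pr (T p) = f (pr p))
    (hfine : ∀ (ψ : Y → ℝ) (A : ℝ), 0 < A → (∀ y y', |ψ y - ψ y'| ≤ A * dist y y') →
      (∀ y, |ψ y| ≤ 1) → ∀ ε > 0, ∃ n : ℕ, 0 < n ∧ ∃ K : ℕ, ∃ Z : Ω → Fin K, Measurable[mΩ] Z ∧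
      2 * Real.log (2 * K) ≤ ε * n ∧ ∀ j < n, ∃ h : Fin K → Ω → ℝ,
        (∀ z, Measurable[𝓑.comap pr] (h z)) ∧ (∀ z p, |h z p| ≤ 1) ∧
        ∫ p, |ψ (Y0 p) - h (Z (T^[j] p)) p| ∂M ≤ ε)
    {U : Set Ω} (hU : MeasurableSet[(𝓑.prod ‹MeasurableSpace Y›).comap fun p => (pr p, Y0 p)] U) :
    SameInformation M T (𝓑.comap pr) U := by
  have h𝓖 : 𝓑.comap pr ≤ mΩ := hpr.comap_le
  have hcomp : pr ∘ T = f ∘ pr := funext hprT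
  have hdec : (𝓑.comap pr).comap T ≤ 𝓑.comap pr := by
    rw [MeasurableSpace.comap_comp, hcomp, ← MeasurableSpace.comap_comp]
    exact MeasurableSpace.comap_mono hf.comap_le
  have h𝓣 : (𝓑.prod ‹MeasurableSpace Y›).comap (fun p => (pr p, Y0 p)) ≤ mΩ := by
    rw [MeasurableSpace.prod, MeasurableSpace.comap_sup, MeasurableSpace.comap_comp,
      MeasurableSpace.comap_comp]
    exact sup_le hpr.comap_le hY0.comap_le
  refine sameInformation_of_generateFrom hT.measurable h𝓖 h𝓣 comap_prodMk_eq_generateFrom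
    isPiSystem_preimage_inter_preimage_isClosed ?_ hU
  rintro _ ⟨B, C, hB, hC, rfl⟩ w hw hw1 hw0
  rcases C.eq_empty_or_nonempty with rfl | hne
  · simp
  set w' : Ω → ℝ := (pr ⁻¹' (f ⁻¹' B)).indicator w with hw'
  have hfB : MeasurableSet[𝓑.comap pr] (pr ⁻¹' (f ⁻¹' B)) := ⟨_, hf hB, rfl⟩
  have hw'm : Measurable[𝓑.comap pr] w' := hw.indicator hfB
  have hw'1 : ∀ p, |w' p| ≤ 1 := by
    intro p
    by_cases hp : p ∈ pr ⁻¹' (f ⁻¹' B)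
    · rw [hw', Set.indicator_of_mem hp]
      exact hw1 p
    · rw [hw', Set.indicator_of_notMem hp]
      simp
  have hfB' : MeasurableSet[(𝓑.comap pr).comap T] (pr ⁻¹' (f ⁻¹' B)) := by
    refine ⟨pr ⁻¹' B, ⟨B, hB, rfl⟩, ?_⟩
    rw [← Set.preimage_comp, hcomp, Set.preimage_comp]
  have hw'0 : ∀ G, MeasurableSet[(𝓑.comap pr).comap T] G → ∫ p in G, w' p ∂M = 0 := by
    intro G hG
    rw [hw', setIntegral_indicator (h𝓖 _ hfB)]
    exact hw0 _ (hG.inter hfB')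
  set φ : ℕ → Y → ℝ := fun n y => max 0 (1 - (n + 1 : ℝ) * Metric.infDist y C) with hφ
  have hφ01 : ∀ n y, |φ n y| ≤ 1 := by
    intro n y
    rw [abs_of_nonneg (le_max_left _ _)]
    refine max_le zero_le_one ?_
    have : 0 ≤ (n + 1 : ℝ) * Metric.infDist y C := mul_nonneg (by positivity) Metric.infDist_nonneg
    linarith
  have hφL : ∀ n y y', |φ n y - φ n y'| ≤ (n + 1 : ℝ) * dist y y' := by
    intro n y y'
    simp only [hφ, max_comm (0 : ℝ)]
    refine (abs_max_sub_max_le_abs _ _ _).trans ?_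
    have h1 : |Metric.infDist y C - Metric.infDist y' C| ≤ dist y y' := by
      have := (Metric.lipschitz_infDist_pt C).dist_le_mul y y'
      simpa [Real.dist_eq] using this
    have h2 : (1 - (n + 1 : ℝ) * Metric.infDist y C) - (1 - (n + 1 : ℝ) * Metric.infDist y' C) =
      (n + 1 : ℝ) * -(Metric.infDist y C - Metric.infDist y' C) := by ring
    rw [h2, abs_mul, abs_neg, abs_of_pos (by positivity : (0 : ℝ) < n + 1)]
    gcongr
  have hφm : ∀ n, Measurable fun p => φ n (Y0 p) := by
    intro n
    have : Continuous (φ n) := by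
      simp only [hφ]
      exact continuous_const.max (continuous_const.sub (continuous_const.mul
        (Metric.continuous_infDist_pt C)))
    exact this.measurable.comp hY0
  have hzero : ∀ n, ∫ p, φ n (Y0 (T p)) * w' p ∂M = 0 := fun n =>
    integral_comp_mul_eq_zero (g := fun p => φ n (Y0 p)) hT h𝓖 hdec (hφm n) (fun p => hφ01 n _)
      (hfine (φ n) (n + 1) (by positivity) (hφL n) (hφ01 n)) hw'm hw'1 hw'0
  have hlim : Tendsto (fun n => ∫ p, φ n (Y0 (T p)) * w' p ∂M) atTop
      (𝓝 (∫ p, C.indicator (fun _ => (1 : ℝ)) (Y0 (T p)) * w' p ∂M)) := by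
    refine tendsto_integral_of_dominated_convergence (fun _ => 1) ?_ (integrable_const _) ?_ ?_
    · exact fun n => (((hφm n).comp hT.measurable).mul
        (hw'm.mono h𝓖 le_rfl)).aestronglyMeasurable
    · refine fun n => Eventually.of_forall fun p => ?_
      rw [Real.norm_eq_abs, abs_mul]
      exact mul_le_one₀ (hφ01 _ _) (abs_nonneg _) (hw'1 p)
    · refine Eventually.of_forall fun p => ?_
      exact (tendsto_one_sub_mul_infDist_indicator hC hne (Y0 (T p))).mul_const _
  simp_rw [hzero] at hlim
  have h0 := tendsto_nhds_unique hlim tendsto_const_nhds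
  rw [← h0, ← integral_indicator (hT.measurable ((hpr hB).inter (hY0 hC.measurableSet)))]
  refine integral_congr_ae (Eventually.of_forall fun p => ?_)
  by_cases h1 : Y0 (T p) ∈ C <;> by_cases h2 : f (pr p) ∈ B <;>
    simp [hw', h1, h2, Set.indicator, hprT]

end Closing

/-! ### The metric form of the invariance principle -/

section Bundle

theorem bundleMap_iterate {X : Type*} {E : X → Type*} (f : X → X) (F : ∀ x, E x → E (f x)) (n : ℕ)
    (p : FiberTotal E) :
    (bundleMap f F)^[n] p = ⟨f^[n] p.base, fiberIter f F n p.base p.point⟩ := by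
  induction n generalizing p with
  | zero => rfl
  | succ n ih => rw [Function.iterate_succ, Function.comp_apply, ih]; rfl

theorem continuous_fiberIter {X : Type*} {E : X → Type*} [∀ x, TopologicalSpace (E x)] {f : X → X}
    {F : ∀ x, E x → E (f x)} (hF : ∀ x, Continuous (F x)) (n : ℕ) (x : X) :
    Continuous (fiberIter f F n x) := by
  induction n generalizing x with
  | zero => exact continuous_id
  | succ n ih => exact (ih (f x)).comp (hF x)

theorem measurable_nullCompletion_of_finerMod0 {X : Type*} {𝓑 : MeasurableSpace X}
    [𝓐 : MeasurableSpace X] {m : Measure X} {f : X → X} (hf : MeasurePreserving f m m)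
    (hnoninc : FinerMod0 𝓑 (𝓑.comap f) m) :
    Measurable[nullCompletion 𝓑 m, nullCompletion 𝓑 m] f := by
  rintro A ⟨hA, B, hB, hAB⟩
  obtain ⟨B', hB', h⟩ := hnoninc (f ⁻¹' B) ⟨B, hB, rfl⟩
  refine ⟨hf.measurable hA, B', hB', ?_⟩
  exact (hf.quasiMeasurePreserving.preimage_ae_eq hAB).trans
    (measure_symmDiff_eq_zero_iff.1 h).symm

/-- Finite nets of finitely many models give finite nets of a large part of the total space. -/
theorem exists_nets_of_forall_model {N : ℕ → Type*} [∀ i, MetricSpace (N i)]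
    {J : Set ℕ} (hnet : ∀ i ∈ J, ∃ C Q : ℝ, ∀ k : ℕ, ∃ S : Finset (N i), (S.card : ℝ) ≤ C * Q ^ k ∧
      ∀ y, ∃ s ∈ S, dist y s < (1 / 2) ^ k) (I : ℕ) :
    ∃ C Q : ℝ, 1 ≤ C ∧ 1 ≤ Q ∧ ∀ k : ℕ, ∃ S : Finset (Σ i, N i), (S.card : ℝ) ≤ C * Q ^ k ∧
      ∀ i ≤ I, i ∈ J → ∀ y : N i, ∃ s : N i, (⟨i, s⟩ : Σ i, N i) ∈ S ∧ dist y s < (1 / 2) ^ k := by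
  have hnet' : ∀ i, ∃ C Q : ℝ, ∀ k : ℕ, ∃ S : Finset (N i), (S.card : ℝ) ≤ C * Q ^ k ∧
      (i ∈ J → ∀ y, ∃ s ∈ S, dist y s < (1 / 2) ^ k) := by
    intro i
    by_cases hi : i ∈ J
    · obtain ⟨C, Q, h⟩ := hnet i hi
      refine ⟨C, Q, fun k => ?_⟩
      obtain ⟨S, hS, h⟩ := h k
      exact ⟨S, hS, fun _ => h⟩
    · exact ⟨0, 0, fun k => ⟨∅, by simp, fun h => absurd h hi⟩⟩
  choose C Q S hS hSnet using hnet'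
  refine ⟨1 + ∑ i ∈ Finset.range (I + 1), |C i|, 1 + ∑ i ∈ Finset.range (I + 1), |Q i|,
    by simpa using Finset.sum_nonneg fun _ _ => abs_nonneg _,
    by simpa using Finset.sum_nonneg fun _ _ => abs_nonneg _, fun k => ?_⟩
  set Q' := 1 + ∑ i ∈ Finset.range (I + 1), |Q i| with hQ'
  have hQ'1 : 0 ≤ Q' := by positivity
  refine ⟨(Finset.range (I + 1)).sigma fun i => S i k, ?_, fun i hi hiJ y => ?_⟩
  · rw [Finset.card_sigma]
    push_cast
    have : ∀ i ∈ Finset.range (I + 1), ((S i k).card : ℝ) ≤ |C i| * Q' ^ k := by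
      intro i hi
      refine (hS i k).trans ((le_abs_self _).trans ?_)
      rw [abs_mul, abs_pow]
      have : |Q i| ≤ Q' := by
        have := Finset.single_le_sum (f := fun i => |Q i|) (fun _ _ => abs_nonneg _) hi
        linarith
      gcongr
    refine (Finset.sum_le_sum this).trans ?_
    rw [← Finset.sum_mul]
    have : 0 ≤ Q' ^ k := by positivity
    nlinarith
  · obtain ⟨s, hs, hd⟩ := hSnet i k hiJ y
    exact ⟨s, by simpa [Nat.lt_succ_iff] using ⟨hi, hs⟩, hd⟩

theorem exists_measureReal_lt_le {X : Type*} [MeasurableSpace X] (m : Measure X)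
    [IsProbabilityMeasure m] {idx : X → ℕ} (hidx : Measurable idx) {η : ℝ} (hη : 0 < η) :
    ∃ I, m.real {x | I < idx x} ≤ η := by
  have h := tendsto_measure_of_ae_tendsto_indicator_of_isFiniteMeasure (μ := m) atTop
    (A := ∅) MeasurableSet.empty (As := fun I : ℕ => {x | I < idx x})
    (fun I => hidx measurableSet_Ioi) (by
      refine Eventually.of_forall fun x => ?_
      filter_upwards [eventually_ge_atTop (idx x)] with I hI
      simpa using hI)
  rw [measure_empty] at h
  obtain ⟨I, hI⟩ := (h.eventually_lt_const (ENNReal.ofReal_pos.2 hη)).exists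
  exact ⟨I, ENNReal.toReal_le_of_le_ofReal hη.le hI.le⟩

variable {X : Type*} {N : ℕ → Type*} {idx : X → ℕ} {E : X → Type*} [∀ x, TopologicalSpace (E x)]

variable [∀ i, MetricSpace (N i)] [∀ i, CompactSpace (N i)]

open Classical in
/-- The points of the fibers that correspond to a dense sequence of each model; over the base points
whose fiber is empty the value is a fixed point. -/
noncomputable def denseSection (τ : ∀ x, E x ≃ₜ N (idx x)) (p₀ : FiberTotal E) (l : ℕ) (x : X) :
    FiberTotal E :=
  if _h : Nonempty (N (idx x)) then ⟨x, (τ x).symm (TopologicalSpace.denseSeq (N (idx x)) l)⟩ else p₀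

theorem denseSection_of_nonempty (τ : ∀ x, E x ≃ₜ N (idx x)) (p₀ : FiberTotal E) (l : ℕ) (x : X)
    [h : Nonempty (N (idx x))] : denseSection τ p₀ l x =
      ⟨x, (τ x).symm (TopologicalSpace.denseSeq (N (idx x)) l)⟩ :=
  dif_pos h

theorem measurable_denseSection {𝓑 : MeasurableSpace X} (τ : ∀ x, E x ≃ₜ N (idx x))
    (hidx : Measurable[𝓑] idx) (p₀ : FiberTotal E) (l : ℕ) :
    Measurable[𝓑, totalSigma 𝓑 fun x ↦ τ x] (denseSection τ p₀ l) := by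
  classical
  refine measurable_comap_iff.2 ?_
  let : MeasurableSpace (Σ i, N i) := borel _
  set g : ℕ → Σ i, N i := fun i => if h : Nonempty (N i) then
    ⟨i, TopologicalSpace.denseSeq (N i) l⟩ else (coord (fun x ↦ τ x) p₀).2 with hg
  have h1 : coord (fun x ↦ τ x) ∘ denseSection τ p₀ l =
      fun x => (if Nonempty (N (idx x)) then x else p₀.base, g (idx x)) := by
    funext x
    by_cases h : Nonempty (N (idx x))
    · rw [Function.comp_apply, denseSection_of_nonempty]
      simp [h, hg, coord]
    · have : denseSection τ p₀ l x = p₀ := dif_neg h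
      rw [Function.comp_apply, this]
      simp [h, hg, coord]
  rw [h1]
  refine Measurable.prodMk ?_ ((measurable_from_nat (f := g)).comp hidx)
  exact Measurable.ite (hidx (MeasurableSet.of_discrete (s := {i | Nonempty (N i)})))
    measurable_id measurable_const

theorem exists_denseSection_dist_lt (τ : ∀ x, E x ≃ₜ N (idx x)) {f : X → X}
    {F : ∀ x, E x → E (f x)} (hF : ∀ x, Continuous (F x)) (p₀ : FiberTotal E) (x : X) (ξ : E x)
    (n : ℕ) {ε : ℝ} (hε : 0 < ε) : ∃ l, ∃ η : E x, denseSection τ p₀ l x = ⟨x, η⟩ ∧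
      dist (τ x ξ) (τ x η) < ε ∧
      dist (τ _ (fiberIter f F n x ξ)) (τ _ (fiberIter f F n x η)) < ε := by
  have : Nonempty (N (idx x)) := ⟨τ x ξ⟩
  have hc : Continuous fun y : N (idx x) => τ _ (fiberIter f F n x ((τ x).symm y)) :=
    (τ _).continuous.comp ((continuous_fiberIter hF n x).comp (τ x).symm.continuous)
  have hopen : IsOpen {y : N (idx x) | dist (τ x ξ) y < ε ∧
      dist (τ _ (fiberIter f F n x ξ)) (τ _ (fiberIter f F n x ((τ x).symm y))) < ε} :=
    (isOpen_lt (continuous_const.dist continuous_id) continuous_const).inter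
      (isOpen_lt (continuous_const.dist hc) continuous_const)
  obtain ⟨l, hl⟩ := (TopologicalSpace.denseRange_denseSeq (N (idx x))).exists_mem_open hopen
    ⟨τ x ξ, by simpa using hε⟩
  exact ⟨l, _, denseSection_of_nonempty τ p₀ l x, by simpa using hl.1, hl.2⟩

variable {𝓑 : MeasurableSpace X} [𝓐 : MeasurableSpace X] {m : Measure X}

/-- If the σ-algebras `f ^ k 𝓑` generate modulo null sets, then the sets that depend on the
base point are generated modulo null sets by those which are known at time `0` after finitely many
iterations. -/
theorem exists_generateFrom_iterate_preimage_ae_eq {Ω : Type*} {mΩ : MeasurableSpace Ω}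
    {M : Measure Ω} {pr : Ω → X} {T : Ω → Ω} (hpr : MeasurePreserving pr M m) (h𝓑 : 𝓑 ≤ 𝓐)
    (f : X ≃ᵐ X) (hf𝓑 : Measurable[nullCompletion 𝓑 m, nullCompletion 𝓑 m] f)
    (hprT : ∀ p, pr (T p) = f (pr p))
    (hgen : FinerMod0 (⨆ k : ℤ, 𝓑.comap ((f.toEquiv ^ k : Equiv.Perm X) : X → X)) 𝓐 m)
    {A : Set X} (hA : MeasurableSet[𝓐] A) :
    ∃ A', MeasurableSet[MeasurableSpace.generateFrom
      {D | MeasurableSet[mΩ] D ∧ ∃ n, MeasurableSet[(nullCompletion 𝓑 m).comap pr] (T^[n] ⁻¹' D)}]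
        A' ∧ (pr ⁻¹' A : Set Ω) =ᵐ[M] A' := by
  obtain ⟨B, hB, hBA⟩ := hgen A hA
  refine ⟨pr ⁻¹' B, ?_, hpr.quasiMeasurePreserving.preimage_ae_eq
    (measure_symmDiff_eq_zero_iff.1 hBA).symm⟩
  have hle : (⨆ k : ℤ, 𝓑.comap ((f.toEquiv ^ k : Equiv.Perm X) : X → X)).comap pr ≤
      MeasurableSpace.generateFrom {D | MeasurableSet[mΩ] D ∧
        ∃ n, MeasurableSet[(nullCompletion 𝓑 m).comap pr] (T^[n] ⁻¹' D)} := by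
    rw [MeasurableSpace.comap_iSup]
    refine iSup_le fun k => ?_
    rintro _ ⟨_, ⟨B, hB, rfl⟩, rfl⟩
    have hfn : ∀ n : ℕ, ((f.toEquiv ^ n : Equiv.Perm X) : X → X) = f^[n] := fun n =>
      (Equiv.Perm.iterate_eq_pow f.toEquiv n).symm
    have hprTn : ∀ n p, pr (T^[n] p) = f^[n] (pr p) := by
      intro n p
      exact (Function.Semiconj.iterate_right (f := pr) (ga := T) (gb := f) hprT n) p
    refine MeasurableSpace.measurableSet_generateFrom ?_
    obtain ⟨n, rfl | rfl⟩ := k.eq_nat_or_neg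
    · rw [zpow_natCast, hfn]
      have h1 : MeasurableSet[nullCompletion 𝓑 m] (f^[n] ⁻¹' B) :=
        (@Measurable.iterate X (nullCompletion 𝓑 m) f hf𝓑 n) (le_nullCompletion h𝓑 _ hB)
      exact ⟨hpr.measurable h1.1, 0, _, h1, rfl⟩
    · have hinv : ((f.toEquiv ^ (-(n : ℤ)) : Equiv.Perm X) : X → X) = f.symm^[n] := by
        rw [zpow_neg, zpow_natCast, ← inv_pow]
        exact (Equiv.Perm.iterate_eq_pow f.toEquiv⁻¹ n).symm
      rw [hinv]
      refine ⟨hpr.measurable ((f.symm.measurable.iterate n) (h𝓑 _ hB)), n, B,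
        le_nullCompletion h𝓑 _ hB, ?_⟩
      ext p
      simp only [Set.mem_preimage]
      rw [hprTn]
      have : f.symm^[n] (f^[n] (pr p)) = pr p :=
        (Function.LeftInverse.iterate (f.symm_apply_apply) n) (pr p)
      rw [this]
  exact hle _ ⟨B, hB, rfl⟩

variable [∀ x, MeasurableSpace (E x)] [∀ x, BorelSpace (E x)]

/-- The invariance principle, when the contraction along the fibers is expressed in terms of
distances: fiberwise iterates contract at a subexponential rate only, and the fibers have finite
dimension. -/
theorem exists_measurableFamily_of_subexponential_contraction
    [IsProbabilityMeasure m] (f : X ≃ᵐ X) (hf : MeasurePreserving f m m)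
    (τ : ∀ x, E x ≃ₜ N (idx x)) (F : ∀ x, E x → E (f x)) (hF : ∀ x, Continuous (F x))
    (M : @Measure (FiberTotal E) (totalSigma 𝓐 fun x ↦ τ x))
    (hM : @MeasurePreserving _ _ (totalSigma 𝓐 fun x ↦ τ x) (totalSigma 𝓐 fun x ↦ τ x)
      (bundleMap f F) M M)
    (hMm : ∀ A : Set X, MeasurableSet A → M {p | p.base ∈ A} = m A)
    (Mx : ∀ x, Measure (E x)) (hMx : IsDisintegration m M Mx)
    (h𝓑 : 𝓑 ≤ 𝓐) (hnoninc : FinerMod0 𝓑 (𝓑.comap f) m)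
    (hgen : FinerMod0 (⨆ k : ℤ, 𝓑.comap ((f.toEquiv ^ k : Equiv.Perm X) : X → X)) 𝓐 m)
    (hidx : Measurable[𝓑] idx)
    (hF𝓑 : Measurable[totalSigma 𝓑 fun x ↦ τ x, borel (Σ i, N i)]
      fun p : FiberTotal E ↦ (coord (fun x ↦ τ x) (bundleMap f F p)).2)
    {Λ : ℝ} (hΛ : 1 ≤ Λ)
    (hlip : ∀ x ξ η, dist (τ x ξ) (τ x η) ≤ Λ * dist (τ (f x) (F x ξ)) (τ (f x) (F x η)))
    {δ : ℕ → ℝ} (hδ : ∀ n, 0 < δ n)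
    (hexp : ∀ θ > 0, ∀ᵐ p ∂M, ∀ᶠ n : ℕ in atTop, ∀ η : E p.base,
      dist (τ _ (fiberIter f F n p.base p.point)) (τ _ (fiberIter f F n p.base η)) < δ n →
      dist (τ _ p.point) (τ _ η) ≤ Real.exp (θ * n) *
        dist (τ _ (fiberIter f F n p.base p.point)) (τ _ (fiberIter f F n p.base η)))
    (hnet : ∀ i ∈ Set.range idx, ∃ C Q : ℝ, ∀ k : ℕ, ∃ S : Finset (N i), (S.card : ℝ) ≤ C * Q ^ k ∧
      ∀ y, ∃ s ∈ S, dist y s < (1 / 2) ^ k) :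
    ∃ κ : ∀ x, Measure (E x),
      MeasurableFamily 𝓑 (totalSigma 𝓑 fun x ↦ τ x) κ ∧ ∀ᵐ x ∂m, Mx x = κ x := by
  refine exists_measurableFamily_of_setIntegral_condExp h𝓑 τ hidx M hMm Mx hMx
    fun C hC A hA => ?_
  let : MeasurableSpace (Σ i, N i) := borel _
  let mY : MetricSpace (Σ i, N i) := Metric.Sigma.metricSpace
  have : BorelSpace (Σ i, N i) := ⟨rfl⟩
  let mE : MeasurableSpace (FiberTotal E) := totalSigma 𝓐 fun x ↦ τ x
  set T := bundleMap f F with hT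
  set Y0 : FiberTotal E → Σ i, N i := fun p => (coord (fun x ↦ τ x) p).2 with hY0
  have hcoord : Measurable (coord (E := E) (fun x ↦ τ x)) := comap_measurable _
  have hbase : Measurable (FiberTotal.base : FiberTotal E → X) := measurable_fst.comp hcoord
  have hM1 : IsProbabilityMeasure M := ⟨by simpa using hMm Set.univ MeasurableSet.univ⟩
  have hpr : MeasurePreserving (FiberTotal.base : FiberTotal E → X) M m :=
    ⟨hbase, Measure.ext fun A hA => by rw [Measure.map_apply hbase hA]; exact hMm A hA⟩
  obtain ⟨p₀⟩ : Nonempty (FiberTotal E) := M.nonempty_of_neZero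
  have hf' : Measurable[nullCompletion 𝓑 m, nullCompletion 𝓑 m] f :=
    measurable_nullCompletion_of_finerMod0 hf hnoninc
  have hle : 𝓑 ≤ nullCompletion 𝓑 m := le_nullCompletion h𝓑
  have hprT : ∀ p, (bundleMap f F p).base = f p.base := fun p => rfl
  have hA' := exists_generateFrom_iterate_preimage_ae_eq hpr h𝓑 f hf' hprT hgen hA
  have hlarge : ∀ η : ℝ, 0 < η → ∃ I, m.real {x | I < idx x} ≤ η := fun η hη =>
    exists_measureReal_lt_le m (hidx.mono h𝓑 le_rfl) hη
  have hbig : ∀ I, M.real (FiberTotal.base ⁻¹' {x | I < idx x}) = m.real {x | I < idx x} :=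
    fun I => hpr.measureReal_preimage
      ((hidx.mono h𝓑 le_rfl) measurableSet_Ioi).nullMeasurableSet
  -- Over the completion, `f⁻¹ 𝓑` lies in `𝓑` exactly and not only modulo null sets.
  set 𝓑' := nullCompletion 𝓑 m with h𝓑'
  have hle' : 𝓑' ≤ 𝓐 := inf_le_left
  set 𝓣 : MeasurableSpace (FiberTotal E) := totalSigma 𝓑' fun x ↦ τ x with h𝓣
  have hmono : ∀ {𝓒 𝓒' : MeasurableSpace X}, 𝓒 ≤ 𝓒' →
      totalSigma 𝓒 (fun x ↦ τ x) ≤ totalSigma (E := E) 𝓒' fun x ↦ τ x := fun h =>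
    MeasurableSpace.comap_mono (sup_le_sup_right (MeasurableSpace.comap_mono h) _)
  have h𝓣m : 𝓣 ≤ mE := hmono hle'
  have hcoord𝓣 : @Measurable _ _ 𝓣 (𝓑'.prod (borel (Σ i, N i))) (coord (fun x ↦ τ x)) :=
    comap_measurable _
  have hY0𝓣 : Measurable[𝓣] Y0 := (@measurable_snd X (Σ i, N i) 𝓑' _).comp hcoord𝓣
  have hpr𝓣 : Measurable[𝓣, 𝓑'] (FiberTotal.base : FiberTotal E → X) :=
    (@measurable_fst X (Σ i, N i) 𝓑' _).comp hcoord𝓣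
  have hpr' : Measurable[mE, 𝓑'] (FiberTotal.base : FiberTotal E → X) :=
    hpr𝓣.mono h𝓣m le_rfl
  have hT𝓣 : Measurable[𝓣, 𝓣] T := by
    refine measurable_comap_iff.2 ?_
    exact @Measurable.prodMk _ 𝓣 _ _ 𝓑' _ _ _ (hf'.comp hpr𝓣) (hF𝓑.mono (hmono hle) le_rfl)
  have hYn : ∀ n p, Y0 (T^[n] p) =
      ⟨idx (f^[n] p.base), τ _ (fiberIter f F n p.base p.point)⟩ := by
    intro n p
    rw [hT, bundleMap_iterate]
    rfl
  have hfine := fun (ψ : (Σ i, N i) → ℝ) (A : ℝ) (hA : 0 < A)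
      (hψ : ∀ y y', |ψ y - ψ y'| ≤ A * dist y y') (hψ1 : ∀ y, |ψ y| ≤ 1) (ε : ℝ) (hε : 0 < ε) =>
    exists_fine_discretization (𝓑 := 𝓑') (𝓣 := 𝓣) (mΩ := mE) (M := M) (T := T)
      (pr := FiberTotal.base) (Y0 := Y0) hM h𝓣m hT𝓣 hY0𝓣 hpr'
      (s := denseSection τ p₀)
      (fun l => measurable_denseSection τ (hidx.mono hle le_rfl) p₀ l)
      (by
        rintro l ⟨x, ξ⟩
        have : Nonempty (N (idx x)) := ⟨τ x ξ⟩
        simp [denseSection_of_nonempty])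
      (by
        rintro ⟨x, ξ⟩ n ε hε
        obtain ⟨l, η, h1, h2, h3⟩ := exists_denseSection_dist_lt τ hF p₀ x ξ n hε
        refine ⟨l, ?_⟩
        simp only [h1, hYn]
        exact ⟨by simpa [hY0, coord, Metric.Sigma.dist_same] using h2,
          by simpa [Metric.Sigma.dist_same] using h3⟩)
      hΛ
      (fun p p' h => by rw [hprT, hprT, h])
      (by
        rintro ⟨x, ξ⟩ ⟨x', η⟩ h
        obtain rfl : x = x' := h
        simpa [hY0, coord, hT, bundleMap, Metric.Sigma.dist_same] using hlip x ξ η)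
      hδ
      (by
        intro θ hθ
        filter_upwards [hexp θ hθ] with p hp
        filter_upwards [hp] with n hn
        obtain ⟨x, ξ⟩ := p
        rintro ⟨x', η⟩ h
        obtain rfl : x' = x := h
        rw [hYn, hYn]
        simpa [hY0, coord, Metric.Sigma.dist_same] using hn η)
      (by
        intro η hη
        obtain ⟨I, hI⟩ := hlarge η hη
        obtain ⟨C, Q, hC, hQ, hCQ⟩ := exists_nets_of_forall_model hnet I
        have hfst : Measurable fun y : Σ i, N i => y.1 :=
          (continuous_sigma_iff.2 fun i => continuous_const).measurable
        refine ⟨{y | y.1 ≤ I} ∩ {y | y.1 ∈ Set.range idx},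
          (hfst measurableSet_Iic).inter (hfst MeasurableSet.of_discrete), ?_, C, Q, hC, hQ, fun k => ?_⟩
        · refine le_trans (le_of_eq ?_) hI
          rw [← hbig I]
          congr 1
          ext p
          simp [hY0, coord]
        · obtain ⟨S, hS, hSn⟩ := hCQ k
          refine ⟨S, hS, ?_⟩
          rintro ⟨i, y⟩ ⟨hy, hyJ⟩
          obtain ⟨s, hs, hd⟩ := hSn i hy hyJ y
          exact ⟨⟨i, s⟩, hs, by simpa [Metric.Sigma.dist_same] using hd⟩)
      hA hψ hψ1 hε
  have hsame : ∀ U, MeasurableSet[𝓣] U → SameInformation M T (𝓑'.comap FiberTotal.base) U :=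
    fun U hU => sameInformation_of_forall_lipschitz (Y0 := Y0) hM hpr' (hY0𝓣.mono h𝓣m le_rfl) hf'
      hprT hfine hU
  refine measureReal_inter_eq_setIntegral_condExp hM hpr'.comap_le h𝓣m ?_ hT𝓣 hsame (hY0𝓣 hC)
    hA'
  have hcomp : FiberTotal.base ∘ T = f ∘ FiberTotal.base := rfl
  rw [MeasurableSpace.comap_comp, hcomp, ← MeasurableSpace.comap_comp]
  exact MeasurableSpace.comap_mono hf'.comap_le

end Bundle

/-! ### Riemannian distances and bounded charts -/

section Distance

open Manifold

variable {k l : ℕ}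
  {M : Type*} [TopologicalSpace M] [ChartedSpace (EuclideanSpace ℝ (Fin k)) M]
  [RiemannianBundle (fun ξ : M ↦ TangentSpace (𝓡 k) ξ)]
  {M' : Type*} [TopologicalSpace M'] [ChartedSpace (EuclideanSpace ℝ (Fin l)) M']
  [RiemannianBundle (fun ξ : M' ↦ TangentSpace (𝓡 l) ξ)]

/-- The Riemannian norm at the point `x` of a vector given by its coordinates in the model space,
with which each tangent space is identified. -/
noncomputable def tangentNorm (x : M) (v : EuclideanSpace ℝ (Fin k)) : ℝ :=
  norm (E := TangentSpace (𝓡 k) x) v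

theorem tangentNorm_add_le (x : M) (v w : EuclideanSpace ℝ (Fin k)) :
    tangentNorm x (v + w) ≤ tangentNorm x v + tangentNorm x w :=
  norm_add_le (E := TangentSpace (𝓡 k) x) v w

theorem tangentNorm_nonneg (x : M) (v : EuclideanSpace ℝ (Fin k)) : 0 ≤ tangentNorm x v :=
  norm_nonneg (E := TangentSpace (𝓡 k) x) v

theorem metricCoeff_self (σ : EuclideanSpace ℝ (Fin k) → M) (u v : EuclideanSpace ℝ (Fin k)) :
    metricCoeff σ u v v = tangentNorm (σ u) (mfderiv (𝓡 k) (𝓡 k) σ u v) ^ 2 :=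
  real_inner_self_eq_norm_sq _

theorem riemannianEDist_comp_le {G : M → M'} (hG : ContMDiff (𝓡 k) (𝓡 l) 1 G) {C : ℝ} (hC : 0 ≤ C)
    (h : ∀ x (v : TangentSpace (𝓡 k) x), ‖mfderiv (𝓡 k) (𝓡 l) G x v‖ ≤ C * ‖v‖) {x y : M} {a : ℝ≥0∞}
    (ha : riemannianEDist (𝓡 k) x y < a) :
    riemannianEDist (𝓡 l) (G x) (G y) ≤ ENNReal.ofReal C * a := by
  obtain ⟨γ, h0, h1, hγ, hlen⟩ := exists_lt_of_riemannianEDist_lt ha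
  have hGγ : ContMDiffOn 𝓘(ℝ, ℝ) (𝓡 l) 1 (G ∘ γ) (Set.Icc 0 1) := hG.comp_contMDiffOn hγ
  refine (riemannianEDist_le_pathELength hGγ (by simp [h0]) (by simp [h1]) zero_le_one).trans ?_
  refine le_trans ?_ (mul_le_mul_right hlen.le _)
  rw [pathELength_eq_lintegral_mfderivWithin_Icc, pathELength_eq_lintegral_mfderivWithin_Icc,
    ← lintegral_const_mul' _ _ ENNReal.ofReal_ne_top]
  refine setLIntegral_mono' measurableSet_Icc fun t ht => ?_
  have hc : mfderivWithin 𝓘(ℝ, ℝ) (𝓡 l) (G ∘ γ) (Set.Icc 0 1) t =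
      (mfderiv (𝓡 k) (𝓡 l) G (γ t)) ∘L (mfderivWithin 𝓘(ℝ, ℝ) (𝓡 k) γ (Set.Icc 0 1) t) := by
    apply mfderiv_comp_mfderivWithin
    · exact hG.mdifferentiable one_ne_zero _
    · exact hγ.mdifferentiableOn one_ne_zero _ ht
    · rw [uniqueMDiffWithinAt_iff_uniqueDiffWithinAt]
      exact uniqueDiffOn_Icc zero_lt_one _ ht
  have hc1 : mfderivWithin 𝓘(ℝ, ℝ) (𝓡 l) (G ∘ γ) (Set.Icc 0 1) t 1 =
      (mfderiv (𝓡 k) (𝓡 l) G (γ t)) (mfderivWithin 𝓘(ℝ, ℝ) (𝓡 k) γ (Set.Icc 0 1) t 1) :=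
    congr($hc 1)
  rw [hc1, ← ofReal_norm, ← ofReal_norm, ← ENNReal.ofReal_mul hC]
  exact ENNReal.ofReal_le_ofReal (h _ _)

theorem toReal_riemannianEDist_comp_le {G : M → M'} (hG : ContMDiff (𝓡 k) (𝓡 l) 1 G) {C : ℝ}
    (hC : 0 ≤ C) (h : ∀ x (v : TangentSpace (𝓡 k) x), ‖mfderiv (𝓡 k) (𝓡 l) G x v‖ ≤ C * ‖v‖)
    {x y : M} (hfin : riemannianEDist (𝓡 k) x y ≠ ⊤) :
    (riemannianEDist (𝓡 l) (G x) (G y)).toReal ≤ C * (riemannianEDist (𝓡 k) x y).toReal := by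
  refine le_of_forall_pos_le_add fun ε hε => ?_
  set d := (riemannianEDist (𝓡 k) x y).toReal with hd
  have hd0 : 0 ≤ d := ENNReal.toReal_nonneg
  have hlt : riemannianEDist (𝓡 k) x y < ENNReal.ofReal (d + ε / (C + 1)) := by
    rw [ENNReal.lt_ofReal_iff_toReal_lt hfin]
    have : 0 < ε / (C + 1) := by positivity
    linarith
  have h1 := riemannianEDist_comp_le hG hC h hlt
  rw [← ENNReal.ofReal_mul hC] at h1
  refine (ENNReal.toReal_le_of_le_ofReal (by positivity) h1).trans ?_
  have : C * (ε / (C + 1)) ≤ ε := by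
    rw [mul_div_assoc', div_le_iff₀ (by positivity)]
    nlinarith
  linarith

end Distance

section Charts

open Manifold

variable {k : ℕ}
  {M : Type*} [TopologicalSpace M] [ChartedSpace (EuclideanSpace ℝ (Fin k)) M]
  [RiemannianBundle (fun ξ : M ↦ TangentSpace (𝓡 k) ξ)]

/-- A smooth chart onto the ball `B(0, r)` in which the metric is `K`-bounded in class `C²`. -/
structure IsBoundedChart (φ : OpenPartialHomeomorph M (EuclideanSpace ℝ (Fin k))) (r K : ℝ) :
    Prop where
  mem_maximalAtlas : φ ∈ IsManifold.maximalAtlas (𝓡 k) ∞ M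
  target_eq : φ.target = Metric.ball 0 r
  bounded : MetricC2Bounded φ.symm r K

variable {φ : OpenPartialHomeomorph M (EuclideanSpace ℝ (Fin k))} {r K : ℝ}

theorem IsBoundedChart.norm_mfderiv_symm_le (h : IsBoundedChart φ r K) (hK : 0 ≤ K)
    {u : EuclideanSpace ℝ (Fin k)} (hu : u ∈ Metric.ball 0 r) (v : EuclideanSpace ℝ (Fin k)) :
    tangentNorm (φ.symm u) (mfderiv (𝓡 k) (𝓡 k) φ.symm u v) ≤ √K * ‖v‖ := by
  have h1 := (h.bounded u hu v v).2 0 (by norm_num)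
  rw [norm_iteratedFDeriv_zero, Real.norm_eq_abs] at h1
  have h2 := (le_abs_self _).trans h1
  rw [metricCoeff_self] at h2
  refine abs_le_of_sq_le_sq' ?_ (by positivity) |>.2
  rw [mul_pow, Real.sq_sqrt hK]
  linarith

theorem IsBoundedChart.norm_le_mfderiv_symm (h : IsBoundedChart φ r K) (hK : 0 < K)
    {u : EuclideanSpace ℝ (Fin k)} (hu : u ∈ Metric.ball 0 r) (v : EuclideanSpace ℝ (Fin k)) :
    ‖v‖ ≤ √K * tangentNorm (φ.symm u) (mfderiv (𝓡 k) (𝓡 k) φ.symm u v) := by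
  have h1 := (h.bounded u hu v v).1
  rw [metricCoeff_self] at h1
  refine abs_le_of_sq_le_sq' ?_ (mul_nonneg (by positivity) (tangentNorm_nonneg _ _)) |>.2
  rw [mul_pow, Real.sq_sqrt hK.le]
  rw [inv_mul_le_iff₀ hK] at h1
  exact h1

theorem IsBoundedChart.contMDiffOn (h : IsBoundedChart φ r K) :
    ContMDiffOn (𝓡 k) (𝓡 k) ∞ φ φ.source :=
  contMDiffOn_of_mem_maximalAtlas h.mem_maximalAtlas

theorem IsBoundedChart.contMDiffOn_symm (h : IsBoundedChart φ r K) :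
    ContMDiffOn (𝓡 k) (𝓡 k) ∞ φ.symm (Metric.ball 0 r) := by
  have := contMDiffOn_symm_of_mem_maximalAtlas h.mem_maximalAtlas
  rwa [h.target_eq] at this

theorem IsBoundedChart.mem_ball (h : IsBoundedChart φ r K) {x : M} (hx : x ∈ φ.source) :
    φ x ∈ Metric.ball (0 : EuclideanSpace ℝ (Fin k)) r := by
  rw [← h.target_eq]
  exact φ.map_source hx

theorem IsBoundedChart.mdifferentiableAt_symm (h : IsBoundedChart φ r K)
    {u : EuclideanSpace ℝ (Fin k)} (hu : u ∈ Metric.ball 0 r) :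
    MDifferentiableAt (𝓡 k) (𝓡 k) φ.symm u :=
  ((h.contMDiffOn_symm u hu).contMDiffAt (Metric.isOpen_ball.mem_nhds hu)).mdifferentiableAt
    (by simp)

theorem IsBoundedChart.mdifferentiableAt (h : IsBoundedChart φ r K) {x : M} (hx : x ∈ φ.source) :
    MDifferentiableAt (𝓡 k) (𝓡 k) φ x :=
  ((h.contMDiffOn x hx).contMDiffAt (φ.open_source.mem_nhds hx)).mdifferentiableAt (by simp)

/-- The parametrization is Lipschitz. -/
theorem IsBoundedChart.riemannianEDist_symm_le (h : IsBoundedChart φ r K) (hK : 0 ≤ K)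
    {u v : EuclideanSpace ℝ (Fin k)} (hu : u ∈ Metric.ball 0 r) (hv : v ∈ Metric.ball 0 r) :
    riemannianEDist (𝓡 k) (φ.symm u) (φ.symm v) ≤ ENNReal.ofReal (√K * ‖u - v‖) := by
  let η := ContinuousAffineMap.lineMap (R := ℝ) u v
  have hη : ∀ t ∈ Set.Icc (0 : ℝ) 1, η t ∈ Metric.ball (0 : EuclideanSpace ℝ (Fin k)) r := by
    intro t ht
    refine (convex_ball _ _).segment_subset hu hv ?_
    rw [segment_eq_image_lineMap]
    exact ⟨t, ht, rfl⟩
  have hηs : ContMDiff 𝓘(ℝ, ℝ) (𝓡 k) 1 η := by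
    rw [contMDiff_iff_contDiff]
    exact ContinuousAffineMap.contDiff _
  have hγ : ContMDiffOn 𝓘(ℝ, ℝ) (𝓡 k) 1 (φ.symm ∘ η) (Set.Icc 0 1) :=
    (h.contMDiffOn_symm.of_le (by norm_cast)).comp hηs.contMDiffOn hη
  refine (riemannianEDist_le_pathELength hγ (by simp [η, ContinuousAffineMap.coe_lineMap_eq])
    (by simp [η, ContinuousAffineMap.coe_lineMap_eq]) zero_le_one).trans ?_
  rw [pathELength_eq_lintegral_mfderivWithin_Icc]
  refine (setLIntegral_mono' (g := fun _ => ENNReal.ofReal (√K * ‖u - v‖)) measurableSet_Icc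
    fun t ht => ?_).trans (by simp)
  have hu' : UniqueMDiffWithinAt 𝓘(ℝ, ℝ) (Set.Icc (0 : ℝ) 1) t := by
    rw [uniqueMDiffWithinAt_iff_uniqueDiffWithinAt]
    exact uniqueDiffOn_Icc zero_lt_one _ ht
  have hc : mfderivWithin 𝓘(ℝ, ℝ) (𝓡 k) (φ.symm ∘ η) (Set.Icc 0 1) t =
      (mfderiv (𝓡 k) (𝓡 k) φ.symm (η t)) ∘L (mfderivWithin 𝓘(ℝ, ℝ) (𝓡 k) η (Set.Icc 0 1) t) := by
    apply mfderiv_comp_mfderivWithin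
    · exact h.mdifferentiableAt_symm (hη t ht)
    · exact (hηs.mdifferentiable one_ne_zero).mdifferentiableOn _ ht
    · exact hu'
  have hd : mfderivWithin 𝓘(ℝ, ℝ) (𝓡 k) η (Set.Icc 0 1) t (1 : ℝ) = v - u := by
    rw [mfderivWithin_eq_fderivWithin, fderivWithin_eq_fderiv (uniqueDiffOn_Icc zero_lt_one _ ht)
      (ContinuousAffineMap.differentiableAt _)]
    exact (by simp : fderiv ℝ (ContinuousAffineMap.lineMap (R := ℝ) u v) t 1 = v - u)
  have hc1 : mfderivWithin 𝓘(ℝ, ℝ) (𝓡 k) (φ.symm ∘ η) (Set.Icc 0 1) t (1 : ℝ) =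
      (mfderiv (𝓡 k) (𝓡 k) φ.symm (η t)) (v - u) := by
    rw [hc, ← hd]
    rfl
  have := h.norm_mfderiv_symm_le hK (hη t ht) (v - u)
  rw [norm_sub_rev] at this
  rw [← ofReal_norm]
  refine ENNReal.ofReal_le_ofReal ((le_of_eq ?_).trans this)
  exact congrArg (tangentNorm (φ.symm (η t))) hc1

theorem IsBoundedChart.norm_mfderiv_le (h : IsBoundedChart φ r K) (hK : 0 < K) {x : M}
    (hx : x ∈ φ.source) (w : EuclideanSpace ℝ (Fin k)) :
    norm (E := EuclideanSpace ℝ (Fin k)) (mfderiv (𝓡 k) (𝓡 k) φ x w) ≤ √K * tangentNorm x w := by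
  have h1 := h.norm_le_mfderiv_symm hK (h.mem_ball hx) (mfderiv (𝓡 k) (𝓡 k) φ x w)
  have hd : φ.MDifferentiable (𝓡 k) (𝓡 k) :=
    ⟨fun y hy => (h.mdifferentiableAt hy).mdifferentiableWithinAt, fun u hu => by
      rw [h.target_eq] at hu
      exact (h.mdifferentiableAt_symm hu).mdifferentiableWithinAt⟩
  have h2 : mfderiv (𝓡 k) (𝓡 k) φ.symm (φ x) (mfderiv (𝓡 k) (𝓡 k) φ x w) = w :=
    congr($(hd.symm_comp_deriv hx) w)
  rw [h2, φ.left_inv hx] at h1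
  exact h1

/-- A short path that starts at the center of a chart stays in the chart. -/
theorem IsBoundedChart.mem_source_of_riemannianEDist_lt [T2Space M] (h : IsBoundedChart φ r K)
    (hK : 0 < K) {x y : M} (hx : x ∈ φ.source) (hx0 : φ x = 0) {a : ℝ} (ha : √K * a < r)
    (hxy : riemannianEDist (𝓡 k) x y < ENNReal.ofReal a) :
    y ∈ φ.source ∧ ‖φ y‖ ≤ √K * a := by
  have ha0 : 0 < a := by
    by_contra! h0
    simp [ENNReal.ofReal_of_nonpos h0] at hxy
  have hK' : 0 < √K := Real.sqrt_pos.2 hK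
  set R := √K * a with hR
  have hR0 : 0 < R := by positivity
  set U : Set M := φ.symm '' Metric.closedBall 0 R with hU
  set V : Set M := φ.symm '' Metric.ball 0 R with hV
  have hsub : Metric.closedBall (0 : EuclideanSpace ℝ (Fin k)) R ⊆ φ.target := by
    rw [h.target_eq]
    exact Metric.closedBall_subset_ball ha
  have hUc : IsClosed U :=
    ((isCompact_closedBall _ _).image_of_continuousOn (φ.continuousOn_symm.mono hsub)).isClosed
  have hVo : IsOpen V := φ.symm.isOpen_image_of_subset_source Metric.isOpen_ball
    (Metric.ball_subset_closedBall.trans hsub)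
  have hVU : V ⊆ U := Set.image_mono Metric.ball_subset_closedBall
  have hUs : U ⊆ φ.source := by
    rintro _ ⟨u, hu, rfl⟩
    exact φ.map_target (hsub hu)
  have hmemU : ∀ z ∈ U, ‖φ z‖ ≤ R := by
    rintro _ ⟨u, hu, rfl⟩
    rw [φ.right_inv (hsub hu)]
    simpa using hu
  obtain ⟨γ, h0, h1, hγ, hlen, -⟩ := exists_lt_locally_constant_of_riemannianEDist_lt hxy
    zero_lt_one
  have hxU : x ∈ U := ⟨0, by simp [hR0.le], by rw [← hx0, φ.left_inv hx]⟩
  suffices hI : Set.Icc (0 : ℝ) 1 ⊆ γ ⁻¹' U by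
    have h2 : y ∈ U := by
      rw [← h1]
      exact hI ⟨zero_le_one, le_rfl⟩
    exact ⟨hUs h2, hmemU y h2⟩
  have hclosed : IsClosed (γ ⁻¹' U ∩ Set.Icc 0 1) :=
    (hUc.preimage hγ.continuous).inter isClosed_Icc
  apply hclosed.Icc_subset_of_forall_mem_nhdsGT_of_Icc_subset (by simpa [h0] using hxU)
  rintro t₁ ⟨ht0, ht1⟩ ht
  suffices hV1 : γ t₁ ∈ V from
    hγ.continuous.continuousWithinAt (mem_of_superset (hVo.mem_nhds hV1) hVU)
  have hsrc : ∀ t ∈ Set.Icc 0 t₁, γ t ∈ φ.source := fun t h => hUs (ht h)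
  set γ' : ℝ → EuclideanSpace ℝ (Fin k) := φ ∘ γ with hγ'
  have hC : ContMDiffOn 𝓘(ℝ, ℝ) (𝓡 k) 1 γ' (Set.Icc 0 t₁) :=
    (h.contMDiffOn.of_le (by norm_cast)).comp hγ.contMDiffOn hsrc
  have hlt : ‖γ' t₁ - γ' 0‖ₑ < ENNReal.ofReal R := by
    rcases ht0.eq_or_lt with rfl | htpos
    · simp [hR0]
    calc ‖γ' t₁ - γ' 0‖ₑ ≤ ∫⁻ t in Set.Icc 0 t₁, ‖derivWithin γ' (Set.Icc 0 t₁) t‖ₑ := by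
          apply enorm_sub_le_lintegral_derivWithin_Icc_of_contDiffOn_Icc _ ht0
          rwa [← contMDiffOn_iff_contDiffOn]
      _ ≤ ∫⁻ t in Set.Icc 0 t₁, ENNReal.ofReal (√K) *
            ‖mfderivWithin 𝓘(ℝ, ℝ) (𝓡 k) γ (Set.Icc 0 t₁) t 1‖ₑ := by
          refine setLIntegral_mono' measurableSet_Icc fun t ht' => ?_
          have hc : mfderivWithin 𝓘(ℝ, ℝ) (𝓡 k) γ' (Set.Icc 0 t₁) t =
              (mfderiv (𝓡 k) (𝓡 k) φ (γ t)) ∘L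
                (mfderivWithin 𝓘(ℝ, ℝ) (𝓡 k) γ (Set.Icc 0 t₁) t) := by
            apply mfderiv_comp_mfderivWithin
            · exact h.mdifferentiableAt (hsrc t ht')
            · exact (hγ.mdifferentiable one_ne_zero).mdifferentiableOn _ ht'
            · rw [uniqueMDiffWithinAt_iff_uniqueDiffWithinAt]
              exact uniqueDiffOn_Icc htpos _ ht'
          have hd : derivWithin γ' (Set.Icc 0 t₁) t =
              mfderiv (𝓡 k) (𝓡 k) φ (γ t)
                (mfderivWithin 𝓘(ℝ, ℝ) (𝓡 k) γ (Set.Icc 0 t₁) t (1 : ℝ)) := by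
            rw [← fderivWithin_derivWithin, ← mfderivWithin_eq_fderivWithin]
            exact congr($hc 1)
          have e1 := h.norm_mfderiv_le hK (hsrc t ht')
            (mfderivWithin 𝓘(ℝ, ℝ) (𝓡 k) γ (Set.Icc 0 t₁) t (1 : ℝ))
          rw [← hd] at e1
          rw [← ofReal_norm]
          refine (ENNReal.ofReal_le_ofReal e1).trans (le_of_eq ?_)
          rw [ENNReal.ofReal_mul hK'.le]
          exact congrArg _ (ofReal_norm (E := TangentSpace (𝓡 k) (γ t)) _)
      _ = ENNReal.ofReal (√K) * pathELength (𝓡 k) γ 0 t₁ := by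
          rw [lintegral_const_mul' _ _ ENNReal.ofReal_ne_top,
            pathELength_eq_lintegral_mfderivWithin_Icc]
      _ ≤ ENNReal.ofReal (√K) * pathELength (𝓡 k) γ 0 1 := by
          gcongr
      _ < ENNReal.ofReal (√K) * ENNReal.ofReal a := by
          rw [ENNReal.mul_lt_mul_iff_right (by simpa using hK) ENNReal.ofReal_ne_top]
          exact hlen
      _ = ENNReal.ofReal R := by rw [← ENNReal.ofReal_mul hK'.le]
  have h2 : γ' 0 = 0 := by simp [hγ', h0, hx0]
  rw [h2, sub_zero, ← ofReal_norm, ENNReal.ofReal_lt_ofReal_iff hR0] at hlt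
  exact ⟨γ' t₁, by simpa using hlt, φ.left_inv (hsrc t₁ ⟨ht0, le_rfl⟩)⟩

end Charts

/-! ### Christoffel symbols in bounded charts -/

section Christoffel

variable {k : ℕ}
  {M : Type*} [TopologicalSpace M] [ChartedSpace (EuclideanSpace ℝ (Fin k)) M]
  [RiemannianBundle (fun ξ : M ↦ TangentSpace (𝓡 k) ξ)]
  {σ : EuclideanSpace ℝ (Fin k) → M} {u : EuclideanSpace ℝ (Fin k)}

theorem metricCoeff_comm (v w : EuclideanSpace ℝ (Fin k)) :
    metricCoeff σ u v w = metricCoeff σ u w v :=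
  real_inner_comm _ _

theorem metricCoeff_add_left (v v' w : EuclideanSpace ℝ (Fin k)) :
    metricCoeff σ u (v + v') w = metricCoeff σ u v w + metricCoeff σ u v' w := by
  unfold metricCoeff
  rw [← inner_add_left]
  congr 1
  exact map_add (mfderiv (𝓡 k) (𝓡 k) σ u) v v'

theorem metricCoeff_smul_left (a : ℝ) (v w : EuclideanSpace ℝ (Fin k)) :
    metricCoeff σ u (a • v) w = a * metricCoeff σ u v w := by
  unfold metricCoeff
  rw [← real_inner_smul_left]
  congr 1
  exact map_smul (mfderiv (𝓡 k) (𝓡 k) σ u) a v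

theorem metricCoeff_add_right (v w w' : EuclideanSpace ℝ (Fin k)) :
    metricCoeff σ u v (w + w') = metricCoeff σ u v w + metricCoeff σ u v w' := by
  rw [metricCoeff_comm, metricCoeff_add_left, metricCoeff_comm w, metricCoeff_comm w']

theorem metricCoeff_smul_right (a : ℝ) (v w : EuclideanSpace ℝ (Fin k)) :
    metricCoeff σ u v (a • w) = a * metricCoeff σ u v w := by
  rw [metricCoeff_comm, metricCoeff_smul_left, metricCoeff_comm]

/-- A positive definite metric with differentiable coefficients has Christoffel symbols. -/
theorem exists_isChristoffel (hpos : ∀ v, v ≠ 0 → 0 < metricCoeff σ u v v)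
    (hd : ∀ v w, DifferentiableAt ℝ (fun y => metricCoeff σ y v w) u)
    (v w : EuclideanSpace ℝ (Fin k)) : ∃ γ, IsChristoffel σ u v w γ := by
  set D : EuclideanSpace ℝ (Fin k) → EuclideanSpace ℝ (Fin k) →
    EuclideanSpace ℝ (Fin k) →L[ℝ] ℝ := fun a b => fderiv ℝ (fun y => metricCoeff σ y a b) u with hD
  have hadd : ∀ a b b', D a (b + b') = D a b + D a b' := by
    intro a b b'
    simp only [hD, metricCoeff_add_right]
    exact fderiv_fun_add (hd a b) (hd a b')
  have hsmul : ∀ (c : ℝ) a b, D a (c • b) = c • D a b := by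
    intro c a b
    simp only [hD, metricCoeff_smul_right]
    exact fderiv_const_mul (hd a b) c
  let ℓ : Module.Dual ℝ (EuclideanSpace ℝ (Fin k)) :=
    { toFun := fun z => (D w z v + D v z w - D v w z) / 2
      map_add' := by
        intro z z'
        simp only [hadd, add_apply, map_add]
        ring
      map_smul' := by
        intro c z
        simp only [hsmul, smul_apply, map_smul, smul_eq_mul, RingHom.id_apply]
        ring }
  let B : EuclideanSpace ℝ (Fin k) →ₗ[ℝ] Module.Dual ℝ (EuclideanSpace ℝ (Fin k)) :=
    LinearMap.mk₂ ℝ (fun a b => metricCoeff σ u a b) metricCoeff_add_left metricCoeff_smul_left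
      metricCoeff_add_right metricCoeff_smul_right
  have hinj : Function.Injective B := by
    rw [injective_iff_map_eq_zero]
    intro a ha
    by_contra hne
    have h1 := hpos a hne
    have h2 : B a a = 0 := by rw [ha]; rfl
    exact h1.ne' h2
  obtain ⟨γ, hγ⟩ := (LinearMap.injective_iff_surjective_of_finrank_eq_finrank
    (Subspace.dual_finrank_eq (K := ℝ) (V := EuclideanSpace ℝ (Fin k))).symm).1 hinj ℓ
  refine ⟨γ, fun z => ?_⟩
  have h1 : metricCoeff σ u γ z = (D w z v + D v z w - D v w z) / 2 := congr($hγ z)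
  rw [h1]
  ring

end Christoffel

section ChartChristoffel

variable {k : ℕ}
  {M : Type*} [TopologicalSpace M] [ChartedSpace (EuclideanSpace ℝ (Fin k)) M]
  [RiemannianBundle (fun ξ : M ↦ TangentSpace (𝓡 k) ξ)]
  {φ : OpenPartialHomeomorph M (EuclideanSpace ℝ (Fin k))} {r K : ℝ}
  {u : EuclideanSpace ℝ (Fin k)}

theorem IsBoundedChart.metricCoeff_pos (h : IsBoundedChart φ r K) (hK : 0 < K)
    (hu : u ∈ Metric.ball 0 r) {v : EuclideanSpace ℝ (Fin k)} (hv : v ≠ 0) :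
    0 < metricCoeff φ.symm u v v :=
  (by positivity : 0 < K⁻¹ * ‖v‖ ^ 2).trans_le (h.bounded u hu v v).1

theorem IsBoundedChart.abs_fderiv_metricCoeff_le (h : IsBoundedChart φ r K)
    (hu : u ∈ Metric.ball 0 r) (v w z : EuclideanSpace ℝ (Fin k)) :
    |fderiv ℝ (fun y => metricCoeff φ.symm y v w) u z| ≤ K * ‖v‖ * ‖w‖ * ‖z‖ := by
  have h1 := (h.bounded u hu v w).2 1 (by norm_num)
  rw [norm_iteratedFDeriv_one] at h1
  exact ((fderiv ℝ (fun y => metricCoeff φ.symm y v w) u).le_opNorm z).trans (by gcongr)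

theorem IsBoundedChart.norm_le_of_isChristoffel (h : IsBoundedChart φ r K) (hK : 0 < K)
    (hu : u ∈ Metric.ball 0 r) {v w γ : EuclideanSpace ℝ (Fin k)}
    (hγ : IsChristoffel φ.symm u v w γ) : ‖γ‖ ≤ 2 * K ^ 2 * ‖v‖ * ‖w‖ := by
  have h1 := hγ γ
  have h2 := (h.bounded u hu γ γ).1
  have e1 := (abs_le.1 (h.abs_fderiv_metricCoeff_le hu w γ v)).2
  have e2 := (abs_le.1 (h.abs_fderiv_metricCoeff_le hu v γ w)).2
  have e3 := (abs_le.1 (h.abs_fderiv_metricCoeff_le hu v w γ)).1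
  have h3 : 2 * (K⁻¹ * ‖γ‖ ^ 2) ≤ 3 * K * ‖v‖ * ‖w‖ * ‖γ‖ := by nlinarith
  have h4 : 2 * ‖γ‖ ^ 2 ≤ 3 * K ^ 2 * ‖v‖ * ‖w‖ * ‖γ‖ := by
    have := mul_le_mul_of_nonneg_left h3 hK.le
    have e : K * (2 * (K⁻¹ * ‖γ‖ ^ 2)) = 2 * ‖γ‖ ^ 2 := by field_simp
    rw [e] at this
    nlinarith
  rcases (norm_nonneg γ).eq_or_lt with h0 | h0
  · rw [← h0]
    positivity
  · have h5 : 0 ≤ K ^ 2 * ‖v‖ * ‖w‖ := by positivity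
    have : 2 * ‖γ‖ ≤ 3 * K ^ 2 * ‖v‖ * ‖w‖ := by
      by_contra! hc
      nlinarith
    linarith

variable [IsManifold (𝓡 k) ∞ M] [IsContMDiffRiemannianBundle (𝓡 k) 2 (EuclideanSpace ℝ (Fin k))
  (fun ξ : M ↦ TangentSpace (𝓡 k) ξ)]

theorem IsBoundedChart.differentiableAt_metricCoeff (h : IsBoundedChart φ r K)
    (hu : u ∈ Metric.ball 0 r) (v w : EuclideanSpace ℝ (Fin k)) :
    DifferentiableAt ℝ (fun y => metricCoeff φ.symm y v w) u := by
  have : IsManifold (𝓡 k) 1 M := IsManifold.of_le (n := ∞) (by norm_cast)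
  have hfield : ∀ v : EuclideanSpace ℝ (Fin k), ContMDiffAt (𝓡 k) (𝓡 k).tangent 1
      (fun y => (⟨φ.symm y, mfderiv (𝓡 k) (𝓡 k) φ.symm y v⟩ : TangentBundle (𝓡 k) M)) u := by
    intro v
    have h1 := h.contMDiffOn_symm.contMDiffOn_tangentMapWithin (m := 1) (by norm_cast)
      Metric.isOpen_ball.uniqueMDiffOn
    have h2 : ContMDiffOn (𝓡 k) (𝓡 k).tangent 1 (fun y : EuclideanSpace ℝ (Fin k) =>
        (⟨y, v⟩ : TangentBundle (𝓡 k) (EuclideanSpace ℝ (Fin k)))) (Metric.ball 0 r) :=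
      contMDiffOn_vectorSpace_iff_contDiffOn.2 contDiffOn_const
    have h3 := h1.comp h2 (fun y hy => hy)
    refine ((h3 u hu).contMDiffAt (Metric.isOpen_ball.mem_nhds hu)).congr_of_eventuallyEq ?_
    filter_upwards [Metric.isOpen_ball.mem_nhds hu] with y hy
    simp only [Function.comp_apply, tangentMapWithin]
    rw [mfderivWithin_of_isOpen Metric.isOpen_ball hy]
  have h4 := (hfield v).inner_bundle (hfield w)
  exact (contMDiffAt_iff_contDiffAt.1 h4).differentiableAt one_ne_zero

theorem IsBoundedChart.exists_isChristoffel (h : IsBoundedChart φ r K) (hK : 0 < K)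
    (hu : u ∈ Metric.ball 0 r) (v w : EuclideanSpace ℝ (Fin k)) :
    ∃ γ, IsChristoffel φ.symm u v w γ :=
  InvariancePrinciple.exists_isChristoffel (fun _ hv => h.metricCoeff_pos hK hu hv)
    (h.differentiableAt_metricCoeff hu) v w

end ChartChristoffel

/-! ### Second derivatives in charts -/

section Hessian

open Manifold

variable {k l : ℕ}
  {M : Type*} [TopologicalSpace M] [ChartedSpace (EuclideanSpace ℝ (Fin k)) M]
  [RiemannianBundle (fun ξ : M ↦ TangentSpace (𝓡 k) ξ)]
  {M' : Type*} [TopologicalSpace M'] [ChartedSpace (EuclideanSpace ℝ (Fin l)) M']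
  [RiemannianBundle (fun ξ : M' ↦ TangentSpace (𝓡 l) ξ)]
  {φ : OpenPartialHomeomorph M (EuclideanSpace ℝ (Fin k))}
  {ψ : OpenPartialHomeomorph M' (EuclideanSpace ℝ (Fin l))} {r K : ℝ} {F : M → M'}
  {u : EuclideanSpace ℝ (Fin k)}

/-- The expression of a map between manifolds in two charts. -/
def chartMap (φ : OpenPartialHomeomorph M (EuclideanSpace ℝ (Fin k)))
    (ψ : OpenPartialHomeomorph M' (EuclideanSpace ℝ (Fin l))) (F : M → M') :
    EuclideanSpace ℝ (Fin k) → EuclideanSpace ℝ (Fin l) :=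
  fun y => ψ (F (φ.symm y))

theorem sqrt_metricCoeff_self (σ : EuclideanSpace ℝ (Fin k) → M)
    (u v : EuclideanSpace ℝ (Fin k)) :
    √(metricCoeff σ u v v) = tangentNorm (σ u) (mfderiv (𝓡 k) (𝓡 k) σ u v) :=
  (congrArg Real.sqrt (metricCoeff_self σ u v)).trans (Real.sqrt_sq (tangentNorm_nonneg _ _))

theorem fderiv_chartMap (hφ : IsBoundedChart φ r K) (hψ : IsBoundedChart ψ r K)
    (hF : ContMDiff (𝓡 k) (𝓡 l) 1 F) (hu : u ∈ Metric.ball 0 r) (hu' : F (φ.symm u) ∈ ψ.source)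
    (v : EuclideanSpace ℝ (Fin k)) :
    fderiv ℝ (chartMap φ ψ F) u v = mfderiv (𝓡 l) (𝓡 l) ψ (F (φ.symm u))
      (mfderiv (𝓡 k) (𝓡 l) F (φ.symm u) (mfderiv (𝓡 k) (𝓡 k) φ.symm u v)) := by
  have h1 : HasMFDerivAt (𝓡 k) (𝓡 l) (ψ ∘ (F ∘ φ.symm)) u
      ((mfderiv (𝓡 l) (𝓡 l) ψ (F (φ.symm u))).comp
        ((mfderiv (𝓡 k) (𝓡 l) F (φ.symm u)).comp (mfderiv (𝓡 k) (𝓡 k) φ.symm u))) :=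
    (hψ.mdifferentiableAt hu').hasMFDerivAt.comp u
      ((hF.mdifferentiable one_ne_zero _).hasMFDerivAt.comp u
        (hφ.mdifferentiableAt_symm hu).hasMFDerivAt)
  have h2 := h1.mfderiv
  rw [mfderiv_eq_fderiv] at h2
  exact congr($h2 v)

theorem norm_fderiv_chartMap_le (hφ : IsBoundedChart φ r K)
    (hψ : IsBoundedChart ψ r K) (hK : 0 < K) (hF : ContMDiff (𝓡 k) (𝓡 l) 1 F)
    {L : ℝ} (hL : 0 ≤ L)
    (hFL : ∀ x v, tangentNorm (F x) (mfderiv (𝓡 k) (𝓡 l) F x v) ≤ L * tangentNorm x v)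
    (hu : u ∈ Metric.ball 0 r) (hu' : F (φ.symm u) ∈ ψ.source) (v : EuclideanSpace ℝ (Fin k)) :
    ‖fderiv ℝ (chartMap φ ψ F) u v‖ ≤ K * L * ‖v‖ := by
  rw [fderiv_chartMap hφ hψ hF hu hu']
  have h1 := hψ.norm_mfderiv_le hK hu'
    (mfderiv (𝓡 k) (𝓡 l) F (φ.symm u) (mfderiv (𝓡 k) (𝓡 k) φ.symm u v))
  have h2 := hFL (φ.symm u) (mfderiv (𝓡 k) (𝓡 k) φ.symm u v)
  have h3 := hφ.norm_mfderiv_symm_le hK.le hu v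
  refine h1.trans ?_
  have h4 : L * tangentNorm (φ.symm u) (mfderiv (𝓡 k) (𝓡 k) φ.symm u v) ≤ L * (√K * ‖v‖) := by
    gcongr
  refine (mul_le_mul_of_nonneg_left (h2.trans h4) (Real.sqrt_nonneg K)).trans (le_of_eq ?_)
  have h5 : √K * √K = K := Real.mul_self_sqrt hK.le
  calc √K * (L * (√K * ‖v‖)) = (√K * √K) * L * ‖v‖ := by ring
    _ = _ := by rw [h5]

variable [IsManifold (𝓡 k) ∞ M] [IsContMDiffRiemannianBundle (𝓡 k) 2 (EuclideanSpace ℝ (Fin k))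
  (fun ξ : M ↦ TangentSpace (𝓡 k) ξ)]
  [IsManifold (𝓡 l) ∞ M'] [IsContMDiffRiemannianBundle (𝓡 l) 2 (EuclideanSpace ℝ (Fin l))
  (fun ξ : M' ↦ TangentSpace (𝓡 l) ξ)]

/-- In bounded charts, a bound on the covariant Hessian is a bound on the second derivative. -/
theorem norm_fderiv_fderiv_chartMap_le (hφ : IsBoundedChart φ r K)
    (hψ : IsBoundedChart ψ r K) (hK : 0 < K) (hF : ContMDiff (𝓡 k) (𝓡 l) 1 F)
    {L : ℝ} (hL : 0 ≤ L)
    (hFL : ∀ x v, tangentNorm (F x) (mfderiv (𝓡 k) (𝓡 l) F x v) ≤ L * tangentNorm x v)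
    (hH : HessianBoundedBy (k := k) (l := l) F L)
    (hu : u ∈ Metric.ball 0 r) (hu' : F (φ.symm u) ∈ ψ.source) :
    ‖fderiv ℝ (fderiv ℝ (chartMap φ ψ F)) u‖ ≤
      √K * L * K + K * L * (2 * K ^ 2) + 2 * K ^ 2 * (K * L) ^ 2 := by
  have hGu : chartMap φ ψ F u ∈ Metric.ball 0 r := hψ.mem_ball hu'
  refine ContinuousLinearMap.opNorm_le_bound _ (by positivity) fun v => ?_
  refine ContinuousLinearMap.opNorm_le_bound _ (by positivity) fun w => ?_
  have hDG := norm_fderiv_chartMap_le hφ hψ hK hF hL hFL hu hu'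
  set G := chartMap φ ψ F with hG
  obtain ⟨γ, hγ⟩ := hφ.exists_isChristoffel hK hu v w
  obtain ⟨γ', hγ'⟩ := hψ.exists_isChristoffel hK hGu (fderiv ℝ G u v) (fderiv ℝ G u w)
  have h1 := hH φ hφ.mem_maximalAtlas ψ hψ.mem_maximalAtlas u (by rw [hφ.target_eq]; exact hu) hu'
    v w γ γ' hγ hγ'
  change √(metricCoeff ψ.symm (G u) (fderiv ℝ (fderiv ℝ G) u v w - fderiv ℝ G u γ + γ')
    (fderiv ℝ (fderiv ℝ G) u v w - fderiv ℝ G u γ + γ')) ≤ _ at h1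
  simp only [sqrt_metricCoeff_self] at h1
  set H := fderiv ℝ (fderiv ℝ G) u v w - fderiv ℝ G u γ + γ' with hHdef
  have hHn : ‖H‖ ≤ √K * L * K * ‖v‖ * ‖w‖ := by
    refine (hψ.norm_le_mfderiv_symm hK hGu H).trans ?_
    refine (mul_le_mul_of_nonneg_left h1 (Real.sqrt_nonneg K)).trans ?_
    have e1 := hφ.norm_mfderiv_symm_le hK.le hu v
    have e2 := hφ.norm_mfderiv_symm_le hK.le hu w
    calc √K * (L * tangentNorm (φ.symm u) (mfderiv (𝓡 k) (𝓡 k) φ.symm u v) *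
          tangentNorm (φ.symm u) (mfderiv (𝓡 k) (𝓡 k) φ.symm u w))
        ≤ √K * (L * (√K * ‖v‖) * (√K * ‖w‖)) := by
          gcongr
          exact tangentNorm_nonneg _ _
      _ = √K * L * (√K * √K) * ‖v‖ * ‖w‖ := by ring
      _ = _ := by rw [Real.mul_self_sqrt hK.le]
  have hγn : ‖fderiv ℝ G u γ‖ ≤ K * L * (2 * K ^ 2) * ‖v‖ * ‖w‖ := by
    refine (hDG γ).trans ?_
    have := hφ.norm_le_of_isChristoffel hK hu hγ
    calc K * L * ‖γ‖ ≤ K * L * (2 * K ^ 2 * ‖v‖ * ‖w‖) := by gcongr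
      _ = _ := by ring
  have hγ'n : ‖γ'‖ ≤ 2 * K ^ 2 * (K * L) ^ 2 * ‖v‖ * ‖w‖ := by
    refine (hψ.norm_le_of_isChristoffel hK hGu hγ').trans ?_
    calc 2 * K ^ 2 * ‖fderiv ℝ G u v‖ * ‖fderiv ℝ G u w‖
        ≤ 2 * K ^ 2 * (K * L * ‖v‖) * (K * L * ‖w‖) := by
          gcongr
          · exact hDG v
          · exact hDG w
      _ = _ := by ring
  have heq : fderiv ℝ (fderiv ℝ G) u v w = H + fderiv ℝ G u γ - γ' := by
    rw [hHdef]
    abel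
  rw [heq]
  calc ‖H + fderiv ℝ G u γ - γ'‖ ≤ ‖H‖ + ‖fderiv ℝ G u γ‖ + ‖γ'‖ :=
        (norm_sub_le _ _).trans (by gcongr; exact norm_add_le _ _)
    _ ≤ _ := by linarith

end Hessian

section Taylor

/-- Second order Taylor estimate at the center of a ball. -/
theorem norm_sub_sub_fderiv_le {V W : Type*} [NormedAddCommGroup V] [NormedSpace ℝ V]
    [NormedAddCommGroup W] [NormedSpace ℝ W] {G : V → W} {ρ C : ℝ}
    (hG : ∀ u ∈ Metric.ball (0 : V) ρ, ContDiffAt ℝ 2 G u)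
    (hC : ∀ u ∈ Metric.ball (0 : V) ρ, ‖fderiv ℝ (fderiv ℝ G) u‖ ≤ C) {u : V}
    (hu : u ∈ Metric.ball (0 : V) ρ) :
    ‖G u - G 0 - fderiv ℝ G 0 u‖ ≤ C * ‖u‖ ^ 2 := by
  have h0 : (0 : V) ∈ Metric.ball (0 : V) ρ :=
    Metric.mem_ball_self (dist_nonneg.trans_lt (Metric.mem_ball.1 hu))
  have hC0 : 0 ≤ C := (norm_nonneg (fderiv ℝ (fderiv ℝ G) 0)).trans (hC 0 h0)
  have hsub : Metric.closedBall (0 : V) ‖u‖ ⊆ Metric.ball 0 ρ := by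
    intro y hy
    rw [mem_closedBall_zero_iff] at hy
    rw [mem_ball_zero_iff] at hu ⊢
    exact hy.trans_lt hu
  have h1 : ∀ y ∈ Metric.closedBall (0 : V) ‖u‖, ‖fderiv ℝ G y - fderiv ℝ G 0‖ ≤ C * ‖u‖ := by
    intro y hy
    have := (convex_ball (0 : V) ρ).norm_image_sub_le_of_norm_fderiv_le (𝕜 := ℝ)
      (f := fderiv ℝ G) (fun z hz => ((hG z hz).fderiv_right (m := 1)
        (by norm_num)).differentiableAt one_ne_zero) hC h0 (hsub hy)
    rw [sub_zero] at this
    refine this.trans ?_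
    gcongr
    simpa using hy
  have h2 := (convex_closedBall (0 : V) ‖u‖).norm_image_sub_le_of_norm_fderiv_le' (𝕜 := ℝ)
    (f := G) (φ := fderiv ℝ G 0) (fun z hz => (hG z (hsub hz)).differentiableAt (by norm_num)) h1
    (Metric.mem_closedBall_self (norm_nonneg _)) (by simp : u ∈ Metric.closedBall (0 : V) ‖u‖)
  rw [sub_zero] at h2
  exact h2.trans (le_of_eq (by ring))

end Taylor

/-! ### Second-order approximation -/

section Log

open Manifold

theorem symm_zero_eq {M V : Type*} [TopologicalSpace M] [TopologicalSpace V] [Zero V]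
    {φ : OpenPartialHomeomorph M V} {x : M} (hx : x ∈ φ.source) (hx0 : φ x = 0) : φ.symm 0 = x := by
  rw [← hx0, φ.left_inv hx]

/-- The Riemannian distance between two points, as a real number. -/
noncomputable def riemannianDist (k : ℕ) {M : Type*} [TopologicalSpace M]
    [ChartedSpace (EuclideanSpace ℝ (Fin k)) M]
    [RiemannianBundle (fun ξ : M ↦ TangentSpace (𝓡 k) ξ)] (x y : M) : ℝ :=
  (riemannianEDist (𝓡 k) x y).toReal

variable {k l : ℕ}
  {M : Type*} [TopologicalSpace M] [ChartedSpace (EuclideanSpace ℝ (Fin k)) M]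
  [RiemannianBundle (fun ξ : M ↦ TangentSpace (𝓡 k) ξ)]
  {M' : Type*} [TopologicalSpace M'] [ChartedSpace (EuclideanSpace ℝ (Fin l)) M']
  [RiemannianBundle (fun ξ : M' ↦ TangentSpace (𝓡 l) ξ)]
  {φ : OpenPartialHomeomorph M (EuclideanSpace ℝ (Fin k))}
  {ψ : OpenPartialHomeomorph M' (EuclideanSpace ℝ (Fin l))} {r K : ℝ}

theorem riemannianDist_nonneg (x y : M) : 0 ≤ riemannianDist k x y := ENNReal.toReal_nonneg

/-- A substitute for the logarithm at the center of the chart `φ` of a Riemannian manifold: the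
tangent vector at the center which has the same coordinates as the point `y`. -/
noncomputable def chartLog (φ : OpenPartialHomeomorph M (EuclideanSpace ℝ (Fin k))) (y : M) :
    EuclideanSpace ℝ (Fin k) :=
  mfderiv (𝓡 k) (𝓡 k) φ.symm 0 (φ y)

/-- The differential of a map between manifolds, as a linear map between the model spaces. -/
noncomputable def coordDeriv (F : M → M') (x : M) :
    EuclideanSpace ℝ (Fin k) →L[ℝ] EuclideanSpace ℝ (Fin l) :=
  mfderiv (𝓡 k) (𝓡 l) F x

theorem IsBoundedChart.zero_mem_ball (h : IsBoundedChart φ r K) {x : M} (hx : x ∈ φ.source)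
    (hx0 : φ x = 0) : (0 : EuclideanSpace ℝ (Fin k)) ∈ Metric.ball 0 r := by
  have := h.mem_ball hx
  rwa [hx0] at this

theorem IsBoundedChart.tangentNorm_chartLog_le (h : IsBoundedChart φ r K) (hK : 0 ≤ K) {x : M}
    (hx : x ∈ φ.source) (hx0 : φ x = 0) (y : M) :
    tangentNorm x (chartLog φ y) ≤ √K * ‖φ y‖ := by
  have := h.norm_mfderiv_symm_le hK (h.zero_mem_ball hx hx0) (φ y)
  rwa [symm_zero_eq hx hx0] at this

theorem IsBoundedChart.norm_le_tangentNorm_chartLog (h : IsBoundedChart φ r K) (hK : 0 < K) {x : M}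
    (hx : x ∈ φ.source) (hx0 : φ x = 0) (y : M) :
    ‖φ y‖ ≤ √K * tangentNorm x (chartLog φ y) := by
  have := h.norm_le_mfderiv_symm hK (h.zero_mem_ball hx hx0) (φ y)
  rwa [symm_zero_eq hx hx0] at this

theorem IsBoundedChart.riemannianDist_le (h : IsBoundedChart φ r K) (hK : 0 ≤ K) {x y : M}
    (hx : x ∈ φ.source) (hx0 : φ x = 0) (hy : y ∈ φ.source) :
    riemannianDist k x y ≤ √K * ‖φ y‖ := by
  have := h.riemannianEDist_symm_le hK (h.zero_mem_ball hx hx0) (h.mem_ball hy)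
  rw [symm_zero_eq hx hx0, φ.left_inv hy, zero_sub, norm_neg] at this
  exact ENNReal.toReal_le_of_le_ofReal (by positivity) this

variable [T2Space M]

theorem IsBoundedChart.mem_source_of_riemannianDist_lt (h : IsBoundedChart φ r K) (hK : 0 < K)
    {x y : M} (hx : x ∈ φ.source) (hx0 : φ x = 0) (hfin : riemannianEDist (𝓡 k) x y ≠ ⊤)
    (hxy : √K * riemannianDist k x y < r) :
    y ∈ φ.source ∧ ‖φ y‖ ≤ √K * riemannianDist k x y := by
  have hK' : 0 < √K := Real.sqrt_pos.2 hK
  have key : ∀ a, riemannianDist k x y < a → √K * a < r → y ∈ φ.source ∧ ‖φ y‖ ≤ √K * a :=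
    fun a ha har => h.mem_source_of_riemannianEDist_lt hK hx hx0 har
      ((ENNReal.lt_ofReal_iff_toReal_lt hfin).2 ha)
  have hlt : riemannianDist k x y < r / √K := by
    rw [lt_div_iff₀ hK']
    linarith
  obtain ⟨b, hb1, hb2⟩ := exists_between hlt
  rw [lt_div_iff₀ hK', mul_comm] at hb2
  refine ⟨(key b hb1 hb2).1, ?_⟩
  refine le_of_forall_pos_le_add fun ε hε => ?_
  set a := min b (riemannianDist k x y + ε / √K) with ha
  have h1 : riemannianDist k x y < a := lt_min hb1 (by linarith [div_pos hε hK'])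
  have h2 : √K * a < r := (mul_le_mul_of_nonneg_left (min_le_left _ _) hK'.le).trans_lt hb2
  refine (key a h1 h2).2.trans ((mul_le_mul_of_nonneg_left (min_le_right _ _) hK'.le).trans
    (le_of_eq ?_))
  field_simp

variable [IsManifold (𝓡 k) ∞ M] [IsContMDiffRiemannianBundle (𝓡 k) 2 (EuclideanSpace ℝ (Fin k))
  (fun ξ : M ↦ TangentSpace (𝓡 k) ξ)]
  [IsManifold (𝓡 l) ∞ M'] [T2Space M'] [IsContMDiffRiemannianBundle (𝓡 l) 2
  (EuclideanSpace ℝ (Fin l)) (fun ξ : M' ↦ TangentSpace (𝓡 l) ξ)]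

/-- A map with bounded covariant derivatives of order one and two is approximated to second order
by its differential. -/
theorem tangentNorm_chartLog_sub_le {F : M → M'} (hφ : IsBoundedChart φ r K)
    (hψ : IsBoundedChart ψ r K) (hK : 1 ≤ K) (hF : ContMDiff (𝓡 k) (𝓡 l) 2 F)
    {L : ℝ} (hL : 1 ≤ L)
    (hFL : ∀ x v, tangentNorm (F x) (coordDeriv (k := k) (l := l) F x v) ≤ L * tangentNorm x v)
    (hH : HessianBoundedBy (k := k) (l := l) F L) {x y : M} (hx : x ∈ φ.source) (hx0 : φ x = 0)
    (hFx : F x ∈ ψ.source) (hFx0 : ψ (F x) = 0)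
    (hfin : riemannianEDist (𝓡 k) x y ≠ ⊤) (hxy : √K * riemannianDist k x y < r / (K * L)) :
    tangentNorm (F x) (chartLog ψ (F y) - coordDeriv F x (chartLog φ y)) ≤
      √K * (√K * L * K + K * L * (2 * K ^ 2) + 2 * K ^ 2 * (K * L) ^ 2) * K *
        riemannianDist k x y ^ 2 := by
  have hK0 : 0 < K := by linarith
  have hL0 : 0 < L := by linarith
  have hK' : 0 < √K := Real.sqrt_pos.2 hK0
  have hKK : √K * √K = K := Real.mul_self_sqrt hK0.le
  have hF1 : ContMDiff (𝓡 k) (𝓡 l) 1 F := hF.of_le (by norm_num)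
  have hKL : 1 ≤ K * L := by nlinarith
  have hr : 0 < r := by
    have := hφ.zero_mem_ball hx hx0
    simpa using this
  have hrle : r / (K * L) ≤ r := div_le_self hr.le hKL
  have hx' := symm_zero_eq hx hx0
  -- the image of a smaller ball of the first chart lies in the second chart
  have hball : ∀ u ∈ Metric.ball (0 : EuclideanSpace ℝ (Fin k)) (r / (K * L)),
      F (φ.symm u) ∈ ψ.source := by
    intro u hu
    have hur : u ∈ Metric.ball (0 : EuclideanSpace ℝ (Fin k)) r := Metric.ball_subset_ball hrle hu
    rw [mem_ball_zero_iff, lt_div_iff₀ (by positivity)] at hu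
    have h1 := hφ.riemannianEDist_symm_le hK0.le (hφ.zero_mem_ball hx hx0) hur
    rw [hx', zero_sub, norm_neg] at h1
    have hlt : L * (√K * ‖u‖) < r / √K := by
      rw [lt_div_iff₀ hK']
      calc L * (√K * ‖u‖) * √K = ‖u‖ * (√K * √K * L) := by ring
        _ < r := by rw [hKK]; exact hu
    have hlt' : √K * ‖u‖ < r / √K / L := by
      rw [lt_div_iff₀ hL0, mul_comm]
      exact hlt
    obtain ⟨b, hb1, hb2⟩ := exists_between hlt'
    rw [lt_div_iff₀ hL0] at hb2
    obtain ⟨a, ha1, ha2⟩ := exists_between hb2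
    rw [lt_div_iff₀ hK', mul_comm] at ha2
    have hb0 : 0 < b := lt_of_le_of_lt (by positivity) hb1
    have h2 : riemannianEDist (𝓡 k) x (φ.symm u) < ENNReal.ofReal b :=
      h1.trans_lt ((ENNReal.ofReal_lt_ofReal_iff hb0).2 hb1)
    have h3 := riemannianEDist_comp_le hF1 hL0.le (fun x v => hFL x v) h2
    rw [← ENNReal.ofReal_mul hL0.le] at h3
    have ha0 : 0 < a := lt_trans (by positivity) ha1
    refine (hψ.mem_source_of_riemannianEDist_lt hK0 hFx hFx0 ha2 (h3.trans_lt ?_)).1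
    rw [ENNReal.ofReal_lt_ofReal_iff ha0]
    linarith
  have hmaps : ∀ u ∈ Metric.ball (0 : EuclideanSpace ℝ (Fin k)) (r / (K * L)),
      ContDiffAt ℝ 2 (chartMap φ ψ F) u := by
    intro u hu
    have hur : u ∈ Metric.ball (0 : EuclideanSpace ℝ (Fin k)) r := Metric.ball_subset_ball hrle hu
    have h1 : ContMDiffAt (𝓡 k) (𝓡 k) 2 φ.symm u :=
      ((hφ.contMDiffOn_symm u hur).contMDiffAt (Metric.isOpen_ball.mem_nhds hur)).of_le
        (by norm_cast)
    have h2 : ContMDiffAt (𝓡 l) (𝓡 l) 2 ψ (F (φ.symm u)) :=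
      ((hψ.contMDiffOn _ (hball u hu)).contMDiffAt (ψ.open_source.mem_nhds (hball u hu))).of_le
        (by norm_cast)
    exact contMDiffAt_iff_contDiffAt.1 (h2.comp u (hF.contMDiffAt.comp u h1))
  obtain ⟨hy, hyn⟩ := hφ.mem_source_of_riemannianDist_lt hK0 hx hx0 hfin (hxy.trans_le hrle)
  have hyb : φ y ∈ Metric.ball (0 : EuclideanSpace ℝ (Fin k)) (r / (K * L)) := by
    rw [mem_ball_zero_iff]
    exact hyn.trans_lt hxy
  have hT := norm_sub_sub_fderiv_le hmaps (fun u hu =>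
    norm_fderiv_fderiv_chartMap_le hφ hψ hK0 hF1 hL0.le hFL hH (Metric.ball_subset_ball hrle hu)
      (hball u hu)) hyb
  set C := √K * L * K + K * L * (2 * K ^ 2) + 2 * K ^ 2 * (K * L) ^ 2 with hC
  have hC0 : 0 ≤ C := by positivity
  have hG0 : chartMap φ ψ F 0 = 0 := by
    simp only [chartMap]
    rw [hx', hFx0]
  have hGy : chartMap φ ψ F (φ y) = ψ (F y) := by
    simp only [chartMap]
    rw [φ.left_inv hy]
  have hD := fderiv_chartMap hφ hψ hF1 (hφ.zero_mem_ball hx hx0) (by rwa [hx']) (φ y)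
  -- the differential of the second parametrization brings the estimate back to the manifold
  have hback : mfderiv (𝓡 l) (𝓡 l) ψ.symm 0 (fderiv ℝ (chartMap φ ψ F) 0 (φ y)) =
      mfderiv (𝓡 k) (𝓡 l) F x (chartLog φ y) := by
    have hd : ψ.MDifferentiable (𝓡 l) (𝓡 l) :=
      ⟨fun y hy => (hψ.mdifferentiableAt hy).mdifferentiableWithinAt, fun u hu => by
        rw [hψ.target_eq] at hu
        exact (hψ.mdifferentiableAt_symm hu).mdifferentiableWithinAt⟩
    have e1 := congr($(hd.symm_comp_deriv hFx) (mfderiv (𝓡 k) (𝓡 l) F x (chartLog φ y)))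
    rw [hFx0] at e1
    rw [hx'] at hD
    rw [hD]
    exact e1
  have hback' : mfderiv (𝓡 l) (𝓡 l) ψ.symm 0 (fderiv ℝ (chartMap φ ψ F) 0 (φ y)) =
      coordDeriv F x (chartLog φ y) := hback
  have h1 := hψ.norm_mfderiv_symm_le hK0.le (hψ.zero_mem_ball hFx hFx0)
    (chartMap φ ψ F (φ y) - chartMap φ ψ F 0 - fderiv ℝ (chartMap φ ψ F) 0 (φ y))
  rw [symm_zero_eq hFx hFx0, hGy, hG0, sub_zero] at h1
  rw [hGy, hG0, sub_zero] at hT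
  have h2 : mfderiv (𝓡 l) (𝓡 l) ψ.symm 0 (ψ (F y) - fderiv ℝ (chartMap φ ψ F) 0 (φ y)) =
      chartLog ψ (F y) - coordDeriv F x (chartLog φ y) := by
    rw [← hback']
    exact map_sub (mfderiv (𝓡 l) (𝓡 l) ψ.symm 0) _ _
  have h3 : tangentNorm (F x) (chartLog ψ (F y) - coordDeriv F x (chartLog φ y)) ≤
      √K * ‖ψ (F y) - fderiv ℝ (chartMap φ ψ F) 0 (φ y)‖ := by
    exact (congrArg (tangentNorm (F x)) h2).symm.le.trans h1
  refine h3.trans ?_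
  have hd0 := riemannianDist_nonneg (k := k) x y
  calc √K * ‖ψ (F y) - fderiv ℝ (chartMap φ ψ F) 0 (φ y)‖
      ≤ √K * (C * (√K * riemannianDist k x y) ^ 2) := by
        refine mul_le_mul_of_nonneg_left (hT.trans ?_) hK'.le
        gcongr
    _ = √K * C * (√K * √K) * riemannianDist k x y ^ 2 := by ring
    _ = _ := by rw [hKK]

end Log

/-! ### Differentials of the iterates -/

section CoordDeriv

open Manifold

variable {k l j : ℕ}
  {M : Type*} [TopologicalSpace M] [ChartedSpace (EuclideanSpace ℝ (Fin k)) M]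
  {M' : Type*} [TopologicalSpace M'] [ChartedSpace (EuclideanSpace ℝ (Fin l)) M']
  {M'' : Type*} [TopologicalSpace M''] [ChartedSpace (EuclideanSpace ℝ (Fin j)) M'']

theorem coordDeriv_id (x : M) (v : EuclideanSpace ℝ (Fin k)) :
    coordDeriv (k := k) (l := k) (id : M → M) x v = v := by
  have h : mfderiv (𝓡 k) (𝓡 k) (id : M → M) x = ContinuousLinearMap.id ℝ _ := mfderiv_id
  exact congr($h v)

theorem coordDeriv_comp {G : M' → M''} {F : M → M'} {x : M}
    (hG : MDifferentiableAt (𝓡 l) (𝓡 j) G (F x)) (hF : MDifferentiableAt (𝓡 k) (𝓡 l) F x)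
    (v : EuclideanSpace ℝ (Fin k)) :
    coordDeriv (k := k) (l := j) (G ∘ F) x v =
      coordDeriv (k := l) (l := j) G (F x) (coordDeriv (k := k) (l := l) F x v) :=
  congr($(mfderiv_comp x hG hF) v)

theorem isInvertible_mfderiv_diffeomorph {n : ℕ∞ω} (F : M ≃ₘ^n⟮𝓡 k, 𝓡 l⟯ M') (hn : n ≠ 0) (x : M) :
    (mfderiv (𝓡 k) (𝓡 l) F x).IsInvertible :=
  ⟨F.mfderivToContinuousLinearEquiv hn x, rfl⟩

variable [RiemannianBundle (fun ξ : M ↦ TangentSpace (𝓡 k) ξ)]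
  [RiemannianBundle (fun ξ : M' ↦ TangentSpace (𝓡 l) ξ)]

theorem tangentNorm_coordDeriv_le {F : M → M'} {x : M} {L : ℝ}
    (hL : ‖mfderiv (𝓡 k) (𝓡 l) F x‖ ≤ L) (v : EuclideanSpace ℝ (Fin k)) :
    tangentNorm (F x) (coordDeriv (k := k) (l := l) F x v) ≤ L * tangentNorm x v :=
  (mfderiv (𝓡 k) (𝓡 l) F x).le_of_opNorm_le hL v

theorem tangentNorm_le_norm_inverse_mul {F : M → M'} {x : M}
    (hF : (mfderiv (𝓡 k) (𝓡 l) F x).IsInvertible) (v : EuclideanSpace ℝ (Fin k)) :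
    tangentNorm x v ≤ ‖(mfderiv (𝓡 k) (𝓡 l) F x).inverse‖ *
      tangentNorm (F x) (coordDeriv (k := k) (l := l) F x v) := by
  have h := (mfderiv (𝓡 k) (𝓡 l) F x).inverse.le_opNorm (mfderiv (𝓡 k) (𝓡 l) F x v)
  exact (congrArg (tangentNorm x) (hF.inverse_apply_self v)).ge.trans h

theorem norm_inverse_mfderiv_le {F : M → M'} {x : M} {L : ℝ} (hL : 0 ≤ L)
    (hF : (mfderiv (𝓡 k) (𝓡 l) F x).IsInvertible)
    (h : ∀ v, tangentNorm x v ≤ L * tangentNorm (F x) (coordDeriv (k := k) (l := l) F x v)) :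
    ‖(mfderiv (𝓡 k) (𝓡 l) F x).inverse‖ ≤ L := by
  refine ContinuousLinearMap.opNorm_le_bound _ hL fun w => ?_
  obtain ⟨v, rfl⟩ := hF.surjective w
  rw [hF.inverse_apply_self]
  exact h v

theorem riemannianDist_comp_le {F : M → M'} (hF : ContMDiff (𝓡 k) (𝓡 l) 1 F) {L : ℝ} (hL : 0 ≤ L)
    (h : ∀ x v, tangentNorm (F x) (coordDeriv (k := k) (l := l) F x v) ≤ L * tangentNorm x v)
    {x y : M} (hfin : riemannianEDist (𝓡 k) x y ≠ ⊤) :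
    riemannianDist l (F x) (F y) ≤ L * riemannianDist k x y :=
  toReal_riemannianEDist_comp_le hF hL h hfin

theorem riemannianDist_le_comp {n : ℕ∞ω} (F : M ≃ₘ^n⟮𝓡 k, 𝓡 l⟯ M') (hn : 1 ≤ n) {L : ℝ} (hL : 0 ≤ L)
    (h : ∀ x v, tangentNorm x v ≤ L * tangentNorm (F x) (coordDeriv (k := k) (l := l) F x v))
    {x y : M} (hfin : riemannianEDist (𝓡 l) (F x) (F y) ≠ ⊤) :
    riemannianDist k x y ≤ L * riemannianDist l (F x) (F y) := by
  have hn0 : n ≠ 0 := (zero_lt_one.trans_le hn).ne'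
  have h1 := riemannianDist_comp_le (F := F.symm) (F.symm.contMDiff.of_le hn) hL (fun z v => by
    have h2 := h (F.symm z) (coordDeriv (k := l) (l := k) F.symm z v)
    have h3 := coordDeriv_comp (G := F) (F := F.symm) (x := z)
      (F.contMDiff.mdifferentiable hn0 _) (F.symm.contMDiff.mdifferentiable hn0 _) v
    have h4 : F ∘ F.symm = id := by
      ext z
      simp
    rw [h4, coordDeriv_id] at h3
    rw [← h3, F.apply_symm_apply] at h2
    exact h2) hfin
  simpa using h1

end CoordDeriv

section Iterates

open Manifold

variable {X : Type*} {dim : X → ℕ} {E : X → Type*} [∀ x, TopologicalSpace (E x)]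
  [∀ x, ChartedSpace (EuclideanSpace ℝ (Fin (dim x))) (E x)]
  {f : X → X} {F : ∀ x, E x ≃ₘ^2⟮𝓡 (dim x), 𝓡 (dim (f x))⟯ E (f x)}

theorem contMDiff_fiberIter (n : ℕ) (x : X) :
    ContMDiff (𝓡 (dim x)) (𝓡 (dim (f^[n] x))) 2 (fiberIter f (fun x ↦ F x) n x) := by
  induction n generalizing x with
  | zero => exact contMDiff_id
  | succ n ih => exact (ih (f x)).comp (F x).contMDiff

theorem coordDeriv_fiberIter_succ (n : ℕ) (x : X) (ξ : E x) (v : EuclideanSpace ℝ (Fin (dim x))) :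
    coordDeriv (k := dim x) (l := dim (f^[n + 1] x)) (fiberIter f (fun x ↦ F x) (n + 1) x) ξ v =
      coordDeriv (k := dim (f x)) (l := dim (f^[n] (f x))) (fiberIter f (fun x ↦ F x) n (f x))
        (F x ξ) (coordDeriv (k := dim x) (l := dim (f x)) (F x) ξ v) :=
  coordDeriv_comp (G := fiberIter f (fun x ↦ F x) n (f x)) (F := F x)
    ((contMDiff_fiberIter n (f x)).mdifferentiable (by norm_num) _)
    ((F x).contMDiff.mdifferentiable (by norm_num) _) v

theorem isInvertible_mfderiv_fiberIter (n : ℕ) (x : X) (ξ : E x) :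
    (mfderiv (𝓡 (dim x)) (𝓡 (dim (f^[n] x))) (fiberIter f (fun x ↦ F x) n x) ξ).IsInvertible := by
  induction n generalizing x with
  | zero =>
    have h : mfderiv (𝓡 (dim x)) (𝓡 (dim x)) (id : E x → E x) ξ = ContinuousLinearMap.id ℝ _ :=
      mfderiv_id
    change (mfderiv (𝓡 (dim x)) (𝓡 (dim x)) (id : E x → E x) ξ).IsInvertible
    rw [h]
    exact ⟨ContinuousLinearEquiv.refl ℝ _, rfl⟩
  | succ n ih =>
    have h : mfderiv (𝓡 (dim x)) (𝓡 (dim (f^[n] (f x))))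
        (fiberIter f (fun x ↦ F x) n (f x) ∘ F x) ξ = _ :=
      mfderiv_comp ξ ((contMDiff_fiberIter n (f x)).mdifferentiable (by norm_num) (F x ξ))
        ((F x).contMDiff.mdifferentiable (by norm_num) ξ)
    change (mfderiv (𝓡 (dim x)) (𝓡 (dim (f^[n] (f x))))
        (fiberIter f (fun x ↦ F x) n (f x) ∘ F x) ξ).IsInvertible
    rw [h]
    exact (ih (f x) (F x ξ)).comp (isInvertible_mfderiv_diffeomorph (F x) (by norm_num) ξ)

variable [∀ x, RiemannianBundle (fun ξ : E x ↦ TangentSpace (𝓡 (dim x)) ξ)] {L : ℝ}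

theorem tangentNorm_coordDeriv_fiberIter_le (hL : 1 ≤ L)
    (hFL : ∀ x ξ v, tangentNorm (F x ξ) (coordDeriv (k := dim x) (l := dim (f x)) (F x) ξ v) ≤
      L * tangentNorm ξ v) (n : ℕ) (x : X) (ξ : E x) (v : EuclideanSpace ℝ (Fin (dim x))) :
    tangentNorm (fiberIter f (fun x ↦ F x) n x ξ)
      (coordDeriv (k := dim x) (l := dim (f^[n] x)) (fiberIter f (fun x ↦ F x) n x) ξ v) ≤
      L ^ n * tangentNorm ξ v := by
  induction n generalizing x with
  | zero =>
    rw [pow_zero, one_mul]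
    have h : tangentNorm ξ (coordDeriv (k := dim x) (l := dim x) (id : E x → E x) ξ v) =
        tangentNorm ξ v := by rw [coordDeriv_id]
    exact h.le
  | succ n ih =>
    rw [coordDeriv_fiberIter_succ]
    refine (ih (f x) (F x ξ) _).trans ?_
    rw [pow_succ, mul_assoc]
    exact mul_le_mul_of_nonneg_left (hFL x ξ v) (by positivity)

theorem tangentNorm_le_coordDeriv_fiberIter (hL : 1 ≤ L)
    (hFL : ∀ x (ξ : E x) (v : EuclideanSpace ℝ (Fin (dim x))), tangentNorm ξ v ≤
      L * tangentNorm (F x ξ) (coordDeriv (k := dim x) (l := dim (f x)) (F x) ξ v))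
    (n : ℕ) (x : X) (ξ : E x) (v : EuclideanSpace ℝ (Fin (dim x))) :
    tangentNorm ξ v ≤ L ^ n * tangentNorm (fiberIter f (fun x ↦ F x) n x ξ)
      (coordDeriv (k := dim x) (l := dim (f^[n] x)) (fiberIter f (fun x ↦ F x) n x) ξ v) := by
  induction n generalizing x with
  | zero =>
    rw [pow_zero, one_mul]
    exact (congrArg (tangentNorm ξ) (coordDeriv_id ξ v)).ge
  | succ n ih =>
    rw [coordDeriv_fiberIter_succ]
    refine (hFL x ξ v).trans ?_
    rw [pow_succ', mul_assoc]
    exact mul_le_mul_of_nonneg_left (ih (f x) (F x ξ) _) (by linarith)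

theorem norm_inverse_mfderiv_fiberIter_le (hL : 1 ≤ L)
    (hFL : ∀ x (ξ : E x) (v : EuclideanSpace ℝ (Fin (dim x))), tangentNorm ξ v ≤
      L * tangentNorm (F x ξ) (coordDeriv (k := dim x) (l := dim (f x)) (F x) ξ v))
    (n : ℕ) (x : X) (ξ : E x) :
    ‖(mfderiv (𝓡 (dim x)) (𝓡 (dim (f^[n] x))) (fiberIter f (fun x ↦ F x) n x) ξ).inverse‖ ≤
      L ^ n :=
  norm_inverse_mfderiv_le (by positivity) (isInvertible_mfderiv_fiberIter n x ξ)
    (tangentNorm_le_coordDeriv_fiberIter hL hFL n x ξ)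

theorem riemannianDist_le_fiberIter (hL : 1 ≤ L)
    (hd : ∀ x ξ η, riemannianDist (dim x) ξ η ≤ L * riemannianDist (dim (f x)) (F x ξ) (F x η))
    (n : ℕ) (x : X) (ξ η : E x) :
    riemannianDist (dim x) ξ η ≤ L ^ n * riemannianDist (dim (f^[n] x))
      (fiberIter f (fun x ↦ F x) n x ξ) (fiberIter f (fun x ↦ F x) n x η) := by
  induction n generalizing x with
  | zero =>
    rw [pow_zero, one_mul]
    exact le_rfl
  | succ n ih =>
    refine (hd x ξ η).trans ?_
    rw [pow_succ', mul_assoc]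
    exact mul_le_mul_of_nonneg_left (ih (f x) (F x ξ) (F x η)) (by linarith)

variable [∀ x, IsManifold (𝓡 (dim x)) ∞ (E x)] [∀ x, T2Space (E x)]
  [∀ x, IsContMDiffRiemannianBundle (𝓡 (dim x)) 2
    (EuclideanSpace ℝ (Fin (dim x))) (fun ξ : E x ↦ TangentSpace (𝓡 (dim x)) ξ)]
  {r K : ℝ} {φ : ∀ x, E x → OpenPartialHomeomorph (E x) (EuclideanSpace ℝ (Fin (dim x)))}

/-- The iterates are approximated to second order by their differentials, uniformly on all the
fibers. -/
theorem exists_tangentNorm_chartLog_fiberIter_sub_le (hr : 0 < r) (hK : 1 ≤ K) (hL : 1 ≤ L)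
    (hφ : ∀ x ξ, IsBoundedChart (φ x ξ) r K ∧ ξ ∈ (φ x ξ).source ∧ φ x ξ ξ = 0)
    (hfin : ∀ x, ∀ ξ η : E x, riemannianEDist (𝓡 (dim x)) ξ η ≠ ⊤)
    (hFL : ∀ x ξ v, tangentNorm (F x ξ) (coordDeriv (k := dim x) (l := dim (f x)) (F x) ξ v) ≤
      L * tangentNorm ξ v)
    (hH : ∀ x, HessianBoundedBy (k := dim x) (l := dim (f x)) (F x) L) (n : ℕ) :
    ∃ C ρ : ℝ, 0 ≤ C ∧ 0 < ρ ∧ ∀ x, ∀ ξ η : E x, riemannianDist (dim x) ξ η < ρ →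
      tangentNorm (fiberIter f (fun x ↦ F x) n x ξ)
        (chartLog (φ _ (fiberIter f (fun x ↦ F x) n x ξ)) (fiberIter f (fun x ↦ F x) n x η) -
          coordDeriv (k := dim x) (l := dim (f^[n] x)) (fiberIter f (fun x ↦ F x) n x) ξ
            (chartLog (φ x ξ) η)) ≤ C * riemannianDist (dim x) ξ η ^ 2 := by
  induction n with
  | zero =>
    refine ⟨0, 1, le_rfl, one_pos, fun x ξ η _ => ?_⟩
    rw [zero_mul]
    have h : coordDeriv (k := dim x) (l := dim x) (id : E x → E x) ξ (chartLog (φ x ξ) η) =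
      chartLog (φ x ξ) η := coordDeriv_id ξ _
    change tangentNorm ξ (chartLog (φ x ξ) η -
      coordDeriv (k := dim x) (l := dim x) (id : E x → E x) ξ (chartLog (φ x ξ) η)) ≤ 0
    rw [h, sub_self]
    exact (norm_zero (E := TangentSpace (𝓡 (dim x)) ξ)).le
  | succ n ih =>
    obtain ⟨C, ρ, hC, hρ, h⟩ := ih
    set C₁ := √K * (√K * L * K + K * L * (2 * K ^ 2) + 2 * K ^ 2 * (K * L) ^ 2) * K with hC₁
    have hC₁0 : 0 ≤ C₁ := by positivity
    have hK' : 0 < √K := Real.sqrt_pos.2 (by linarith)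
    refine ⟨C * L ^ 2 + L ^ n * C₁, min (ρ / L) (r / (K * L) / √K), by positivity,
      lt_min (by positivity) (by positivity), fun x ξ η hξη => ?_⟩
    have h1 : L * riemannianDist (dim x) ξ η < ρ := by
      have := hξη.trans_le (min_le_left _ _)
      rwa [lt_div_iff₀ (by linarith), mul_comm] at this
    have h2 : √K * riemannianDist (dim x) ξ η < r / (K * L) := by
      have := hξη.trans_le (min_le_right _ _)
      rwa [lt_div_iff₀ hK', mul_comm] at this
    have hstep := tangentNorm_chartLog_sub_le (hφ x ξ).1 (hφ (f x) (F x ξ)).1 hK (F x).contMDiff hL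
      (hFL x) (hH x) (hφ x ξ).2.1 (hφ x ξ).2.2 (hφ (f x) (F x ξ)).2.1 (hφ (f x) (F x ξ)).2.2
      (hfin x ξ η) h2
    rw [← hC₁] at hstep
    have hLip := riemannianDist_comp_le ((F x).contMDiff.of_le (by norm_num)) (by linarith) (hFL x)
      (hfin x ξ η)
    have hn := h (f x) (F x ξ) (F x η) (hLip.trans_lt h1)
    have hd0 := riemannianDist_nonneg (k := dim x) ξ η
    have hd1 := riemannianDist_nonneg (k := dim (f x)) (F x ξ) (F x η)
    have hDn := tangentNorm_coordDeriv_fiberIter_le hL hFL n (f x) (F x ξ)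
      (chartLog (φ (f x) (F x ξ)) (F x η) - coordDeriv (k := dim x) (l := dim (f x)) (F x) ξ
        (chartLog (φ x ξ) η))
    rw [map_sub] at hDn
    rw [coordDeriv_fiberIter_succ]
    refine le_trans ?_ ((tangentNorm_add_le (fiberIter f (fun x ↦ F x) n (f x) (F x ξ)) _ _).trans
      (add_le_add hn (hDn.trans (mul_le_mul_of_nonneg_left hstep (by positivity))))) |>.trans ?_
    · rw [sub_add_sub_cancel]
      exact le_rfl
    · have : C * riemannianDist (dim (f x)) (F x ξ) (F x η) ^ 2 ≤
          C * (L * riemannianDist (dim x) ξ η) ^ 2 := by gcongr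
      nlinarith

/-- Points with close images under the iterate of order `n` are separated by at most the norm of the
inverse of the differential. -/
theorem exists_riemannianDist_le_norm_inverse_mul (hr : 0 < r) (hK : 1 ≤ K) (hL : 1 ≤ L)
    (hφ : ∀ x ξ, IsBoundedChart (φ x ξ) r K ∧ ξ ∈ (φ x ξ).source ∧ φ x ξ ξ = 0)
    (hfin : ∀ x, ∀ ξ η : E x, riemannianEDist (𝓡 (dim x)) ξ η ≠ ⊤)
    (hFL : ∀ x ξ v, tangentNorm (F x ξ) (coordDeriv (k := dim x) (l := dim (f x)) (F x) ξ v) ≤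
      L * tangentNorm ξ v)
    (hFL' : ∀ x (ξ : E x) (v : EuclideanSpace ℝ (Fin (dim x))), tangentNorm ξ v ≤
      L * tangentNorm (F x ξ) (coordDeriv (k := dim x) (l := dim (f x)) (F x) ξ v))
    (hH : ∀ x, HessianBoundedBy (k := dim x) (l := dim (f x)) (F x) L) (n : ℕ) :
    ∃ δ : ℝ, 0 < δ ∧ ∀ x, ∀ ξ η : E x,
      riemannianDist (dim (f^[n] x)) (fiberIter f (fun x ↦ F x) n x ξ)
        (fiberIter f (fun x ↦ F x) n x η) < δ →
      riemannianDist (dim x) ξ η ≤ 2 * K ^ 2 *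
        ‖(mfderiv (𝓡 (dim x)) (𝓡 (dim (f^[n] x))) (fiberIter f (fun x ↦ F x) n x) ξ).inverse‖ *
        riemannianDist (dim (f^[n] x)) (fiberIter f (fun x ↦ F x) n x ξ)
          (fiberIter f (fun x ↦ F x) n x η) := by
  obtain ⟨C, ρ, hC, hρ, h⟩ := exists_tangentNorm_chartLog_fiberIter_sub_le hr hK hL hφ hfin hFL hH n
  have hK0 : 0 < K := by linarith
  have hK' : 0 < √K := Real.sqrt_pos.2 hK0
  have hKK : √K * √K = K := Real.mul_self_sqrt hK0.le
  have hLn : 1 ≤ L ^ n := one_le_pow₀ hL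
  have hLn0 : 0 < L ^ n := by positivity
  refine ⟨min (ρ / L ^ n) (min (r / √K / L ^ n) (1 / (2 * K * L ^ n * L ^ n * (C + 1)))),
    by positivity, fun x ξ η hlt => ?_⟩
  set d := riemannianDist (dim x) ξ η with hd
  set ξn := fiberIter f (fun x ↦ F x) n x ξ with hξn
  set ηn := fiberIter f (fun x ↦ F x) n x η with hηn
  set dn := riemannianDist (dim (f^[n] x)) ξn ηn with hdn
  set A := mfderiv (𝓡 (dim x)) (𝓡 (dim (f^[n] x))) (fiberIter f (fun x ↦ F x) n x) ξ with hA
  have hdist : ∀ x ξ η, riemannianDist (dim x) ξ η ≤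
      L * riemannianDist (dim (f x)) (F x ξ) (F x η) := fun x ξ η =>
    riemannianDist_le_comp (F x) (by norm_num) (by linarith) (hFL' x) (hfin (f x) _ _)
  have hle : d ≤ L ^ n * dn := riemannianDist_le_fiberIter hL hdist n x ξ η
  have hd0 : 0 ≤ d := riemannianDist_nonneg _ _
  have hdn0 : 0 ≤ dn := riemannianDist_nonneg _ _
  have h1 : L ^ n * dn < ρ := by
    have := hlt.trans_le (min_le_left _ _)
    rwa [lt_div_iff₀ hLn0, mul_comm] at this
  have h2 : L ^ n * dn < r / √K := by
    have := hlt.trans_le ((min_le_right _ _).trans (min_le_left _ _))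
    rwa [lt_div_iff₀ hLn0, mul_comm] at this
  have h3 : 2 * K * L ^ n * (C + 1) * (L ^ n * dn) < 1 := by
    have := hlt.trans_le ((min_le_right _ _).trans (min_le_right _ _))
    rw [lt_div_iff₀ (by positivity)] at this
    linarith
  have h2' : ∀ a, a ≤ L ^ n * dn → √K * a < r := by
    intro a ha
    have := ha.trans_lt h2
    rwa [lt_div_iff₀ hK', mul_comm] at this
  obtain ⟨hφ1, hφ2, hφ3⟩ := hφ x ξ
  obtain ⟨hψ1, hψ2, hψ3⟩ := hφ _ ξn
  obtain ⟨hs, -⟩ := hφ1.mem_source_of_riemannianDist_lt hK0 hφ2 hφ3 (hfin x ξ η) (h2' d hle)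
  obtain ⟨-, hsn⟩ := hψ1.mem_source_of_riemannianDist_lt hK0 hψ2 hψ3 (hfin _ ξn ηn)
    (h2' dn (le_mul_of_one_le_left hdn0 hLn))
  have hlog := h x ξ η (hle.trans_lt h1)
  set v := chartLog (φ x ξ) η with hv
  set vn := chartLog (φ _ ξn) ηn with hvn
  set D := coordDeriv (k := dim x) (l := dim (f^[n] x)) (fiberIter f (fun x ↦ F x) n x) ξ with hD
  have e1 : d ≤ √K * ‖φ x ξ η‖ := hφ1.riemannianDist_le hK0.le hφ2 hφ3 hs
  have e2 : ‖φ x ξ η‖ ≤ √K * tangentNorm ξ v := hφ1.norm_le_tangentNorm_chartLog hK0 hφ2 hφ3 η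
  have e3 : tangentNorm ξ v ≤ ‖A.inverse‖ * tangentNorm ξn (D v) :=
    tangentNorm_le_norm_inverse_mul (isInvertible_mfderiv_fiberIter n x ξ) v
  have e4 : tangentNorm ξn (D v) ≤ tangentNorm ξn vn + tangentNorm ξn (vn - D v) := by
    have e : D v = vn - (vn - D v) := by abel
    conv_lhs => rw [e]
    exact norm_sub_le (E := TangentSpace (𝓡 (dim (f^[n] x))) ξn) vn (vn - D v)
  have e5 : tangentNorm ξn vn ≤ √K * (√K * dn) :=
    (hψ1.tangentNorm_chartLog_le hK0.le hψ2 hψ3 ηn).trans (by gcongr)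
  have e6 : ‖A.inverse‖ ≤ L ^ n := norm_inverse_mfderiv_fiberIter_le hL hFL' n x ξ
  have ha0 : 0 ≤ ‖A.inverse‖ := A.inverse.opNorm_nonneg
  set a := ‖A.inverse‖ with ha
  have e7 : d ≤ K * (a * (K * dn + C * d ^ 2)) := by
    calc d ≤ √K * (√K * (a * (√K * (√K * dn) + C * d ^ 2))) := by
          refine e1.trans (mul_le_mul_of_nonneg_left (e2.trans (mul_le_mul_of_nonneg_left
            (e3.trans (mul_le_mul_of_nonneg_left (e4.trans (add_le_add e5 hlog)) ha0)) hK'.le))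
            hK'.le)
      _ = (√K * √K) * (a * ((√K * √K) * dn + C * d ^ 2)) := by ring
      _ = _ := by rw [hKK]
  have e8 : K * (a * (C * d ^ 2)) ≤ d / 2 := by
    have : 2 * K * a * C * d ≤ 1 := by
      calc 2 * K * a * C * d ≤ 2 * K * L ^ n * (C + 1) * (L ^ n * dn) := by
            gcongr
            linarith
        _ ≤ 1 := h3.le
    have h5 := mul_le_mul_of_nonneg_right this hd0
    nlinarith
  nlinarith

end Iterates

/-! ### Nets -/

section Nets

variable {V : Type*} [NormedAddCommGroup V] [NormedSpace ℝ V] [FiniteDimensional ℝ V]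

theorem exists_net_ball {ρ : ℝ} (hρ : 0 < ρ) (R : ℝ) :
    ∃ T : Finset V, ∀ u ∈ Metric.ball (0 : V) R, ∃ t ∈ T, ‖u - t‖ < ρ := by
  obtain ⟨T, -, hT, h⟩ := (isCompact_closedBall (0 : V) R).finite_cover_balls hρ
  refine ⟨hT.toFinset, fun u hu => ?_⟩
  obtain ⟨t, ht, hut⟩ := Set.mem_iUnion₂.1 (h (Metric.ball_subset_closedBall hu))
  exact ⟨t, hT.mem_toFinset.2 ht, by rwa [mem_ball_iff_norm] at hut⟩

open Classical in
/-- Nets of a ball of a finite-dimensional space are refined by scaled copies of a net of the unit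
ball, so that their cardinality grows exponentially. -/
theorem exists_nets_ball {ρ : ℝ} (hρ : 0 < ρ) (R : ℝ) :
    ∃ C Q : ℕ, ∀ k : ℕ, ∃ T : Finset V, T.card ≤ C * Q ^ k ∧
      ∀ u ∈ Metric.ball (0 : V) R, ∃ t ∈ T, ‖u - t‖ < ρ * (1 / 2) ^ k := by
  obtain ⟨A, hA⟩ := exists_net_ball (V := V) (ρ := 1 / 2) (by norm_num) 1
  obtain ⟨T₀, hT₀⟩ := exists_net_ball (V := V) hρ R
  refine ⟨T₀.card, A.card, fun k => ?_⟩
  induction k with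
  | zero => exact ⟨T₀, by simp, by simpa using hT₀⟩
  | succ k ih =>
    obtain ⟨T, hT, h⟩ := ih
    set s := ρ * (1 / 2) ^ k with hs
    have hs0 : 0 < s := by positivity
    refine ⟨Finset.image₂ (fun t a => t + s • a) T A, ?_, fun u hu => ?_⟩
    · refine (Finset.card_image₂_le _ _ _).trans ?_
      rw [pow_succ, ← mul_assoc]
      exact Nat.mul_le_mul_right _ hT
    · obtain ⟨t, ht, hut⟩ := h u hu
      obtain ⟨a, ha, hwa⟩ := hA (s⁻¹ • (u - t)) (by
        rw [mem_ball_zero_iff, norm_smul, norm_inv, Real.norm_of_nonneg hs0.le,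
          inv_mul_lt_iff₀ hs0]
        simpa using hut)
      refine ⟨t + s • a, Finset.mem_image₂_of_mem ht ha, ?_⟩
      have e : u - (t + s • a) = s • (s⁻¹ • (u - t) - a) := by
        rw [smul_sub, smul_inv_smul₀ hs0.ne']
        abel
      rw [e, norm_smul, Real.norm_of_nonneg hs0.le, pow_succ, ← mul_assoc, ← hs]
      exact mul_lt_mul_of_pos_left hwa hs0

open Classical in
theorem exists_nets_ball_subset {ρ : ℝ} (hρ : 0 < ρ) (R : ℝ) :
    ∃ C Q : ℕ, ∀ k : ℕ, ∃ T : Finset V, T.card ≤ C * Q ^ k ∧ ↑T ⊆ Metric.ball (0 : V) R ∧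
      ∀ u ∈ Metric.ball (0 : V) R, ∃ t ∈ T, ‖u - t‖ < ρ * (1 / 2) ^ k := by
  obtain ⟨C, Q, h⟩ := exists_nets_ball (V := V) (half_pos hρ) R
  refine ⟨C, Q, fun k => ?_⟩
  obtain ⟨T, hT, hnet⟩ := h k
  choose! g hg using fun (t : V)
    (ht : ∃ s ∈ Metric.ball (0 : V) R, ‖s - t‖ < ρ / 2 * (1 / 2) ^ k) => ht
  refine ⟨(T.filter fun t => ∃ s ∈ Metric.ball (0 : V) R, ‖s - t‖ < ρ / 2 * (1 / 2) ^ k).image g,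
    (Finset.card_image_le.trans (Finset.card_filter_le _ _)).trans hT, ?_, fun u hu => ?_⟩
  · intro s hs
    simp only [Finset.coe_image, Set.mem_image, Finset.mem_coe, Finset.mem_filter] at hs
    obtain ⟨t, ⟨-, ht⟩, rfl⟩ := hs
    exact (hg t ht).1
  · obtain ⟨t, ht, hut⟩ := hnet u hu
    have hex : ∃ s ∈ Metric.ball (0 : V) R, ‖s - t‖ < ρ / 2 * (1 / 2) ^ k := ⟨u, hu, hut⟩
    refine ⟨g t, Finset.mem_image_of_mem g (Finset.mem_filter.2 ⟨ht, hex⟩), ?_⟩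
    have h1 := norm_sub_le_norm_sub_add_norm_sub u t (g t)
    have h2 := (hg t hex).2
    rw [norm_sub_rev] at h2
    linarith

open Classical in
/-- A compact space which is locally parametrized in a Lipschitz way by balls of a
finite-dimensional space has nets whose cardinality grows exponentially. -/
theorem exists_nets_of_lipschitz_charts {Y : Type*} [TopologicalSpace Y] [CompactSpace Y]
    (D : Y → Y → ℝ) (c : Y → OpenPartialHomeomorph Y V) {R B : ℝ} (hB : 0 < B) (hc : ∀ y, y ∈ (c y).source)
    (hct : ∀ y, (c y).target = Metric.ball 0 R)
    (hlip : ∀ y, ∀ u ∈ Metric.ball (0 : V) R, ∀ v ∈ Metric.ball (0 : V) R,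
      D ((c y).symm u) ((c y).symm v) ≤ B * ‖u - v‖) :
    ∃ C Q : ℝ, ∀ k : ℕ, ∃ S : Finset Y, (S.card : ℝ) ≤ C * Q ^ k ∧
      ∀ y, ∃ s ∈ S, D y s < (1 / 2) ^ k := by
  obtain ⟨J, -, hJ⟩ := isCompact_univ.elim_nhds_subcover (fun y : Y => (c y).source)
    fun y _ => (c y).open_source.mem_nhds (hc y)
  obtain ⟨C, Q, h⟩ := exists_nets_ball_subset (V := V) (inv_pos.2 hB) R
  refine ⟨J.card * C, Q, fun k => ?_⟩
  obtain ⟨T, hT, hTs, hnet⟩ := h k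
  refine ⟨Finset.image₂ (fun j t => (c j).symm t) J T, ?_, fun y => ?_⟩
  · rw [mul_assoc]
    have := (Finset.card_image₂_le (fun j t => (c j).symm t) J T).trans (Nat.mul_le_mul_left _ hT)
    exact_mod_cast this
  · obtain ⟨j, hj, hy⟩ := Set.mem_iUnion₂.1 (hJ (Set.mem_univ y))
    have hu : c j y ∈ Metric.ball (0 : V) R := hct j ▸ (c j).map_source hy
    obtain ⟨t, ht, hut⟩ := hnet _ hu
    refine ⟨(c j).symm t, Finset.mem_image₂_of_mem hj ht, ?_⟩
    have h1 := hlip j _ hu t (hTs ht)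
    rw [(c j).left_inv hy] at h1
    refine h1.trans_lt ?_
    calc B * ‖c j y - t‖ < B * (B⁻¹ * (1 / 2) ^ k) := mul_lt_mul_of_pos_left hut hB
      _ = _ := by rw [mul_inv_cancel_left₀ hB.ne']

end Nets

/-! ### Charts of the fibers and distances on the models -/

section Transport

open Manifold

variable {k : ℕ}
  {M : Type*} [TopologicalSpace M] [ChartedSpace (EuclideanSpace ℝ (Fin k)) M]
  [RiemannianBundle (fun ξ : M ↦ TangentSpace (𝓡 k) ξ)]

theorem MetricC2Bounded.mono {σ : EuclideanSpace ℝ (Fin k) → M} {r K K' : ℝ}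
    (h : MetricC2Bounded σ r K) (hK : 0 < K) (hKK' : K ≤ K') : MetricC2Bounded σ r K' := by
  refine fun u hu v w => ⟨le_trans ?_ (h u hu v w).1, fun j hj => ((h u hu v w).2 j hj).trans ?_⟩
  · gcongr
  · gcongr

theorem HessianBoundedBy.mono {l : ℕ} {M' : Type*} [TopologicalSpace M']
    [ChartedSpace (EuclideanSpace ℝ (Fin l)) M']
    [RiemannianBundle (fun ξ : M' ↦ TangentSpace (𝓡 l) ξ)] {F : M → M'} {C C' : ℝ}
    (h : HessianBoundedBy (k := k) (l := l) F C) (hC : C ≤ C') :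
    HessianBoundedBy (k := k) (l := l) F C' := by
  intro φ hφ ψ hψ u hu hF G v w γ γ' hγ hγ'
  refine (h φ hφ ψ hψ u hu hF v w γ γ' hγ hγ').trans ?_
  gcongr

end Transport

section PullbackChart

open Manifold

variable {k : ℕ}
  {M : Type*} [TopologicalSpace M] [ChartedSpace (EuclideanSpace ℝ (Fin k)) M]
  {N : Type*} [TopologicalSpace N] [ChartedSpace (EuclideanSpace ℝ (Fin k)) N] {r K : ℝ}

/-- The chart of `M` that corresponds to a chart of `N` under the diffeomorphism `τ`. -/
noncomputable def pullbackChart (τ : M ≃ₘ^∞⟮𝓡 k, 𝓡 k⟯ N)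
    (c : OpenPartialHomeomorph N (EuclideanSpace ℝ (Fin k))) :
    OpenPartialHomeomorph M (EuclideanSpace ℝ (Fin k)) :=
  τ.toHomeomorph.toOpenPartialHomeomorph ≫ₕ c

variable (τ : M ≃ₘ^∞⟮𝓡 k, 𝓡 k⟯ N) {c : OpenPartialHomeomorph N (EuclideanSpace ℝ (Fin k))}

theorem mem_pullbackChart_source {x : M} (hx : τ x ∈ c.source) : x ∈ (pullbackChart τ c).source :=
  ⟨Set.mem_univ x, hx⟩

variable [RiemannianBundle (fun ξ : M ↦ TangentSpace (𝓡 k) ξ)]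

theorem isBoundedChart_pullbackChart [IsManifold (𝓡 k) ∞ M] [IsManifold (𝓡 k) ∞ N]
    (hc : c ∈ IsManifold.maximalAtlas (𝓡 k) ∞ N)
    (hct : c.target = Metric.ball 0 r)
    (h : MetricC2Bounded (k := k) (fun u ↦ τ.symm (c.symm u)) r K) :
    IsBoundedChart (pullbackChart τ c) r K := by
  have ht : (pullbackChart τ c).target = c.target := by
    ext u
    simp [pullbackChart]
  refine ⟨?_, ht.trans hct, h⟩
  obtain ⟨h1, h2⟩ := (IsManifold.mem_maximalAtlas_iff_contMDiffOn c).1 hc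
  refine OpenPartialHomeomorph.mem_maximalAtlas_of_contMDiffOn _
    (h1.comp τ.contMDiff.contMDiffOn fun x hx => hx.2) ?_
  rw [ht]
  exact τ.symm.contMDiff.comp_contMDiffOn h2

variable {M' : Type*} [TopologicalSpace M'] [ChartedSpace (EuclideanSpace ℝ (Fin k)) M']
  [RiemannianBundle (fun ξ : M' ↦ TangentSpace (𝓡 k) ξ)]

/-- Two metrics on a manifold which are uniformly comparable to the Euclidean ones in the same
charts are comparable. -/
theorem riemannianDist_symm_comp_le (τ : M ≃ₘ^∞⟮𝓡 k, 𝓡 k⟯ N) (τ' : M' ≃ₘ^∞⟮𝓡 k, 𝓡 k⟯ N)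
    (c : N → OpenPartialHomeomorph N (EuclideanSpace ℝ (Fin k))) (hK : 0 < K)
    (hcs : ∀ y, y ∈ (c y).source)
    (h : ∀ y, IsBoundedChart (pullbackChart τ (c y)) r K)
    (h' : ∀ y, IsBoundedChart (pullbackChart τ' (c y)) r K)
    {ξ η : M} (hfin : riemannianEDist (𝓡 k) ξ η ≠ ⊤) :
    riemannianDist k (τ'.symm (τ ξ)) (τ'.symm (τ η)) ≤ K * riemannianDist k ξ η := by
  set G : M → M' := τ'.symm ∘ τ with hG
  have hGs : ContMDiff (𝓡 k) (𝓡 k) ∞ G := τ'.symm.contMDiff.comp τ.contMDiff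
  refine riemannianDist_comp_le (F := G) (hGs.of_le (by norm_cast)) hK.le (fun x v => ?_) hfin
  have hx : x ∈ (pullbackChart τ (c (τ x))).source := mem_pullbackChart_source τ (hcs (τ x))
  set φ := pullbackChart τ (c (τ x)) with hφ
  set φ' := pullbackChart τ' (c (τ x)) with hφ'
  have hφx : φ x ∈ Metric.ball (0 : EuclideanSpace ℝ (Fin k)) r := (h (τ x)).mem_ball hx
  have e1 : φ'.symm ∘ φ =ᶠ[𝓝 x] G := by
    filter_upwards [φ.open_source.mem_nhds hx] with y hy
    have hy' : τ y ∈ (c (τ x)).source := hy.2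
    change τ'.symm ((c (τ x)).symm (c (τ x) (τ y))) = τ'.symm (τ y)
    rw [(c (τ x)).left_inv hy']
  have e2 : coordDeriv (k := k) (l := k) (φ'.symm ∘ φ) x v =
      coordDeriv (k := k) (l := k) φ'.symm (φ x) (coordDeriv (k := k) (l := k) φ x v) :=
    coordDeriv_comp ((h' (τ x)).mdifferentiableAt_symm hφx) ((h (τ x)).mdifferentiableAt hx) v
  have e3 : coordDeriv (k := k) (l := k) G x v = coordDeriv (k := k) (l := k) (φ'.symm ∘ φ) x v :=
    congr($(e1.symm.mfderiv_eq (I := 𝓡 k) (I' := 𝓡 k)) v)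
  have e4 := (h' (τ x)).norm_mfderiv_symm_le hK.le hφx (coordDeriv (k := k) (l := k) φ x v)
  have e5 : φ'.symm (φ x) = G x := e1.self_of_nhds
  rw [← hφ', e5] at e4
  have e6 := (h (τ x)).norm_mfderiv_le hK hx v
  rw [e3, e2]
  refine e4.trans ?_
  calc √K * ‖coordDeriv (k := k) (l := k) φ x v‖ ≤ √K * (√K * tangentNorm x v) := by
        gcongr
        exact e6
    _ = _ := by rw [← mul_assoc, Real.mul_self_sqrt hK.le]

end PullbackChart

section ModelMetric

open Manifold

/-- A compact manifold carries the distance of a Riemannian metric on a diffeomorphic manifold. -/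
theorem exists_metricSpace_dist_eq {k : ℕ}
    {M : Type*} [TopologicalSpace M] [T2Space M] [CompactSpace M]
    [ChartedSpace (EuclideanSpace ℝ (Fin k)) M] [IsManifold (𝓡 k) ∞ M]
    [RiemannianBundle (fun ξ : M ↦ TangentSpace (𝓡 k) ξ)]
    [IsContMDiffRiemannianBundle (𝓡 k) 2 (EuclideanSpace ℝ (Fin k))
      (fun ξ : M ↦ TangentSpace (𝓡 k) ξ)]
    {N : Type*} [t : TopologicalSpace N] (τ : M ≃ₜ N)
    (hfin : ∀ ξ η : M, riemannianEDist (𝓡 k) ξ η ≠ ⊤) :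
    ∃ d : MetricSpace N, d.toUniformSpace.toTopologicalSpace = t ∧
      ∀ a b, dist a b = riemannianDist k (τ.symm a) (τ.symm b) := by
  have : IsManifold (𝓡 k) 1 M := IsManifold.of_le (n := ∞) (by norm_cast)
  obtain ⟨g, hg, hgi⟩ := IsContMDiffRiemannianBundle.exists_contMDiff (IB := 𝓡 k) (n := 2)
    (F := EuclideanSpace ℝ (Fin k)) (E := fun ξ : M ↦ TangentSpace (𝓡 k) ξ)
  have : IsContinuousRiemannianBundle (EuclideanSpace ℝ (Fin k))
      (fun ξ : M ↦ TangentSpace (𝓡 k) ξ) := ⟨g, hg.continuous, hgi⟩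
  let e : EMetricSpace M := EMetricSpace.ofRiemannianMetric (𝓡 k) M
  let d : MetricSpace M := EMetricSpace.toMetricSpace hfin
  refine ⟨MetricSpace.induced τ.symm τ.symm.injective d, τ.symm.isInducing.eq_induced.symm,
    fun a b => rfl⟩

variable {X : Type*} {N : ℕ → Type*} {dim : ℕ → ℕ} {idx : X → ℕ} {E : X → Type*}
  [∀ i, TopologicalSpace (N i)] [∀ i, ChartedSpace (EuclideanSpace ℝ (Fin (dim i))) (N i)]

/-- The comparison of two fibers with the same model. The indices of the fibers are equal only
propositionally, so that a point of the model `N i` is identified with a point of `N j` by a cast. -/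
theorem riemannianDist_cast_le {i j : ℕ} (hij : i = j)
    {M : Type*} [TopologicalSpace M] [ChartedSpace (EuclideanSpace ℝ (Fin (dim i))) M]
    [RiemannianBundle (fun ξ : M ↦ TangentSpace (𝓡 (dim i)) ξ)]
    {M' : Type*} [TopologicalSpace M'] [ChartedSpace (EuclideanSpace ℝ (Fin (dim j))) M']
    [RiemannianBundle (fun ξ : M' ↦ TangentSpace (𝓡 (dim j)) ξ)]
    (c : ∀ i, N i → OpenPartialHomeomorph (N i) (EuclideanSpace ℝ (Fin (dim i))))
    (hcs : ∀ i, ∀ y : N i, y ∈ (c i y).source) {r K : ℝ} (hK : 0 < K)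
    (τ : M ≃ₘ^∞⟮𝓡 (dim i), 𝓡 (dim i)⟯ N i) (τ' : M' ≃ₘ^∞⟮𝓡 (dim j), 𝓡 (dim j)⟯ N j)
    (h : ∀ y, IsBoundedChart (pullbackChart τ (c i y)) r K)
    (h' : ∀ y, IsBoundedChart (pullbackChart τ' (c j y)) r K)
    (hfin : ∀ ξ η : M, riemannianEDist (𝓡 (dim i)) ξ η ≠ ⊤)
    (hfin' : ∀ ξ η : M', riemannianEDist (𝓡 (dim j)) ξ η ≠ ⊤) (ξ η : M) :
    riemannianDist (dim j) (τ'.symm (cast (congrArg N hij) (τ ξ)))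
      (τ'.symm (cast (congrArg N hij) (τ η))) ≤ K * riemannianDist (dim i) ξ η ∧
    riemannianDist (dim i) ξ η ≤ K * riemannianDist (dim j)
      (τ'.symm (cast (congrArg N hij) (τ ξ))) (τ'.symm (cast (congrArg N hij) (τ η))) := by
  subst hij
  refine ⟨riemannianDist_symm_comp_le τ τ' (c i) hK (hcs i) h h' (hfin ξ η), ?_⟩
  have := riemannianDist_symm_comp_le τ' τ (c i) hK (hcs i) h' h
    (hfin' (τ'.symm (τ ξ)) (τ'.symm (τ η)))
  simpa using this

variable [∀ i, T2Space (N i)] [∀ i, CompactSpace (N i)]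
  [∀ x, TopologicalSpace (E x)] [∀ x, T2Space (E x)] [∀ x, CompactSpace (E x)]
  [∀ x, ChartedSpace (EuclideanSpace ℝ (Fin (dim (idx x)))) (E x)]
  [∀ x, IsManifold (𝓡 (dim (idx x))) ∞ (E x)]
  [∀ x, RiemannianBundle (fun ξ : E x ↦ TangentSpace (𝓡 (dim (idx x))) ξ)]
  [∀ x, IsContMDiffRiemannianBundle (𝓡 (dim (idx x))) 2
    (EuclideanSpace ℝ (Fin (dim (idx x)))) (fun ξ : E x ↦ TangentSpace (𝓡 (dim (idx x))) ξ)]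

/-- The models carry distances to which the Riemannian distances of all the fibers are
comparable. -/
theorem exists_metricSpace_models
    (τ : ∀ x, E x ≃ₘ^∞⟮𝓡 (dim (idx x)), 𝓡 (dim (idx x))⟯ N (idx x))
    (c : ∀ i, N i → OpenPartialHomeomorph (N i) (EuclideanSpace ℝ (Fin (dim i))))
    (hcs : ∀ i, ∀ y : N i, y ∈ (c i y).source) {r K : ℝ} (hK : 0 < K)
    (h : ∀ x y, IsBoundedChart (pullbackChart (τ x) (c (idx x) y)) r K)
    (hfin : ∀ x, ∀ ξ η : E x, riemannianEDist (𝓡 (dim (idx x))) ξ η ≠ ⊤) :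
    ∃ d : ∀ i, MetricSpace (N i),
      (fun i => (d i).toUniformSpace.toTopologicalSpace) = ‹∀ i, TopologicalSpace (N i)› ∧
      ∀ x ξ η, (d (idx x)).dist (τ x ξ) (τ x η) ≤ K * riemannianDist (dim (idx x)) ξ η ∧
        riemannianDist (dim (idx x)) ξ η ≤ K * (d (idx x)).dist (τ x ξ) (τ x η) := by
  have key : ∀ i, ∃ d : MetricSpace (N i),
      d.toUniformSpace.toTopologicalSpace = ‹∀ i, TopologicalSpace (N i)› i ∧
      ∀ x (hx : idx x = i) ξ η,
        d.dist (cast (congrArg N hx) (τ x ξ)) (cast (congrArg N hx) (τ x η)) ≤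
          K * riemannianDist (dim (idx x)) ξ η ∧
        riemannianDist (dim (idx x)) ξ η ≤
          K * d.dist (cast (congrArg N hx) (τ x ξ)) (cast (congrArg N hx) (τ x η)) := by
    intro i
    by_cases hi : ∃ y, idx y = i
    · obtain ⟨y, rfl⟩ := hi
      obtain ⟨d, hd, hdist⟩ := exists_metricSpace_dist_eq (k := dim (idx y)) (τ y).toHomeomorph
        (hfin y)
      refine ⟨d, hd, fun x hx ξ η => ?_⟩
      have e := hdist (cast (congrArg N hx) (τ x ξ)) (cast (congrArg N hx) (τ x η))
      have := riemannianDist_cast_le hx c hcs hK (τ x) (τ y) (h x) (h y) (hfin x) (hfin y) ξ η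
      change d.dist _ _ = _ at e
      rw [e]
      exact this
    · have : TopologicalSpace.MetrizableSpace (N i) := Manifold.metrizableSpace (𝓡 (dim i)) (N i)
      exact ⟨TopologicalSpace.metrizableSpaceMetric (N i), rfl, fun x hx => absurd ⟨x, hx⟩ hi⟩
  choose d hd hdist using key
  exact ⟨d, funext hd, fun x => hdist (idx x) x rfl⟩

end ModelMetric

/-! ### Lower exponents and the conclusion -/

section Models

variable {X : Type*} {N : ℕ → Type*} {idx : X → ℕ} {E : X → Type*} [∀ x, TopologicalSpace (E x)]
  [∀ i, TopologicalSpace (N i)] [∀ i, CompactSpace (N i)]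
  {𝓑 : MeasurableSpace X} [𝓐 : MeasurableSpace X] {m : Measure X}
  [∀ x, MeasurableSpace (E x)] [∀ x, BorelSpace (E x)]

/-- The metric form of the invariance principle for models that are topological spaces, with
distances that are not part of their structure. -/
theorem exists_measurableFamily_of_subexponential_contraction_dist
    [IsProbabilityMeasure m] (f : X ≃ᵐ X) (hf : MeasurePreserving f m m)
    (τ : ∀ x, E x ≃ₜ N (idx x)) (F : ∀ x, E x → E (f x)) (hF : ∀ x, Continuous (F x))
    (M : @Measure (FiberTotal E) (totalSigma 𝓐 fun x ↦ τ x))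
    (hM : @MeasurePreserving _ _ (totalSigma 𝓐 fun x ↦ τ x) (totalSigma 𝓐 fun x ↦ τ x)
      (bundleMap f F) M M)
    (hMm : ∀ A : Set X, MeasurableSet A → M {p | p.base ∈ A} = m A)
    (Mx : ∀ x, Measure (E x)) (hMx : IsDisintegration m M Mx)
    (h𝓑 : 𝓑 ≤ 𝓐) (hnoninc : FinerMod0 𝓑 (𝓑.comap f) m)
    (hgen : FinerMod0 (⨆ k : ℤ, 𝓑.comap ((f.toEquiv ^ k : Equiv.Perm X) : X → X)) 𝓐 m)
    (hidx : Measurable[𝓑] idx)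
    (hF𝓑 : Measurable[totalSigma 𝓑 fun x ↦ τ x, borel (Σ i, N i)]
      fun p : FiberTotal E ↦ (coord (fun x ↦ τ x) (bundleMap f F p)).2)
    (d : ∀ i, MetricSpace (N i))
    (hd : (fun i => (d i).toUniformSpace.toTopologicalSpace) = ‹∀ i, TopologicalSpace (N i)›)
    {Λ : ℝ} (hΛ : 1 ≤ Λ)
    (hlip : ∀ x ξ η, (d _).dist (τ x ξ) (τ x η) ≤
      Λ * (d _).dist (τ (f x) (F x ξ)) (τ (f x) (F x η)))
    {δ : ℕ → ℝ} (hδ : ∀ n, 0 < δ n)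
    (hexp : ∀ θ > 0, ∀ᵐ p ∂M, ∀ᶠ n : ℕ in atTop, ∀ η : E p.base,
      (d _).dist (τ _ (fiberIter f F n p.base p.point)) (τ _ (fiberIter f F n p.base η)) < δ n →
      (d _).dist (τ _ p.point) (τ _ η) ≤ Real.exp (θ * n) *
        (d _).dist (τ _ (fiberIter f F n p.base p.point)) (τ _ (fiberIter f F n p.base η)))
    (hnet : ∀ i ∈ Set.range idx, ∃ C Q : ℝ, ∀ k : ℕ, ∃ S : Finset (N i), (S.card : ℝ) ≤ C * Q ^ k ∧
      ∀ y, ∃ s ∈ S, (d i).dist y s < (1 / 2) ^ k) :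
    ∃ κ : ∀ x, Measure (E x),
      MeasurableFamily 𝓑 (totalSigma 𝓑 fun x ↦ τ x) κ ∧ ∀ᵐ x ∂m, Mx x = κ x := by
  subst hd
  exact exists_measurableFamily_of_subexponential_contraction f hf τ F hF M hM hMm Mx hMx h𝓑
    hnoninc hgen hidx hF𝓑 hΛ hlip hδ hexp hnet

end Models

/-- At a point with non-negative lower exponent the inverses of the differentials of the iterates
grow subexponentially. -/
theorem eventually_norm_inverse_mfderiv_fiberIter_le {X : Type*} {dim : X → ℕ} {E : X → Type*}
    [∀ x, TopologicalSpace (E x)] [∀ x, ChartedSpace (EuclideanSpace ℝ (Fin (dim x))) (E x)]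
    [∀ x, RiemannianBundle (fun ξ : E x ↦ TangentSpace (𝓡 (dim x)) ξ)]
    {f : X → X} {F : ∀ x, E x → E (f x)} {p : FiberTotal E} {L : ℝ} (hL : 1 ≤ L)
    (hle : ∀ n : ℕ, ‖(mfderiv (𝓡 (dim p.base)) (𝓡 (dim (f^[n] p.base)))
        (fiberIter f F n p.base) p.point).inverse‖ ≤ L ^ n)
    (hp : 0 ≤ lowerExponent dim f F p) {θ : ℝ} (hθ : 0 < θ) :
    ∀ᶠ n : ℕ in atTop, ‖(mfderiv (𝓡 (dim p.base)) (𝓡 (dim (f^[n] p.base)))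
        (fiberIter f F n p.base) p.point).inverse‖ ≤ Real.exp (θ * n) := by
  have h0 := neg_nonneg.1 hp
  have hbdd : IsBoundedUnder (· ≤ ·) atTop (fun n : ℕ ↦ (1 / (n : ℝ)) * Real.log
      ‖(mfderiv (𝓡 (dim p.base)) (𝓡 (dim (f^[n] p.base)))
        (fiberIter f F n p.base) p.point).inverse‖) := by
    refine isBoundedUnder_of ⟨Real.log L, fun n => ?_⟩
    set a := ‖(mfderiv (𝓡 (dim p.base)) (𝓡 (dim (f^[n] p.base)))
        (fiberIter f F n p.base) p.point).inverse‖ with ha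
    have ha0 : 0 ≤ a := ContinuousLinearMap.opNorm_nonneg _
    have hlog : 0 ≤ Real.log L := Real.log_nonneg hL
    rcases Nat.eq_zero_or_pos n with hn | hn
    · simpa [hn] using hlog
    rcases ha0.eq_or_lt with h | h
    · simpa [← h] using hlog
    have h1 := Real.log_le_log h (hle n)
    rw [Real.log_pow] at h1
    rw [one_div, inv_mul_le_iff₀ (by positivity)]
    exact h1
  filter_upwards [eventually_lt_of_limsup_lt (h0.trans_lt hθ) hbdd, eventually_gt_atTop 0]
    with n hn hn0
  refine (Real.le_exp_log _).trans (Real.exp_le_exp.2 ?_)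
  have hn0' : (0 : ℝ) < n := by exact_mod_cast hn0
  rw [one_div, inv_mul_lt_iff₀ hn0'] at hn
  rw [mul_comm]
  exact hn.le

/-- The comparison between the Riemannian distances and the distances of the models costs a factor
`K` at each end, which is absorbed into the exponential. -/
theorem le_exp_mul_of_le {K a t s D θ n : ℝ} (hK : 0 ≤ K) (h : t ≤ 2 * K ^ 2 * a * s)
    (hs : s ≤ K * D) (ha0 : 0 ≤ a) (ha : a ≤ Real.exp (θ / 2 * n))
    (hKn : 2 * K ^ 4 ≤ Real.exp (θ / 2 * n)) (hD : 0 ≤ D) : K * t ≤ Real.exp (θ * n) * D := by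
  have h1 : K * t ≤ K * (2 * K ^ 2 * a * (K * D)) := by gcongr; exact h.trans (by gcongr)
  have h2 : 2 * K ^ 4 * a ≤ Real.exp (θ / 2 * n) * Real.exp (θ / 2 * n) := by gcongr
  rw [← Real.exp_add, ← add_mul, add_halves] at h2
  calc K * t ≤ 2 * K ^ 4 * a * D := h1.trans (le_of_eq (by ring))
    _ ≤ _ := by gcongr

end InvariancePrinciple

theorem theorem3p1
    {X : Type*} (𝓑 : MeasurableSpace X) [𝓐 : MeasurableSpace X]
    (m : Measure X) [IsProbabilityMeasure m]
    -- the ergodic invertible base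
    (f : X ≃ᵐ X) (hf : Ergodic f m)
    -- the models of the fibers
    (N : ℕ → Type*) (dim : ℕ → ℕ)
    [∀ i, TopologicalSpace (N i)] [∀ i, T2Space (N i)] [∀ i, CompactSpace (N i)]
    [∀ i, ChartedSpace (EuclideanSpace ℝ (Fin (dim i))) (N i)]
    [∀ i, IsManifold (𝓡 (dim i)) ∞ (N i)]
    -- the fibers: compact Riemannian manifolds with metrics of class `C²`
    (idx : X → ℕ) (E : X → Type*)
    [∀ x, TopologicalSpace (E x)] [∀ x, T2Space (E x)] [∀ x, CompactSpace (E x)]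
    [∀ x, ChartedSpace (EuclideanSpace ℝ (Fin (dim (idx x)))) (E x)]
    [∀ x, IsManifold (𝓡 (dim (idx x))) ∞ (E x)]
    [∀ x, RiemannianBundle (fun ξ : E x ↦ TangentSpace (𝓡 (dim (idx x))) ξ)]
    [∀ x, IsContMDiffRiemannianBundle (𝓡 (dim (idx x))) 2
      (EuclideanSpace ℝ (Fin (dim (idx x)))) (fun ξ : E x ↦ TangentSpace (𝓡 (dim (idx x))) ξ)]
    [∀ x, MeasurableSpace (E x)] [∀ x, BorelSpace (E x)]
    -- the trivialization of the bundle
    (τ : ∀ x, E x ≃ₘ^∞⟮𝓡 (dim (idx x)), 𝓡 (dim (idx x))⟯ N (idx x))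
    -- dimensions and diameters of the fibers are bounded
    (dmax : ℕ) (hdim : ∀ x, dim (idx x) ≤ dmax)
    (diam : ℝ≥0) (hdiam : ∀ x, ∀ ξ η : E x, Manifold.riemannianEDist (𝓡 (dim (idx x))) ξ η ≤ diam)
    -- the `C²` norms of the metrics are uniformly bounded
    (r : ℝ) (hr : 0 < r) (K : ℝ) (hK : 0 < K)
    (c : ∀ i, N i → OpenPartialHomeomorph (N i) (EuclideanSpace ℝ (Fin (dim i))))
    (hc : ∀ i, ∀ η : N i, c i η ∈ IsManifold.maximalAtlas (𝓡 (dim i)) ∞ (N i) ∧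
      η ∈ (c i η).source ∧ c i η η = 0 ∧ (c i η).target = Metric.ball 0 r)
    (hmetric : ∀ x, ∀ η : N (idx x),
      MetricC2Bounded (k := dim (idx x)) (fun u ↦ (τ x).symm ((c (idx x) η).symm u)) r K)
    -- the fiber diffeomorphisms, with uniformly bounded first and second derivatives
    (F : ∀ x, E x ≃ₘ^2⟮𝓡 (dim (idx x)), 𝓡 (dim (idx (f x)))⟯ E (f x))
    (L : ℝ)
    (hF : ∀ x, ∀ ξ : E x,
      ‖mfderiv (𝓡 (dim (idx x))) (𝓡 (dim (idx (f x)))) (F x) ξ‖ ≤ L)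
    (hFinv : ∀ x, ∀ ξ : E x,
      ‖(mfderiv (𝓡 (dim (idx x))) (𝓡 (dim (idx (f x)))) (F x) ξ).inverse‖ ≤ L)
    (hFhess : ∀ x, HessianBoundedBy (k := dim (idx x)) (l := dim (idx (f x))) (F x) L)
    -- the ergodic invariant measure and its disintegration
    (M : @Measure (FiberTotal E) (totalSigma 𝓐 fun x ↦ τ x))
    (hM : Ergodic (bundleMap f fun x ↦ F x) M)
    (hMm : ∀ A : Set X, MeasurableSet A → M {p | p.base ∈ A} = m A)
    (Mx : ∀ x, Measure (E x)) (hMx : IsDisintegration m M Mx)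
    -- the sub-σ-algebra is non-increasing and generating
    (h𝓑 : 𝓑 ≤ 𝓐)
    (hnoninc : FinerMod0 𝓑 (𝓑.comap f) m)
    (hgen : FinerMod0 (⨆ k : ℤ, 𝓑.comap ((f.toEquiv ^ k : Equiv.Perm X) : X → X)) 𝓐 m)
    -- the fibers, as Riemannian manifolds, depend on `x` in a `𝓑`-measurable way
    (hidx : Measurable[𝓑] idx)
    (hg : Measurable[totalSigma (E := fun x ↦ TangentBundle (𝓡 (dim (idx x))) (E x))
        (N := fun i ↦ TangentBundle (𝓡 (dim i)) (N i)) 𝓑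
        (fun x ↦ tangentMap (𝓡 (dim (idx x))) (𝓡 (dim (idx x))) (τ x))]
      fun p : FiberTotal (fun x ↦ TangentBundle (𝓡 (dim (idx x))) (E x)) ↦ ‖p.point.2‖)
    -- the diffeomorphisms `F x` depend on `x` in a `𝓑`-measurable way
    (hF𝓑 : Measurable[totalSigma 𝓑 fun x ↦ τ x, borel (Σ i, N i)]
      fun p : FiberTotal E ↦ (coord (fun x ↦ τ x) (bundleMap f (fun x ↦ F x) p)).2)
    -- the smallest fiber exponent is non-negative
    (hγ : ∀ᵐ p ∂M, 0 ≤ lowerExponent (fun x ↦ dim (idx x)) f (fun x ↦ F x) p) :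
    ∃ κ : ∀ x, Measure (E x),
      MeasurableFamily 𝓑 (totalSigma 𝓑 fun x ↦ τ x) κ ∧ ∀ᵐ x ∂m, Mx x = κ x := by
  have hK1 : 1 ≤ max K 1 := le_max_right _ _
  have hL1 : 1 ≤ max L 1 := le_max_right _ _
  have hfin : ∀ x, ∀ ξ η : E x, Manifold.riemannianEDist (𝓡 (dim (idx x))) ξ η ≠ ⊤ :=
    fun x ξ η => ((hdiam x ξ η).trans_lt ENNReal.coe_lt_top).ne
  have hchart : ∀ x y, IsBoundedChart (pullbackChart (τ x) (c (idx x) y)) r (max K 1) :=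
    fun x y => isBoundedChart_pullbackChart (τ x) (hc _ y).1 (hc _ y).2.2.2
      ((hmetric x y).mono hK (le_max_left _ _))
  have hFL : ∀ x (ξ : E x) v, tangentNorm (F x ξ)
      (coordDeriv (k := dim (idx x)) (l := dim (idx (f x))) (F x) ξ v) ≤
      max L 1 * tangentNorm ξ v :=
    fun x ξ v => tangentNorm_coordDeriv_le ((hF x ξ).trans (le_max_left _ _)) v
  have hFL' : ∀ x (ξ : E x) v, tangentNorm ξ v ≤ max L 1 * tangentNorm (F x ξ)
      (coordDeriv (k := dim (idx x)) (l := dim (idx (f x))) (F x) ξ v) := fun x ξ v =>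
    (tangentNorm_le_norm_inverse_mul
      (isInvertible_mfderiv_diffeomorph (F x) (by norm_num) ξ) v).trans
      (mul_le_mul_of_nonneg_right ((hFinv x ξ).trans (le_max_left _ _)) (tangentNorm_nonneg _ _))
  have hH : ∀ x, HessianBoundedBy (k := dim (idx x)) (l := dim (idx (f x))) (F x) (max L 1) :=
    fun x => (hFhess x).mono (le_max_left _ _)
  -- The chart and dynamics bounds stay true for larger constants, which may thus be taken at least `1`.
  generalize max K 1 = K' at hK1 hchart
  generalize max L 1 = L' at hL1 hFL hFL' hH
  have hK0 : 0 < K' := by linarith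
  obtain ⟨d, hd, hdist⟩ := exists_metricSpace_models τ c (fun i y => (hc i y).2.1) hK0 hchart hfin
  have hcontr := exists_riemannianDist_le_norm_inverse_mul (dim := fun x ↦ dim (idx x)) (f := f)
    (F := F) (φ := fun x ξ => pullbackChart (τ x) (c (idx x) (τ x ξ))) hr hK1 hL1
    (fun x ξ => ⟨hchart x _, mem_pullbackChart_source (τ x) (hc _ _).2.1, (hc _ _).2.2.1⟩)
    hfin hFL hFL' hH
  choose δ hδ hcontr using hcontr
  have hlip : ∀ x ξ η, (d _).dist (τ x ξ) (τ x η) ≤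
      K' * L' * K' * (d _).dist (τ (f x) (F x ξ)) (τ (f x) (F x η)) := fun x ξ η => by
    have h2 : riemannianDist (dim (idx x)) ξ η ≤
        L' * riemannianDist (dim (idx (f x))) (F x ξ) (F x η) :=
      riemannianDist_le_comp (F x) (by norm_num) (by linarith) (hFL' x) (hfin _ _ _)
    calc _ ≤ K' * (L' * (K' * (d _).dist (τ (f x) (F x ξ)) (τ (f x) (F x η)))) :=
          (hdist x ξ η).1.trans (mul_le_mul_of_nonneg_left (h2.trans
            (mul_le_mul_of_nonneg_left (hdist _ _ _).2 (by linarith))) hK0.le)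
      _ = _ := by ring
  have hexp : ∀ θ > 0, ∀ᵐ p ∂M, ∀ᶠ n : ℕ in atTop, ∀ η : E p.base,
      (d _).dist (τ _ (fiberIter f (fun x => F x) n p.base p.point))
        (τ _ (fiberIter f (fun x => F x) n p.base η)) < δ n / K' →
      (d _).dist (τ _ p.point) (τ _ η) ≤ Real.exp (θ * n) *
        (d _).dist (τ _ (fiberIter f (fun x => F x) n p.base p.point))
          (τ _ (fiberIter f (fun x => F x) n p.base η)) := fun θ hθ => by
    have hK' : ∀ᶠ n : ℕ in atTop, 2 * K' ^ 4 ≤ Real.exp (θ / 2 * n) :=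
      (Real.tendsto_exp_atTop.comp (tendsto_natCast_atTop_atTop.const_mul_atTop
        (half_pos hθ))).eventually_ge_atTop _
    refine hγ.mono fun p hp => ?_
    have hinv := eventually_norm_inverse_mfderiv_fiberIter_le (dim := fun x ↦ dim (idx x))
      (f := f) (F := fun x => F x) (p := p) hL1 (fun n =>
      norm_inverse_mfderiv_fiberIter_le (dim := fun x ↦ dim (idx x)) (F := F) hL1 hFL' n p.base
        p.point) hp (half_pos hθ)
    refine (hK'.and hinv).mono fun n hn η hη => ?_
    have h1 := (hdist p.base p.point η).1
    have h3 := (hdist (f^[n] p.base) (fiberIter f (fun x => F x) n p.base p.point)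
      (fiberIter f (fun x => F x) n p.base η)).2
    have h2 := hcontr n p.base p.point η (h3.trans_lt ((lt_div_iff₀' hK0).1 hη))
    have hd0 := @dist_nonneg _ (d (idx (f^[n] p.base))).toPseudoMetricSpace
      (τ _ (fiberIter f (fun x => F x) n p.base p.point))
      (τ _ (fiberIter f (fun x => F x) n p.base η))
    have ha0 := ContinuousLinearMap.opNorm_nonneg
      (mfderiv (𝓡 (dim (idx p.base))) (𝓡 (dim (idx (f^[n] p.base))))
        (fiberIter f (fun x => F x) n p.base) p.point).inverse
    exact h1.trans (le_exp_mul_of_le hK0.le h2 h3 ha0 hn.2 hn.1 hd0)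
  have hnet : ∀ i ∈ Set.range idx, ∃ C Q : ℝ, ∀ k : ℕ, ∃ S : Finset (N i),
      (S.card : ℝ) ≤ C * Q ^ k ∧ ∀ y, ∃ s ∈ S, (d i).dist y s < (1 / 2) ^ k := by
    rintro _ ⟨x, rfl⟩
    refine exists_nets_of_lipschitz_charts (d (idx x)).dist (c (idx x)) (R := r) (B := K' * √K')
      (by positivity) (fun y => (hc _ y).2.1) (fun y => (hc _ y).2.2.2) fun y u hu v hv => ?_
    have h1 := (hdist x ((τ x).symm ((c (idx x) y).symm u)) ((τ x).symm ((c (idx x) y).symm v))).1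
    rw [(τ x).apply_symm_apply, (τ x).apply_symm_apply] at h1
    refine h1.trans ?_
    rw [mul_assoc]
    exact mul_le_mul_of_nonneg_left (ENNReal.toReal_le_of_le_ofReal (by positivity)
      ((hchart x y).riemannianEDist_symm_le hK0.le hu hv)) hK0.le
  exact exists_measurableFamily_of_subexponential_contraction_dist f hf.toMeasurePreserving
    (fun x => (τ x).toHomeomorph) (fun x => F x) (fun x => (F x).continuous) M
    hM.toMeasurePreserving hMm Mx hMx h𝓑 hnoninc hgen hidx hF𝓑 d hd
    (one_le_mul_of_one_le_of_one_le (one_le_mul_of_one_le_of_one_le hK1 hL1) hK1) hlip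
    (fun n => div_pos (hδ n) hK0) hexp hnet
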